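/- Let $n\in\mathbb N$ and $t>0$. Write $\Delta=-\frac1{4\pi}\sum_{i=1}^n\partial^2/\partial x_i^2$, and let $\exp(t\Delta)$ be the (unbounded) operator given by $\mathcal F(\exp(t\Delta)f)(\xi)=e^{t\pi|\xi|^2}\hat f(\xi)$, where $\hat f(\xi)=\mathcal Ff(\xi)=\int_{\mathbb R^n}f(x)e^{-2\pi i x\cdot\xi}\,dx$; its domain in $\mathcal S(\mathbb R^n)$ is the dense set of those $f$ for which $e^{t\pi|\cdot|^2}\hat f\in\mathcal S(\mathbb R^n)$. Let $$p_t(x,y)=t^{-n/2}\exp\Bigl(-\frac{\pi|x-y|^2}{t}\Bigr)$$ be the heat kernel, i.e. the kernel of $\exp(-t\Delta)$. **Theorem.** Let $T:\mathcal S(\mathbb R^n)\to\mathcal S(\mathbb R^n)'$ be a continuous linear operator with Schwartz kernel $\Phi\in\mathcal S(\mathbb R^{2n})'$, that is, $T(f)(g)=\Phi(g\otimes f)$ for all $f,g\in\mathcal S(\mathbb R^n)$, where $(g\otimes f)(x,y)=g(x)f(y)$. Suppose that 1. $T\exp(t\Delta)$ maps $\mathcal S(\mathbb R^n)$ into $\mathcal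 S(\mathbb R^n)'$, in the sense that it extends from the domain of $\exp(t\Delta)$ in $\mathcal S(\mathbb R^n)$ to a continuous linear operator $\mathcal S(\mathbb R^n)\to\mathcal S(\mathbb R^n)'$; 2. $\exp\bigl(\frac{\pi}{t}|x-y|^2\bigr)\Phi$ is a tempered distribution on $\mathbb R^{2n}$, in the sense that the distribution $\varphi\mapsto\Phi\bigl(e^{\frac{\pi}{t}|x-y|^2}\varphi\bigr)$ on $C_c^\infty(\mathbb R^{2n})$ extends to an element of $\mathcal S(\mathbb R^{2n})'$. Then there exist a positive integer $N$ and tempered distributions $M_\alpha\in\mathcal S(\mathbb R^n)'$, for multi-indices $\alpha\in\mathbb N^n$ with $|\alpha|\le N$, such that $$\Phi(x,y)=\sum_{|\alpha|\le N}M_\alpha(x)\,(x-y)^\alpha\,p_t(x,y),$$ which means that for every $F\in\mathcal S(\mathbb R^{2n})$ $$\Phi(F)=\sum_{|\alpha|\le N}M_\alpha\Bigl(x\mapsto\int_{\mathbb R^n}(x-y)^\alpha\,p_t(x,y)\,F(x,y)\,dy\Bigr).$$ -/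

import Mathlib

open scoped SchwartzMap FourierTransform Laplacian ContDiff
open MeasureTheory

noncomputable section

namespace HardyOperators

/-- `ℝⁿ` with its Euclidean norm. The space `ℝ²ⁿ` is represented by `Rn n × Rn n`: its Schwartz
space only depends on the linear topology, and its volume is Lebesgue measure. -/
abbrev Rn (n : ℕ) : Type := EuclideanSpace ℝ (Fin n)

/-! ### Outer tensor products and Schwartz kernels -/

section Outer

variable {n : ℕ}

/-- The outer tensor product `(g ⊗ f)(x, y) = g x * f y` of two Schwartz functions. -/
def outer (g f : 𝓢(Rn n, ℂ)) : 𝓢(Rn n × Rn n, ℂ) where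
  toFun p := g p.1 * f p.2
  smooth' := ((g.smooth ⊤).comp contDiff_fst).mul ((f.smooth ⊤).comp contDiff_snd)
  decay' k m := by
    have hg : ContDiff ℝ ∞ (fun p : Rn n × Rn n => g p.1) := (g.smooth ⊤).comp contDiff_fst
    have hf : ContDiff ℝ ∞ (fun p : Rn n × Rn n => f p.2) := (f.smooth ⊤).comp contDiff_snd
    have bg : ∀ (i : ℕ) (p : Rn n × Rn n),
        ‖iteratedFDeriv ℝ i (fun p : Rn n × Rn n => g p.1) p‖ ≤ ‖iteratedFDeriv ℝ i g p.1‖ := by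
      intro i p
      have h := ContinuousLinearMap.iteratedFDeriv_comp_right
        (ContinuousLinearMap.fst ℝ (Rn n) (Rn n)) (g.smooth ⊤) p (i := i) (mod_cast le_top)
      change ‖iteratedFDeriv ℝ i (g ∘ ContinuousLinearMap.fst ℝ (Rn n) (Rn n)) p‖ ≤ _
      rw [h]
      refine (ContinuousMultilinearMap.norm_compContinuousLinearMap_le _ _).trans ?_
      refine mul_le_of_le_one_right (norm_nonneg _) ?_
      exact Finset.prod_le_one (fun _ _ => norm_nonneg _)
        (fun _ _ => ContinuousLinearMap.norm_fst_le ..)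
    have bf : ∀ (i : ℕ) (p : Rn n × Rn n),
        ‖iteratedFDeriv ℝ i (fun p : Rn n × Rn n => f p.2) p‖ ≤ ‖iteratedFDeriv ℝ i f p.2‖ := by
      intro i p
      have h := ContinuousLinearMap.iteratedFDeriv_comp_right
        (ContinuousLinearMap.snd ℝ (Rn n) (Rn n)) (f.smooth ⊤) p (i := i) (mod_cast le_top)
      change ‖iteratedFDeriv ℝ i (f ∘ ContinuousLinearMap.snd ℝ (Rn n) (Rn n)) p‖ ≤ _
      rw [h]
      refine (ContinuousMultilinearMap.norm_compContinuousLinearMap_le _ _).trans ?_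
      refine mul_le_of_le_one_right (norm_nonneg _) ?_
      exact Finset.prod_le_one (fun _ _ => norm_nonneg _)
        (fun _ _ => ContinuousLinearMap.norm_snd_le ..)
    let sg := fun a b => SchwartzMap.seminorm ℝ a b g
    let sf := fun a b => SchwartzMap.seminorm ℝ a b f
    refine ⟨∑ i ∈ Finset.range (m + 1), (m.choose i : ℝ) *
      (sg k i * sf 0 (m - i) + sg 0 i * sf k (m - i)), fun p => ?_⟩
    have h1 := norm_iteratedFDeriv_mul_le (𝕜 := ℝ) hg hf p (n := m) (mod_cast le_top)
    refine (mul_le_mul_of_nonneg_left h1 (by positivity)).trans ?_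
    rw [Finset.mul_sum]
    refine Finset.sum_le_sum fun i _ => ?_
    have hp : ‖p‖ ^ k ≤ ‖p.1‖ ^ k + ‖p.2‖ ^ k := by
      rw [Prod.norm_def]
      rcases max_cases ‖p.1‖ ‖p.2‖ with h | h <;> rw [h.1]
      · exact le_add_of_nonneg_right (by positivity)
      · exact le_add_of_nonneg_left (by positivity)
    set A := ‖iteratedFDeriv ℝ i g p.1‖
    set B := ‖iteratedFDeriv ℝ (m - i) f p.2‖
    have hA0 : A ≤ sg 0 i := by simpa using SchwartzMap.le_seminorm ℝ 0 i g p.1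
    have hB0 : B ≤ sf 0 (m - i) := by simpa using SchwartzMap.le_seminorm ℝ 0 (m - i) f p.2
    have hAk : ‖p.1‖ ^ k * A ≤ sg k i := SchwartzMap.le_seminorm ℝ k i g p.1
    have hBk : ‖p.2‖ ^ k * B ≤ sf k (m - i) := SchwartzMap.le_seminorm ℝ k (m - i) f p.2
    have hA : 0 ≤ A := norm_nonneg _
    have hB : 0 ≤ B := norm_nonneg _
    calc _ ≤ (‖p.1‖ ^ k + ‖p.2‖ ^ k) * ((m.choose i : ℝ) * A * B) := by
          gcongr
          · exact bg i p
          · exact bf (m - i) p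
      _ = (m.choose i : ℝ) * ((‖p.1‖ ^ k * A) * B + A * (‖p.2‖ ^ k * B)) := by ring
      _ ≤ _ := by
          gcongr

@[simp] theorem outer_apply (g f : 𝓢(Rn n, ℂ)) (x y : Rn n) : outer g f (x, y) = g x * f y := rfl

/-- `Φ` is the Schwartz kernel of the continuous linear operator `T : 𝓢(ℝⁿ) → 𝓢(ℝⁿ)'`. -/
def IsSchwartzKernel (T : 𝓢(Rn n, ℂ) →L[ℂ] 𝓢'(Rn n, ℂ)) (Φ : 𝓢'(Rn n × Rn n, ℂ)) : Prop :=
  ∀ f g : 𝓢(Rn n, ℂ), T f g = Φ (outer g f)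

end Outer

/-! ### Products of a tempered distribution with a smooth function of arbitrary growth -/

section Weight

variable {V : Type*} [NormedAddCommGroup V] [NormedSpace ℝ V]

/-- The product of a smooth function and a smooth compactly supported function. -/
def mulCompact (h : V → ℂ) (hh : ContDiff ℝ ∞ h) (φ : 𝓢(V, ℂ)) (hφ : HasCompactSupport φ) :
    𝓢(V, ℂ) :=
  HasCompactSupport.toSchwartzMap (f := fun v => h v * φ v) hφ.mul_left (hh.mul (φ.smooth ⊤))

@[simp] theorem mulCompact_apply (h : V → ℂ) (hh : ContDiff ℝ ∞ h) (φ : 𝓢(V, ℂ))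
    (hφ : HasCompactSupport φ) (v : V) : mulCompact h hh φ hφ v = h v * φ v := rfl

/-- The distribution `h Φ : φ ↦ Φ (h φ)`, defined on smooth compactly supported `φ`, is tempered,
i.e. it is the restriction of a tempered distribution `Ψ`. -/
def MulIsTempered (h : V → ℂ) (hh : ContDiff ℝ ∞ h) (Φ : 𝓢'(V, ℂ)) : Prop :=
  ∃ Ψ : 𝓢'(V, ℂ), ∀ (φ : 𝓢(V, ℂ)) (hφ : HasCompactSupport φ), Ψ φ = Φ (mulCompact h hh φ hφ)

/-- The function `(x, y) ↦ exp (s π |x - y|²)` on `ℝ²ⁿ`. -/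
def gaussWeight {n : ℕ} (s : ℝ) (p : Rn n × Rn n) : ℂ :=
  (Real.exp (s * Real.pi * ‖p.1 - p.2‖ ^ 2) : ℝ)

theorem contDiff_gaussWeight {n : ℕ} (s : ℝ) : ContDiff ℝ ∞ (gaussWeight (n := n) s) := by
  unfold gaussWeight
  exact Complex.ofRealCLM.contDiff.comp
    (Real.contDiff_exp.comp (contDiff_const.mul ((contDiff_fst.sub contDiff_snd).norm_sq ℝ)))

end Weight

/-! ### The operator `exp (t Δ)` -/

section Heat

variable {n : ℕ}

/-- The positive Laplacian `-(1 / 4π) ∑ᵢ ∂² / ∂xᵢ²`. -/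
def posLaplacian (f : 𝓢(Rn n, ℂ)) : 𝓢(Rn n, ℂ) := (-(1 / (4 * Real.pi)) : ℝ) • Δ f

/-- In the Fourier picture `posLaplacian` is multiplication by `π |ξ|²`. -/
theorem fourier_posLaplacian (f : 𝓢(Rn n, ℂ)) (ξ : Rn n) :
    𝓕 (posLaplacian f) ξ = ((Real.pi * ‖ξ‖ ^ 2 : ℝ) : ℂ) * 𝓕 f ξ := by
  have hT : (fun x : Rn n => ‖x‖ ^ 2).HasTemperateGrowth :=
    Function.hasTemperateGrowth_norm_sq (Rn n)
  rw [posLaplacian, SchwartzMap.laplacian_eq_fourierMultiplierCLM, smul_smul,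
    SchwartzMap.fourierMultiplierCLM_apply, ← FourierTransform.fourierInv_smul,
    FourierTransform.fourier_fourierInv_eq, _root_.smul_apply,
    SchwartzMap.smulLeftCLM_apply_apply (by simpa [Pi.pow_def] using hT), smul_smul,
    Complex.real_smul]
  congr 2
  have := Real.pi_ne_zero
  field_simp
  ring

/-- The graph of the (unbounded) operator `exp (t Δ)`, where `Δ` is `posLaplacian`:
`g = exp (t Δ) f` holds iff `ĝ = exp (t π |·|²) f̂`. The domain in `𝓢(ℝⁿ)` consists of those `f` for
which `exp (t π |·|²) f̂` is a Schwartz function. -/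
def IsExpLaplacian (t : ℝ) (f g : 𝓢(Rn n, ℂ)) : Prop :=
  ∀ ξ : Rn n, 𝓕 g ξ = (Real.exp (t * (Real.pi * ‖ξ‖ ^ 2)) : ℂ) * 𝓕 f ξ

/-- The densely defined operator `f ↦ T (exp (t Δ) f)` extends to a continuous linear operator from
`𝓢(ℝⁿ)` to `𝓢(ℝⁿ)'`. -/
def CompExpLaplacianIsTempered (t : ℝ) (T : 𝓢(Rn n, ℂ) →L[ℂ] 𝓢'(Rn n, ℂ)) : Prop :=
  ∃ S : 𝓢(Rn n, ℂ) →L[ℂ] 𝓢'(Rn n, ℂ),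
    ∀ f g : 𝓢(Rn n, ℂ), IsExpLaplacian t f g → S f = T g

/-- The heat kernel `p_t(x, y) = t^(-n/2) exp (-π |x - y|² / t)`. -/
def heatKernel (t : ℝ) (x y : Rn n) : ℝ :=
  1 / t ^ ((n : ℝ) / 2) * Real.exp (-(Real.pi * ‖x - y‖ ^ 2 / t))

end Heat

/-! ### Pairing a distribution in `x` with an integral in `y` -/

section Fiber

variable {n : ℕ}

theorem fiber_bound {F : Type} [NormedAddCommGroup F] [NormedSpace ℝ F]
    (G : 𝓢(Rn n × Rn n, F)) (k m : ℕ) :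
    ∃ C : ℝ, ∀ x y : Rn n, ‖x‖ ^ k * ‖G (x, y)‖ ≤ C * (1 + ‖y‖) ^ (-(m : ℝ)) := by
  refine ⟨2 ^ (k + m) * ((Finset.Iic (k + m, 0)).sup
    fun q => SchwartzMap.seminorm ℝ q.1 q.2) G, fun x y => ?_⟩
  have h := SchwartzMap.one_add_le_sup_seminorm_apply (𝕜 := ℝ) (m := (k + m, 0))
    (k := k + m) (n := 0) le_rfl le_rfl G (x, y)
  simp only [norm_iteratedFDeriv_zero] at h
  have hx : ‖x‖ ≤ 1 + ‖(x, y)‖ := (norm_fst_le (x, y)).trans (by linarith)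
  have hy : 1 + ‖y‖ ≤ 1 + ‖(x, y)‖ := by linarith [norm_snd_le (x, y)]
  have hpos : (0 : ℝ) < (1 + ‖y‖) ^ m := by positivity
  rw [Real.rpow_neg (by positivity), Real.rpow_natCast, ← div_eq_mul_inv, le_div_iff₀ hpos]
  refine le_trans ?_ h
  rw [pow_add]
  calc ‖x‖ ^ k * ‖G (x, y)‖ * (1 + ‖y‖) ^ m = ‖x‖ ^ k * (1 + ‖y‖) ^ m * ‖G (x, y)‖ := by ring
    _ ≤ _ := by gcongr

theorem fiber_integrable {F : Type} [NormedAddCommGroup F] [NormedSpace ℝ F]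
    (G : 𝓢(Rn n × Rn n, F)) (x : Rn n) : Integrable (fun y => G (x, y)) := by
  obtain ⟨C, hC⟩ := fiber_bound G 0 (volume : Measure (Rn n)).integrablePower
  refine ((Measure.integrable_pow_neg_integrablePower
    (volume : Measure (Rn n))).const_mul C).mono'
    (G.continuous.comp (by fun_prop)).aestronglyMeasurable (.of_forall fun y => ?_)
  simpa using hC x y

/-- The partial derivative of a Schwartz function on `ℝ²ⁿ` in the first variable. -/
def fderivFst {F : Type} [NormedAddCommGroup F] [NormedSpace ℝ F]
    (G : 𝓢(Rn n × Rn n, F)) : 𝓢(Rn n × Rn n, Rn n →L[ℝ] F) :=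
  SchwartzMap.postcompCLM (𝕜 := ℝ)
    ((ContinuousLinearMap.compL ℝ (Rn n) (Rn n × Rn n) F).flip
      (ContinuousLinearMap.inl ℝ (Rn n) (Rn n)))
    (SchwartzMap.fderivCLM ℝ (Rn n × Rn n) F G)

theorem fiber_hasFDerivAt {F : Type} [NormedAddCommGroup F] [NormedSpace ℝ F]
    (G : 𝓢(Rn n × Rn n, F)) (x : Rn n) :
    HasFDerivAt (fun x => ∫ y, G (x, y)) (∫ y, fderivFst G (x, y)) x := by
  obtain ⟨C, hC⟩ := fiber_bound (fderivFst G) 0 (volume : Measure (Rn n)).integrablePower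
  refine hasFDerivAt_integral_of_dominated_of_fderiv_le
    (F := fun x y => G (x, y)) (F' := fun x y => fderivFst G (x, y))
    (bound := fun y => C * (1 + ‖y‖) ^ (-((volume : Measure (Rn n)).integrablePower : ℝ)))
    (s := Set.univ) Filter.univ_mem ?_ (fiber_integrable G x)
    (fiber_integrable (fderivFst G) x).aestronglyMeasurable ?_ ?_ ?_
  · exact .of_forall fun x => (fiber_integrable G x).aestronglyMeasurable
  · exact .of_forall fun y x _ => by simpa using hC x y
  · exact (Measure.integrable_pow_neg_integrablePower (volume : Measure (Rn n))).const_mul C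
  · refine .of_forall fun y x _ => ?_
    have h1 : HasFDerivAt G (fderiv ℝ G (x, y)) (x, y) := G.differentiableAt.hasFDerivAt
    exact h1.comp x (hasFDerivAt_prodMk_left x y)

theorem fiber_contDiff (m : ℕ) : ∀ {F : Type} [NormedAddCommGroup F] [NormedSpace ℝ F]
    (G : 𝓢(Rn n × Rn n, F)), ContDiff ℝ m (fun x => ∫ y, G (x, y)) := by
  induction m with
  | zero =>
    intro F _ _ G
    exact contDiff_zero.2 (continuous_iff_continuousAt.2
      fun x => (fiber_hasFDerivAt G x).continuousAt)
  | succ m ih =>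
    intro F _ _ G
    refine contDiff_succ_iff_fderiv.2
      ⟨fun x => (fiber_hasFDerivAt G x).differentiableAt, fun h => absurd h (by exact_mod_cast WithTop.natCast_ne_top m), ?_⟩
    rw [show fderiv ℝ (fun x => ∫ y, G (x, y)) = fun x => ∫ y, fderivFst G (x, y) from
      funext fun x => (fiber_hasFDerivAt G x).fderiv]
    exact ih (fderivFst G)

theorem fiber_decay (k m : ℕ) : ∀ {F : Type} [NormedAddCommGroup F] [NormedSpace ℝ F]
    (G : 𝓢(Rn n × Rn n, F)),
    ∃ C : ℝ, ∀ x, ‖x‖ ^ k * ‖iteratedFDeriv ℝ m (fun x => ∫ y, G (x, y)) x‖ ≤ C := by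
  induction m with
  | zero =>
    intro F _ _ G
    obtain ⟨C, hC⟩ := fiber_bound G k (volume : Measure (Rn n)).integrablePower
    refine ⟨∫ y : Rn n, C * (1 + ‖y‖) ^ (-((volume : Measure (Rn n)).integrablePower : ℝ)),
      fun x => ?_⟩
    rw [norm_iteratedFDeriv_zero]
    calc ‖x‖ ^ k * ‖∫ y, G (x, y)‖ ≤ ‖x‖ ^ k * ∫ y, ‖G (x, y)‖ := by
          gcongr
          exact norm_integral_le_integral_norm _
      _ = ∫ y, ‖x‖ ^ k * ‖G (x, y)‖ := (integral_const_mul _ _).symm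
      _ ≤ _ := integral_mono ((fiber_integrable G x).norm.const_mul _)
          ((Measure.integrable_pow_neg_integrablePower (volume : Measure (Rn n))).const_mul C)
          (hC x)
  | succ m ih =>
    intro F _ _ G
    obtain ⟨C, hC⟩ := ih (fderivFst G)
    refine ⟨C, fun x => ?_⟩
    rw [← norm_iteratedFDeriv_fderiv,
      show fderiv ℝ (fun x => ∫ y, G (x, y)) = fun x => ∫ y, fderivFst G (x, y) from
        funext fun x => (fiber_hasFDerivAt G x).fderiv]
    exact hC x

/-- For `w` of temperate growth on `ℝ²ⁿ` and a Schwartz function `F` on `ℝ²ⁿ`, the Schwartz function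
`x ↦ ∫ w(x, y) F(x, y) dy` on `ℝⁿ`. -/
def fiberIntegral (w : Rn n × Rn n → ℂ) (hw : w.HasTemperateGrowth) (F : 𝓢(Rn n × Rn n, ℂ)) :
    𝓢(Rn n, ℂ) where
  toFun x := ∫ y, w (x, y) * F (x, y)
  smooth' := by
    have h : (fun x => ∫ y, w (x, y) * F (x, y)) =
        fun x => ∫ y, SchwartzMap.smulLeftCLM ℂ w F (x, y) := by simp [hw]
    rw [h]
    exact contDiff_infty.2 fun m => fiber_contDiff m _
  decay' k m := by
    have h : (fun x => ∫ y, w (x, y) * F (x, y)) =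
        fun x => ∫ y, SchwartzMap.smulLeftCLM ℂ w F (x, y) := by simp [hw]
    rw [h]
    exact fiber_decay k m _

@[simp] theorem fiberIntegral_apply (w : Rn n × Rn n → ℂ) (hw : w.HasTemperateGrowth)
    (F : 𝓢(Rn n × Rn n, ℂ)) (x : Rn n) :
    fiberIntegral w hw F x = ∫ y, w (x, y) * F (x, y) := rfl

/-- The function `(x, y) ↦ (x - y)^α p_t(x, y)` for a multi-index `α`. -/
def polyHeat (t : ℝ) (α : Fin n → ℕ) (p : Rn n × Rn n) : ℂ :=
  (((∏ i, (p.1 i - p.2 i) ^ α i) * heatKernel t p.1 p.2 : ℝ) : ℂ)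

theorem hasTemperateGrowth_exp_of_nonpos {V : Type*} [NormedAddCommGroup V]
    [NormedSpace ℝ V] {q : V → ℝ} (hq : q.HasTemperateGrowth) (h0 : ∀ v, q v ≤ 0) :
    (fun v => Real.exp (q v)).HasTemperateGrowth := by
  refine Function.HasTemperateGrowth.comp' (g := Real.exp) (t := Set.Iic 0)
    (by rintro _ ⟨v, rfl⟩; exact h0 v) (uniqueDiffOn_Iic 0) Real.contDiff_exp.contDiffOn
    (fun N => ⟨0, 1, zero_le_one, fun m _ x hx => ?_⟩) hq
  rw [norm_iteratedFDerivWithin_eq_norm_iteratedDerivWithin,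
    iteratedDerivWithin_eq_iteratedDeriv (uniqueDiffOn_Iic 0) Real.contDiff_exp.contDiffAt hx,
    iteratedDeriv_eq_iterate, Real.iter_deriv_exp]
  simpa using hx

theorem hasTemperateGrowth_prod {V ι : Type*} [NormedAddCommGroup V] [NormedSpace ℝ V]
    (s : Finset ι) {q : ι → V → ℝ} (hq : ∀ i, (q i).HasTemperateGrowth) :
    (fun v => ∏ i ∈ s, q i v).HasTemperateGrowth := by
  classical
  induction s using Finset.induction_on with
  | empty => simp
  | insert i s hi ih =>
    simp only [Finset.prod_insert hi]
    exact (hq i).mul ih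

theorem hasTemperateGrowth_polyHeat {t : ℝ} (ht : 0 < t) (α : Fin n → ℕ) :
    (polyHeat t α).HasTemperateGrowth := by
  have hsub : (fun p : Rn n × Rn n => p.1 - p.2).HasTemperateGrowth :=
    (ContinuousLinearMap.fst ℝ (Rn n) (Rn n) - ContinuousLinearMap.snd ℝ (Rn n) (Rn n)).hasTemperateGrowth
  have hco : ∀ i : Fin n, (fun p : Rn n × Rn n => (p.1 i - p.2 i) ^ α i).HasTemperateGrowth := by
    intro i
    exact (((EuclideanSpace.proj i : Rn n →L[ℝ] ℝ).hasTemperateGrowth).comp hsub).pow (α i)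
  have hq : (fun p : Rn n × Rn n => -(Real.pi / t) * ‖p.1 - p.2‖ ^ 2).HasTemperateGrowth :=
    (Function.HasTemperateGrowth.const _).mul
      ((Function.hasTemperateGrowth_norm_sq (Rn n)).comp hsub)
  have he := hasTemperateGrowth_exp_of_nonpos hq fun p => by
    have := Real.pi_pos
    have h : 0 ≤ Real.pi / t * ‖p.1 - p.2‖ ^ 2 := by positivity
    linarith
  have hk : (fun p : Rn n × Rn n => heatKernel t p.1 p.2).HasTemperateGrowth := by
    have h := (Function.HasTemperateGrowth.const (E := Rn n × Rn n)
      (1 / t ^ ((n : ℝ) / 2) : ℝ)).mul he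
    have heq : (fun p : Rn n × Rn n => heatKernel t p.1 p.2) = fun p =>
        1 / t ^ ((n : ℝ) / 2) * Real.exp (-(Real.pi / t) * ‖p.1 - p.2‖ ^ 2) := by
      funext p
      simp only [heatKernel]
      congr 2
      ring
    rw [heq]
    exact h
  exact Function.Complex.hasTemperateGrowth_ofReal.comp ((hasTemperateGrowth_prod Finset.univ hco).mul hk)

/-- The multi-indices `α ∈ ℕⁿ` with `|α| ≤ N`. -/
def multiIndices (n N : ℕ) : Finset (Fin n → ℕ) :=
  {α ∈ Fintype.piFinset fun _ => Finset.range (N + 1) | ∑ i, α i ≤ N}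

theorem mem_multiIndices {N : ℕ} {α : Fin n → ℕ} : α ∈ multiIndices n N ↔ ∑ i, α i ≤ N := by
  simp only [multiIndices, Finset.mem_filter, Fintype.mem_piFinset, Finset.mem_range,
    Nat.lt_succ_iff, and_iff_right_iff_imp]
  exact fun h i => (Finset.single_le_sum (fun _ _ => Nat.zero_le _) (Finset.mem_univ i)).trans h

end Fiber

end HardyOperators

end

noncomputable section

namespace HardyOperators

/-! ### Series, completeness and bilinear maps on Schwartz space -/

section Series

variable {E F : Type*} [NormedAddCommGroup E] [NormedSpace ℝ E] [NormedAddCommGroup F]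
  [NormedSpace ℝ F]

/-! Let Ψ be the tempered distribution that extends e^{π|x-y|²/t} Φ. The heart of the matter is that
Ψ is polynomial in y: for some N, every Ψ ∘ ∂_{y_i}^{N+1} vanishes. Then Ψ is a finite sum of terms
M_α(x) (x-y)^α, and multiplying by e^{-π|x-y|²/t} gives the formula for Φ.

The argument is the one behind Hardy's uncertainty principle. Test Ψ on the Gaussians exp(-πb|x|² -
πc|y-κx|² + 2πiθ·x + 2πζ·(y-κx)), ζ ∈ ℂⁿ, and multiply the value by exp(-πζ²/c); this is `famQ`.
With this normalisation ∂/∂ζ_i replaces Ψ by -(1/c) Ψ ∘ ∂_{y_i} (`hasDerivAt_famQ`). Imaginary ζ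
already give all modulations of one Gaussian, and these span a dense subspace
(`eq_zero_of_apply_gaussExp`). So it suffices that `famQ` is polynomial, of bounded degree, in each
ζ_i with the other coordinates imaginary.

Two bounds force this. Temperedness of Ψ bounds `famQ` in one coordinate s by a polynomial times
exp(π (Im s)²/c) (`famQ_growth`). For κ = 1/2, b = 1/t, c = 2/t the test Gaussian is e^{-π|x-y|²/t}
g(x) f(y) with f in the range of exp(tΔ); the continuous extension of T exp(tΔ) then gives a
polynomial bound at ζ = iq (`exists_derivSnd_pow_eq_zero`). A Phragmén–Lindelöf argument in each
quadrant (`norm_le_of_growth`) and Cauchy's estimates conclude.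

For the expansion (`exists_expansion`), κ = b = c = 1 is used. There `famQ` has degree at most N in
each ζ_i, so Lagrange interpolation recovers it from the grid {0,…,N}ⁿ. Written in Gaussian moments,
the Lagrange polynomials are exactly the fibre integrals of (x-y)^α against the test Gaussians, and
the M_α can be read off. -/

theorem summable_iteratedFDeriv_bound {ι : Type*} {f : ι → 𝓢(E, F)}
    (h : ∀ k m, Summable fun i => SchwartzMap.seminorm ℝ k m (f i)) (k m : ℕ) [CompleteSpace F]
    (x : E) : ‖x‖ ^ k * ‖iteratedFDeriv ℝ m (fun y => ∑' i, f i y) x‖ ≤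
      ∑' i, SchwartzMap.seminorm ℝ k m (f i) := by
  have hd := iteratedFDeriv_tsum (𝕜 := ℝ) (f := fun i => (f i : E → F)) (N := ⊤)
    (v := fun m i => SchwartzMap.seminorm ℝ 0 m (f i))
    (fun i => (f i).smooth ⊤) (fun m _ => h 0 m)
    (fun m i x _ => SchwartzMap.norm_iteratedFDeriv_le_seminorm ℝ (f i) m x) (k := m) le_top
  rw [hd]
  have hs : Summable fun i => ‖iteratedFDeriv ℝ m (f i) x‖ :=
    (h 0 m).of_nonneg_of_le (fun _ => norm_nonneg _)
      fun i => SchwartzMap.norm_iteratedFDeriv_le_seminorm ℝ (f i) m x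
  calc _ ≤ ‖x‖ ^ k * ∑' i, ‖iteratedFDeriv ℝ m (f i) x‖ := by
        gcongr
        exact norm_tsum_le_tsum_norm hs
    _ = ∑' i, ‖x‖ ^ k * ‖iteratedFDeriv ℝ m (f i) x‖ := tsum_mul_left.symm
    _ ≤ _ := (hs.mul_left _).tsum_le_tsum (fun i => SchwartzMap.le_seminorm ℝ k m (f i) x) (h k m)

theorem seminorm_le_tsum_of_hasSum [CompleteSpace F] {ι : Type*} {f : ι → 𝓢(E, F)} {G : 𝓢(E, F)}
    (h : ∀ k m, Summable fun i => SchwartzMap.seminorm ℝ k m (f i))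
    (hG : ∀ x, HasSum (fun i => f i x) (G x)) (k m : ℕ) :
    SchwartzMap.seminorm ℝ k m G ≤ ∑' i, SchwartzMap.seminorm ℝ k m (f i) := by
  refine SchwartzMap.seminorm_le_bound ℝ k m G (tsum_nonneg fun i => apply_nonneg _ _) fun x => ?_
  have : (G : E → F) = fun y => ∑' i, f i y := funext fun y => (hG y).tsum_eq.symm
  rw [this]
  exact summable_iteratedFDeriv_bound h k m x

/-- Each seminorm of the remainder after a finite partial sum is at most the corresponding tail of
the series of seminorms. This turns pointwise power series and Fourier expansions into convergence
that a tempered distribution respects. -/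
theorem hasSum_of_summable_seminorm [CompleteSpace F] {ι : Type*} {f : ι → 𝓢(E, F)} {G : 𝓢(E, F)}
    (h : ∀ k m, Summable fun i => SchwartzMap.seminorm ℝ k m (f i))
    (hG : ∀ x, HasSum (fun i => f i x) (G x)) : HasSum f G := by
  refine ((schwartz_withSeminorms ℝ E F).tendsto_nhds _ G).2 fun ⟨k, m⟩ ε hε => ?_
  have h0 := tendsto_tsum_compl_atTop_zero fun i => SchwartzMap.seminorm ℝ k m (f i)
  filter_upwards [h0.eventually_lt_const hε] with s hs
  refine lt_of_le_of_lt ?_ hs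
  rw [map_sub_rev, SchwartzMap.schwartzSeminormFamily_apply]
  refine seminorm_le_tsum_of_hasSum (f := fun i : {i // i ∉ s} => f i)
    (fun k m => (h k m).subtype _) (fun x => ?_) k m
  have h1 := (s.hasSum_compl_iff (f := fun i => f i x) (a := G x - ∑ i ∈ s, f i x)).2
    (by simpa using hG x)
  simpa [sum_apply] using h1

theorem exists_hasSum_of_summable_seminorm [CompleteSpace F] {ι : Type*} {f : ι → 𝓢(E, F)}
    (h : ∀ k m, Summable fun i => SchwartzMap.seminorm ℝ k m (f i)) : ∃ G, HasSum f G := by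
  let G : 𝓢(E, F) :=
    { toFun := fun y => ∑' i, f i y
      smooth' := contDiff_tsum (𝕜 := ℝ) (N := ⊤)
        (v := fun m i => SchwartzMap.seminorm ℝ 0 m (f i)) (fun i => (f i).smooth ⊤)
        (fun m _ => h 0 m)
        (fun m i x _ => SchwartzMap.norm_iteratedFDeriv_le_seminorm ℝ (f i) m x)
      decay' := fun k m => ⟨_, summable_iteratedFDeriv_bound h k m⟩ }
  refine ⟨G, hasSum_of_summable_seminorm h fun x => ?_⟩
  have hs : Summable fun i => f i x :=
    Summable.of_norm_bounded (h 0 0) fun i => SchwartzMap.norm_le_seminorm ℝ (f i) x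
  exact hs.hasSum

instance [CompleteSpace F] : (uniformity 𝓢(E, F)).IsCountablyGenerated :=
  IsUniformAddGroup.uniformity_countably_generated

theorem continuous_finsetSup_seminorm (s : Finset (ℕ × ℕ)) :
    Continuous (s.sup (fun q => schwartzSeminormFamily ℝ E F q) : Seminorm ℝ 𝓢(E, F)) := by
  refine Seminorm.continuous_of_le (q := ∑ q ∈ s, schwartzSeminormFamily ℝ E F q)
    ?_ (Seminorm.finset_sup_le_sum _ _)
  have : ((∑ q ∈ s, schwartzSeminormFamily ℝ E F q : Seminorm ℝ 𝓢(E, F)) : 𝓢(E, F) → ℝ) =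
      fun f => ∑ q ∈ s, schwartzSeminormFamily ℝ E F q f := by
    ext f
    simp [sum_apply]
  rw [this]
  exact continuous_finsetSum _ fun q _ => (schwartz_withSeminorms ℝ E F).continuous_seminorm q

/-- A Cauchy sequence has a subsequence whose `j`-th step is below 2^{-j} in the `j`-th graded
seminorm; a fixed seminorm is dominated from some `j` on, so the telescoping series converges.
Completeness is what makes Banach–Steinhaus available below. -/
instance [CompleteSpace F] : CompleteSpace 𝓢(E, F) := by
  refine UniformSpace.complete_of_cauchySeq_tendsto fun u hu => ?_
  let P : ℕ → Seminorm ℝ 𝓢(E, F) := fun j => (Finset.Iic (j, j)).sup (schwartzSeminormFamily ℝ E F)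
  have hP : ∀ k m j, k ≤ j → m ≤ j → ∀ f, SchwartzMap.seminorm ℝ k m f ≤ P j f := by
    intro k m j hk hm f
    exact Seminorm.le_finset_sup_apply (p := schwartzSeminormFamily ℝ E F) (i := (k, m))
      (by simp [hk, hm])
  have hPc : ∀ j, Continuous (P j) := fun j => continuous_finsetSup_seminorm _
  have hV : ∀ j, {a : 𝓢(E, F) × 𝓢(E, F) | P j (a.2 - a.1) < (1 / 2) ^ j} ∈
      uniformity 𝓢(E, F) := by
    intro j
    rw [uniformity_eq_comap_nhds_zero]
    refine ⟨{f | P j f < (1 / 2) ^ j}, ?_, fun a ha => ha⟩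
    exact (isOpen_lt (hPc j) continuous_const).mem_nhds (by simp)
  obtain ⟨φ, hφ, hφV⟩ := hu.subseq_mem hV
  obtain ⟨G, hG⟩ := exists_hasSum_of_summable_seminorm
    (f := fun j => u (φ (j + 1)) - u (φ j)) fun k m => by
      refine Summable.of_norm_bounded_eventually_nat (g := fun j => (1 / 2 : ℝ) ^ j)
        (summable_geometric_of_lt_one (by norm_num) (by norm_num)) ?_
      filter_upwards [Filter.eventually_ge_atTop k, Filter.eventually_ge_atTop m] with j hk hm
      rw [Real.norm_of_nonneg (apply_nonneg _ _), map_sub_rev]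
      exact (hP k m j hk hm _).trans (hφV j).le
  refine ⟨G + u (φ 0), tendsto_nhds_of_cauchySeq_of_subseq hu hφ.tendsto_atTop ?_⟩
  have h1 := hG.tendsto_sum_nat.add_const (u (φ 0))
  simpa [Finset.sum_range_sub (fun j => u (φ j)), Function.comp_def] using h1

end Series

/-! ### Separately continuous bilinear forms on Schwartz spaces. -/

section Bilinear

variable {E E' : Type*} [NormedAddCommGroup E] [NormedSpace ℝ E]
  [NormedAddCommGroup E'] [NormedSpace ℝ E']

/-- The increasing sequence of continuous seminorms defining the topology of Schwartz space. -/
def gradedSeminorm (E : Type*) [NormedAddCommGroup E] [NormedSpace ℝ E] (j : ℕ) :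
    Seminorm ℂ 𝓢(E, ℂ) := (Finset.Iic (j, j)).sup (schwartzSeminormFamily ℂ E ℂ)

theorem gradedSeminorm_mono {i j : ℕ} (h : i ≤ j) (f : 𝓢(E, ℂ)) :
    gradedSeminorm E i f ≤ gradedSeminorm E j f := by
  refine Finset.sup_mono (f := schwartzSeminormFamily ℂ E ℂ) ?_ f
  exact Finset.Iic_subset_Iic.2 ⟨h, h⟩

theorem finsetSup_le_gradedSeminorm (s : Finset (ℕ × ℕ)) : ∃ j, ∀ f,
    s.sup (schwartzSeminormFamily ℂ E ℂ) f ≤ gradedSeminorm E j f := by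
  refine ⟨s.sup fun q => max q.1 q.2, fun f => ?_⟩
  refine Finset.sup_mono (f := schwartzSeminormFamily ℂ E ℂ) (fun q hq => ?_) f
  have := Finset.le_sup (f := fun q : ℕ × ℕ => max q.1 q.2) hq
  simp only [Finset.mem_Iic, Prod.le_def]
  exact ⟨(le_max_left _ _).trans this, (le_max_right _ _).trans this⟩

theorem norm_apply_le_gradedSeminorm (j : ℕ) (f : 𝓢(E, ℂ)) (x : E) :
    ‖f x‖ ≤ gradedSeminorm E j f :=
  (SchwartzMap.norm_le_seminorm ℂ f x).trans
    (Seminorm.le_finset_sup_apply (p := schwartzSeminormFamily ℂ E ℂ) (i := (0, 0)) (by simp))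

theorem gradedSeminorm_pos {j : ℕ} {f : 𝓢(E, ℂ)} (hf : f ≠ 0) : 0 < gradedSeminorm E j f := by
  refine (apply_nonneg _ _).lt_of_ne fun h => hf ?_
  ext x
  simpa [← h] using norm_apply_le_gradedSeminorm j f x

theorem tendsto_zero_of_gradedSeminorm {f : ℕ → 𝓢(E, ℂ)} {a : ℕ → ℝ}
    (ha : Filter.Tendsto a Filter.atTop (nhds 0)) (h : ∀ j, gradedSeminorm E j (f j) ≤ a j) :
    Filter.Tendsto f Filter.atTop (nhds 0) := by
  refine ((schwartz_withSeminorms ℂ E ℂ).tendsto_nhds _ _).2 fun q ε hε => ?_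
  filter_upwards [ha.eventually_lt_const hε, Filter.eventually_ge_atTop (max q.1 q.2)] with j hj hq
  rw [sub_zero]
  refine lt_of_le_of_lt ((Seminorm.le_finset_sup_apply (p := schwartzSeminormFamily ℂ E ℂ)
    (i := q) ?_).trans (h j)) hj
  simp only [Finset.mem_Iic, Prod.le_def]
  exact ⟨(le_max_left _ _).trans hq, (le_max_right _ _).trans hq⟩

theorem exists_bound_of_continuous (L : 𝓢(E, ℂ) →L[ℂ] ℂ) :
    ∃ (j : ℕ) (C : ℝ), 0 ≤ C ∧ ∀ f, ‖L f‖ ≤ C * gradedSeminorm E j f := by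
  obtain ⟨s, C, -, h⟩ := Seminorm.bound_of_continuous (schwartz_withSeminorms ℂ E ℂ)
    ((normSeminorm ℂ ℂ).comp L.toLinearMap) (continuous_norm.comp L.continuous)
  obtain ⟨j, hj⟩ := finsetSup_le_gradedSeminorm (E := E) s
  exact ⟨j, C, C.2, fun f => (h f).trans (mul_le_mul_of_nonneg_left (hj f) C.2)⟩

/-- A separately continuous bilinear form on Schwartz spaces is jointly continuous. -/
theorem exists_bound_of_separately_continuous (S : 𝓢(E, ℂ) →L[ℂ] 𝓢'(E', ℂ)) :
    ∃ (j : ℕ) (C : ℝ), 0 ≤ C ∧ ∀ f g, ‖S f g‖ ≤ C * gradedSeminorm E j f * gradedSeminorm E' j g := by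
  by_contra! hcon
  have h1 : ∀ j : ℕ, ∃ (f : 𝓢(E, ℂ)) (g : 𝓢(E', ℂ)), gradedSeminorm E j f ≤ 1 / (j + 1) ∧
      gradedSeminorm E' j g ≤ 1 ∧ (j : ℝ) < ‖S f g‖ := by
    intro j
    -- The factor `j + 1` pays for shrinking `f` to seminorm 1/(j+1), so that the normalised pair
    -- still has value above `j`.
    obtain ⟨f, g, h⟩ := hcon j (j * (j + 1)) (by positivity)
    have hf : f ≠ 0 := by
      rintro rfl
      simp at h
    have hg : g ≠ 0 := by
      rintro rfl
      simp at h
    have pf := gradedSeminorm_pos (j := j) hf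
    have pg := gradedSeminorm_pos (j := j) hg
    refine ⟨(((1 / (j + 1) / gradedSeminorm E j f : ℝ)) : ℂ) • f,
      (((gradedSeminorm E' j g)⁻¹ : ℝ) : ℂ) • g, ?_, ?_, ?_⟩
    · rw [map_smul_eq_mul, Complex.norm_real, Real.norm_of_nonneg (by positivity)]
      field_simp
      rfl
    · rw [map_smul_eq_mul, Complex.norm_real, Real.norm_of_nonneg (by positivity)]
      field_simp
      rfl
    · rw [map_smul, map_smul, smul_apply, smul_eq_mul, smul_eq_mul, norm_mul, norm_mul,
        Complex.norm_real, Complex.norm_real, Real.norm_of_nonneg (by positivity),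
        Real.norm_of_nonneg (by positivity)]
      field_simp
      nlinarith
  choose f g hf hg hfg using h1
  have hf0 : Filter.Tendsto f Filter.atTop (nhds 0) :=
    tendsto_zero_of_gradedSeminorm tendsto_one_div_add_atTop_nhds_zero_nat hf
  let A : ℕ → 𝓢(E', ℂ) →L[ℂ] ℂ := fun j => S (f j)
  have hbdd : ∀ (_ : Fin 1) (x : 𝓢(E', ℂ)),
      BddAbove (Set.range fun j => normSeminorm ℂ ℂ (A j x)) := by
    intro _ x
    have : Filter.Tendsto (fun j => S (f j) x) Filter.atTop (nhds (S 0 x)) :=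
      ((PointwiseConvergenceCLM.evalCLM (RingHom.id ℂ) ℂ x).continuous.comp
        S.continuous).continuousAt.tendsto.comp hf0
    exact this.norm.bddAbove_range
  -- Since `f j` tends to 0, the functionals `S (f j)` are pointwise bounded; equicontinuity then
  -- bounds them all by one continuous seminorm.
  have heq : UniformEquicontinuous (DFunLike.coe ∘ A) :=
    (norm_withSeminorms ℂ ℂ).banach_steinhaus hbdd
  obtain ⟨p, hp, hAp⟩ := ((norm_withSeminorms ℂ ℂ).uniformEquicontinuous_iff_exists_continuous_seminorm
    (fun j => (A j).toLinearMap)).1 heq 0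
  obtain ⟨s, C, -, hC⟩ := Seminorm.bound_of_continuous (schwartz_withSeminorms ℂ E' ℂ) p hp
  obtain ⟨i, hi⟩ := finsetSup_le_gradedSeminorm (E := E') s
  obtain ⟨m, hm⟩ := exists_nat_ge (C : ℝ)
  -- At this index the seminorm bound gives at most `C ≤ m ≤ j`, against the value above `j`.
  set j := max i m
  have h1 : ‖S (f j) (g j)‖ ≤ p (g j) := hAp j (g j)
  have h2 : p (g j) ≤ C * s.sup (schwartzSeminormFamily ℂ E' ℂ) (g j) := hC (g j)
  have h3 : gradedSeminorm E' i (g j) ≤ 1 :=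
    (gradedSeminorm_mono (le_max_left i m) _).trans (hg j)
  have h4 : (m : ℝ) ≤ j := by exact_mod_cast le_max_right i m
  have h5 : (C : ℝ) * s.sup (schwartzSeminormFamily ℂ E' ℂ) (g j) ≤ C * 1 :=
    mul_le_mul_of_nonneg_left ((hi _).trans h3) C.2
  linarith [hfg j]

end Bilinear

/-! ### Density of compactly supported functions -/

section Density

variable {E : Type*} [NormedAddCommGroup E] [NormedSpace ℝ E] [FiniteDimensional ℝ E]

theorem exists_cutoff (E : Type*) [NormedAddCommGroup E] [NormedSpace ℝ E]
    [FiniteDimensional ℝ E] : ∃ χ : E → ℂ, ContDiff ℝ ∞ χ ∧ HasCompactSupport χ ∧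
      ∀ v, ‖v‖ ≤ 1 → χ v = 1 := by
  let b : ContDiffBump (0 : E) := ⟨1, 2, by norm_num, by norm_num⟩
  refine ⟨fun v => (b v : ℂ), Complex.ofRealCLM.contDiff.comp b.contDiff,
    b.hasCompactSupport.comp_left (g := Complex.ofReal) Complex.ofReal_zero, fun v hv => ?_⟩
  simp [b.one_of_mem_closedBall (x := v) (by simpa using hv)]

/-- The approximants are χ(c_j v) φ(v) with c_j = 1/(j+1). The error vanishes near every v with
c_j|v| < 1; elsewhere 1 ≤ c_j|v|, so spending one more power of |v| on φ buys a factor c_j. -/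
theorem exists_hasCompactSupport_tendsto (φ : 𝓢(E, ℂ)) : ∃ u : ℕ → 𝓢(E, ℂ),
    (∀ j, HasCompactSupport (u j)) ∧ Filter.Tendsto u Filter.atTop (nhds φ) := by
  obtain ⟨χ, hχ, hχc, hχ1⟩ := exists_cutoff E
  let c : ℕ → ℝ := fun j => 1 / (j + 1)
  have hc0 : ∀ j, 0 < c j := fun j => by positivity
  have hc1 : ∀ j, c j ≤ 1 := fun j => by
    simp only [c]
    rw [div_le_one (by positivity)]
    have : (0 : ℝ) ≤ j := by positivity
    linarith
  let A : ℕ → E →L[ℝ] E := fun j => c j • ContinuousLinearMap.id ℝ E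
  have hA : ∀ j, ‖A j‖ ≤ 1 := fun j => by
    refine (norm_smul_le (c j) (ContinuousLinearMap.id ℝ E)).trans ?_
    rw [Real.norm_of_nonneg (hc0 j).le]
    exact mul_le_one₀ (hc1 j) (norm_nonneg _) ContinuousLinearMap.norm_id_le
  let η : E → ℂ := fun v => 1 - χ v
  have hη : ContDiff ℝ ∞ η := contDiff_const.sub hχ
  have hB : ∀ i, ∃ B, 0 ≤ B ∧ ∀ v, ‖iteratedFDeriv ℝ i η v‖ ≤ B := by
    intro i
    obtain ⟨B, hB⟩ := (hχc.iteratedFDeriv (𝕜 := ℝ) i).exists_bound_of_continuous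
      (hχ.continuous_iteratedFDeriv (m := i) (mod_cast le_top))
    refine ⟨1 + B, by linarith [(norm_nonneg _).trans (hB 0)], fun v => ?_⟩
    have h1 : iteratedFDeriv ℝ i η v =
        iteratedFDeriv ℝ i (fun _ : E => (1 : ℂ)) v - iteratedFDeriv ℝ i χ v :=
      iteratedFDeriv_sub_apply (contDiff_const.contDiffAt)
        ((hχ.of_le (mod_cast le_top)).contDiffAt)
    rw [h1]
    refine (norm_sub_le _ _).trans (add_le_add ?_ (hB v))
    rcases i with _ | i
    · simp
    · simp [iteratedFDeriv_const_of_ne]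
  choose B hB0 hB using hB
  have hcs : ∀ j, HasCompactSupport fun v => χ (A j v) * φ v := by
    intro j
    have : HasCompactSupport fun v => χ (A j v) := by
      refine hχc.comp_isClosedEmbedding (g := fun v => A j v) ?_
      exact (Homeomorph.smulOfNeZero (c j) (hc0 j).ne').isClosedEmbedding
    exact this.mul_right
  have hsm : ∀ j, ContDiff ℝ ∞ fun v => χ (A j v) * φ v := fun j =>
    (hχ.comp (A j).contDiff).mul (φ.smooth ⊤)
  refine ⟨fun j => (hcs j).toSchwartzMap (hsm j), fun j => hcs j, ?_⟩
  refine ((schwartz_withSeminorms ℝ E ℂ).tendsto_nhds _ φ).2 fun ⟨k, m⟩ ε hε => ?_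
  let K : ℝ := ∑ i ∈ Finset.range (m + 1), (m.choose i : ℝ) * B i *
    SchwartzMap.seminorm ℝ (k + 1) (m - i) φ
  have hK : 0 ≤ K := Finset.sum_nonneg fun i _ =>
    mul_nonneg (mul_nonneg (by positivity) (hB0 i)) (apply_nonneg _ _)
  have hlim : Filter.Tendsto (fun j => c j * K) Filter.atTop (nhds 0) := by
    simpa [c] using tendsto_one_div_add_atTop_nhds_zero_nat.mul_const K
  filter_upwards [hlim.eventually_lt_const hε] with j hj
  refine lt_of_le_of_lt ?_ hj
  rw [map_sub_rev, SchwartzMap.schwartzSeminormFamily_apply]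
  refine SchwartzMap.seminorm_le_bound ℝ k m _ (mul_nonneg (hc0 j).le hK) fun v => ?_
  have hfun : (φ - (hcs j).toSchwartzMap (hsm j) : 𝓢(E, ℂ)) = fun v => η (A j v) * φ v := by
    ext v
    simp [η, sub_mul]
  rw [hfun]
  by_cases hv : ‖c j • v‖ < 1
  · have : (fun v => η (A j v) * φ v) =ᶠ[nhds v] fun _ => 0 := by
      have hopen : {v : E | ‖c j • v‖ < 1} ∈ nhds v :=
        (isOpen_lt (by fun_prop) continuous_const).mem_nhds hv
      filter_upwards [hopen] with w hw
      simp [η, A, hχ1 _ (le_of_lt hw)]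
    rw [(Filter.EventuallyEq.iteratedFDeriv ℝ this m).eq_of_nhds]
    simp only [iteratedFDeriv_fun_zero, Pi.zero_apply, norm_zero, mul_zero]
    exact mul_nonneg (hc0 j).le hK
  · have hv1 : 1 ≤ c j * ‖v‖ := by
      rw [norm_smul, Real.norm_of_nonneg (hc0 j).le] at hv
      exact not_lt.1 hv
    have h1 := norm_iteratedFDeriv_mul_le (𝕜 := ℝ) (hη.comp (A j).contDiff) (φ.smooth ⊤) v (n := m)
      (mod_cast le_top)
    refine (mul_le_mul_of_nonneg_left h1 (by positivity)).trans ?_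
    simp only [K]
    rw [Finset.mul_sum, Finset.mul_sum]
    refine Finset.sum_le_sum fun i _ => ?_
    have h2 : ‖iteratedFDeriv ℝ i (η ∘ A j) v‖ ≤ B i := by
      rw [ContinuousLinearMap.iteratedFDeriv_comp_right (A j) hη v (mod_cast le_top)]
      refine (ContinuousMultilinearMap.norm_compContinuousLinearMap_le _ _).trans ?_
      refine (mul_le_of_le_one_right (norm_nonneg _) ?_).trans (hB i _)
      exact Finset.prod_le_one (fun _ _ => norm_nonneg _) fun _ _ => hA j
    have h3 := SchwartzMap.le_seminorm ℝ (k + 1) (m - i) φ v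
    set D := ‖iteratedFDeriv ℝ (m - i) φ v‖
    have hD : 0 ≤ D := norm_nonneg _
    calc ‖v‖ ^ k * ((m.choose i : ℝ) * ‖iteratedFDeriv ℝ i (η ∘ A j) v‖ * D)
        ≤ ‖v‖ ^ k * ((m.choose i : ℝ) * B i * D) := by gcongr
      _ ≤ ‖v‖ ^ k * ((m.choose i : ℝ) * B i * D) * (c j * ‖v‖) :=
          le_mul_of_one_le_right (by have := hB0 i; positivity) hv1
      _ = c j * ((m.choose i : ℝ) * B i * (‖v‖ ^ (k + 1) * D)) := by ring
      _ ≤ _ := by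
        have := hB0 i
        have := hc0 j
        gcongr

/-- A tempered distribution is determined by its values on compactly supported functions. -/
theorem ext_of_hasCompactSupport {L L' : 𝓢(E, ℂ) →L[ℂ] ℂ}
    (h : ∀ φ : 𝓢(E, ℂ), HasCompactSupport φ → L φ = L' φ) : L = L' := by
  ext φ
  obtain ⟨u, hu, hlim⟩ := exists_hasCompactSupport_tendsto φ
  have h1 := (L.continuous.tendsto φ).comp hlim
  have h2 := (L'.continuous.tendsto φ).comp hlim
  refine tendsto_nhds_unique h1 (h2.congr fun j => (h _ (hu j)).symm)

end Density

/-! ### Exponentials of complex quadratic polynomials -/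

section GaussExp

variable {E : Type*} [NormedAddCommGroup E] [NormedSpace ℝ E]

/-- The complex quadratic polynomial `B(v, v) + ℓ(v)`. -/
def quadPoly (B : E →L[ℝ] E →L[ℝ] ℂ) (ℓ : E →L[ℝ] ℂ) (v : E) : ℂ := B v v + ℓ v

theorem hasFDerivAt_quadPoly (B : E →L[ℝ] E →L[ℝ] ℂ) (ℓ : E →L[ℝ] ℂ) (v : E) :
    HasFDerivAt (quadPoly B ℓ) ((B + B.flip) v + ℓ) v := by
  have h := (B.hasFDerivAt_of_bilinear (hasFDerivAt_id v) (hasFDerivAt_id v)).add ℓ.hasFDerivAt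
  refine h.congr_fderiv ?_
  ext w
  simp

theorem contDiff_quadPoly (B : E →L[ℝ] E →L[ℝ] ℂ) (ℓ : E →L[ℝ] ℂ) : ContDiff ℝ ∞ (quadPoly B ℓ) :=
  (B.contDiff.clm_apply contDiff_id).add ℓ.contDiff

/-- The bound has the form D^i required by the Faà di Bruno estimate for compositions. The leading 1
keeps D ≥ 1, which covers the second derivative; the higher ones vanish. -/
theorem norm_iteratedFDeriv_quadPoly_le (B : E →L[ℝ] E →L[ℝ] ℂ) (ℓ : E →L[ℝ] ℂ) (v : E) {i : ℕ}
    (hi : 1 ≤ i) :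
    ‖iteratedFDeriv ℝ i (quadPoly B ℓ) v‖ ≤ ((1 + ‖ℓ‖ + 2 * ‖B‖) * (1 + ‖v‖)) ^ i := by
  have h1 : fderiv ℝ (quadPoly B ℓ) = fun v => (B + B.flip) v + ℓ :=
    funext fun v => (hasFDerivAt_quadPoly B ℓ v).fderiv
  have h2 : fderiv ℝ (fun v => (B + B.flip) v + ℓ) = fun _ => B + B.flip :=
    funext fun v => ((B + B.flip).hasFDerivAt.add_const ℓ).fderiv
  have hBB : ‖B + B.flip‖ ≤ 2 * ‖B‖ := by
    refine (norm_add_le B B.flip).trans ?_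
    rw [ContinuousLinearMap.opNorm_flip]
    linarith
  have hℓ := norm_nonneg ℓ
  have hB := norm_nonneg B
  have hv := norm_nonneg v
  have hbase : 1 ≤ (1 + ‖ℓ‖ + 2 * ‖B‖) * (1 + ‖v‖) := by nlinarith [mul_nonneg hℓ hv, mul_nonneg hB hv]
  rcases i with _ | _ | _ | i
  · omega
  · rw [← norm_iteratedFDeriv_fderiv, h1, norm_iteratedFDeriv_zero, zero_add, pow_one]
    refine (norm_add_le _ _).trans ?_
    have := ((B + B.flip).le_opNorm v).trans (mul_le_mul_of_nonneg_right hBB hv)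
    nlinarith [mul_nonneg hℓ hv]
  · rw [← norm_iteratedFDeriv_fderiv, h1, ← norm_iteratedFDeriv_fderiv, h2,
      norm_iteratedFDeriv_zero]
    refine hBB.trans (le_trans ?_ (le_self_pow₀ hbase (by norm_num)))
    nlinarith [mul_nonneg hℓ hv, mul_nonneg hB hv]
  · rw [← norm_iteratedFDeriv_fderiv, h1, ← norm_iteratedFDeriv_fderiv, h2,
      iteratedFDeriv_const_of_ne (by omega)]
    simp only [Pi.zero_apply, norm_zero]
    positivity

theorem norm_iteratedFDeriv_cexp_le (i : ℕ) (z : ℂ) :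
    ‖iteratedFDeriv ℝ i Complex.exp z‖ ≤ Real.exp z.re := by
  induction i with
  | zero => rw [norm_iteratedFDeriv_zero, Complex.norm_exp]
  | succ i ih =>
    have h1 : fderiv ℝ Complex.exp =
        (ContinuousLinearMap.mul ℝ ℂ) ∘ Complex.exp := by
      funext w
      refine (Complex.hasDerivAt_exp w).complexToReal_fderiv.fderiv.trans ?_
      ext
      simp
    rw [← norm_iteratedFDeriv_fderiv, h1]
    refine ((ContinuousLinearMap.mul ℝ ℂ).norm_iteratedFDeriv_comp_left
      (n := i) (N := ∞) Complex.contDiff_exp.contDiffAt (mod_cast le_top)).trans ?_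
    exact (mul_le_of_le_one_left (norm_nonneg _) (ContinuousLinearMap.opNorm_mul_le ℝ ℂ)).trans ih

theorem norm_iteratedFDeriv_exp_quadPoly_le (B : E →L[ℝ] E →L[ℝ] ℂ) (ℓ : E →L[ℝ] ℂ) (v : E)
    (m : ℕ) : ‖iteratedFDeriv ℝ m (fun v => Complex.exp (quadPoly B ℓ v)) v‖ ≤
      m.factorial * Real.exp (quadPoly B ℓ v).re *
        ((1 + ‖ℓ‖ + 2 * ‖B‖) * (1 + ‖v‖)) ^ m :=
  norm_iteratedFDeriv_comp_le (g := Complex.exp) (f := quadPoly B ℓ) (N := ∞)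
    Complex.contDiff_exp (contDiff_quadPoly B ℓ) (mod_cast le_top) v
    (fun i _ => norm_iteratedFDeriv_cexp_le i _)
    fun _ hi _ => norm_iteratedFDeriv_quadPoly_le B ℓ v hi

theorem one_add_pow_mul_exp_le (p : ℕ) (b r : ℝ) {ε : ℝ} (hε : 0 < ε) (hr : 0 ≤ r) :
    (1 + r) ^ p * Real.exp (b * r - ε * r ^ 2) ≤
      p.factorial * Real.exp (1 + (b + 1) ^ 2 / (4 * ε)) := by
  have h1 : (1 + r) ^ p ≤ p.factorial * Real.exp (1 + r) := by
    have := Real.pow_div_factorial_le_exp (1 + r) (by linarith) p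
    rwa [div_le_iff₀' (by positivity)] at this
  calc _ ≤ p.factorial * Real.exp (1 + r) * Real.exp (b * r - ε * r ^ 2) := by gcongr
    _ = p.factorial * Real.exp (1 + r + (b * r - ε * r ^ 2)) := by rw [mul_assoc, ← Real.exp_add]
    _ ≤ _ := by
      refine mul_le_mul_of_nonneg_left (Real.exp_le_exp.2 ?_) (by positivity)
      -- Completing the square: (b+1)r - εr² is largest at r = (b+1)/(2ε).
      have : 0 ≤ ε * (r - (b + 1) / (2 * ε)) ^ 2 := by positivity
      have h2 : ε * (r - (b + 1) / (2 * ε)) ^ 2 = ε * r ^ 2 - (b + 1) * r + (b + 1) ^ 2 / (4 * ε) := by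
        field_simp
        ring
      linarith

/-- If the real part of the quadratic polynomial is at most `M - ε |v - a|²`, then its exponential
and the derivatives are bounded in terms of `M`, `ε`, `a`. -/
theorem pow_mul_norm_iteratedFDeriv_exp_quadPoly_le (B : E →L[ℝ] E →L[ℝ] ℂ) (ℓ : E →L[ℝ] ℂ)
    {M ε : ℝ} (hε : 0 < ε) {a : E} (h : ∀ v, (quadPoly B ℓ v).re ≤ M - ε * ‖v - a‖ ^ 2)
    (k m : ℕ) (v : E) :
    ‖v‖ ^ k * ‖iteratedFDeriv ℝ m (fun v => Complex.exp (quadPoly B ℓ v)) v‖ ≤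
      m.factorial * (k + m).factorial * Real.exp (1 + 1 / (4 * ε)) *
        (1 + ‖ℓ‖ + 2 * ‖B‖) ^ m * (1 + ‖a‖) ^ (k + m) * Real.exp M := by
  have h1 := one_add_pow_mul_exp_le (k + m) 0 ‖v - a‖ hε (norm_nonneg _)
  rw [zero_mul, zero_sub, zero_add, one_pow] at h1
  have hv : 1 + ‖v‖ ≤ (1 + ‖a‖) * (1 + ‖v - a‖) := by
    have : ‖v‖ ≤ ‖v - a‖ + ‖a‖ := by simpa using norm_add_le (v - a) a
    nlinarith [mul_nonneg (norm_nonneg a) (norm_nonneg (v - a))]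
  set A := 1 + ‖ℓ‖ + 2 * ‖B‖
  have hA : 0 ≤ A := by positivity
  calc _ ≤ (1 + ‖v‖) ^ k * (m.factorial * Real.exp (M - ε * ‖v - a‖ ^ 2) * (A * (1 + ‖v‖)) ^ m) := by
        gcongr
        · linarith
        · refine (norm_iteratedFDeriv_exp_quadPoly_le B ℓ v m).trans ?_
          gcongr
          exact h v
    _ = m.factorial * A ^ m * (1 + ‖v‖) ^ (k + m) * (Real.exp M * Real.exp (-(ε * ‖v - a‖ ^ 2))) := by
        rw [sub_eq_add_neg, Real.exp_add, mul_pow, pow_add]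
        ring
    _ ≤ m.factorial * A ^ m * ((1 + ‖a‖) * (1 + ‖v - a‖)) ^ (k + m) *
          (Real.exp M * Real.exp (-(ε * ‖v - a‖ ^ 2))) := by gcongr
    _ = m.factorial * A ^ m * (1 + ‖a‖) ^ (k + m) * Real.exp M *
          ((1 + ‖v - a‖) ^ (k + m) * Real.exp (-(ε * ‖v - a‖ ^ 2))) := by
        rw [mul_pow]
        ring
    _ ≤ m.factorial * A ^ m * (1 + ‖a‖) ^ (k + m) * Real.exp M *
          ((k + m).factorial * Real.exp (1 + 1 / (4 * ε))) := by gcongr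
    _ = _ := by ring

/-- The real part of the quadratic form of `B` is negative definite. -/
def NegDef (B : E →L[ℝ] E →L[ℝ] ℂ) : Prop := ∃ ε > 0, ∀ v, (B v v).re ≤ -ε * ‖v‖ ^ 2

theorem NegDef.re_quadPoly_le {B : E →L[ℝ] E →L[ℝ] ℂ} (hB : NegDef B) (ℓ : E →L[ℝ] ℂ) :
    ∃ M, ∃ ε > 0, ∀ v, (quadPoly B ℓ v).re ≤ M - ε * ‖v‖ ^ 2 := by
  obtain ⟨ε, hε, h⟩ := hB
  refine ⟨‖ℓ‖ ^ 2 / (2 * ε), ε / 2, by positivity, fun v => ?_⟩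
  have h1 : (ℓ v).re ≤ ‖ℓ‖ * ‖v‖ := (Complex.re_le_norm _).trans (ℓ.le_opNorm v)
  have h2 : 0 ≤ ε / 2 * (‖v‖ - ‖ℓ‖ / ε) ^ 2 := by positivity
  have h3 : ε / 2 * (‖v‖ - ‖ℓ‖ / ε) ^ 2 = ε / 2 * ‖v‖ ^ 2 - ‖ℓ‖ * ‖v‖ + ‖ℓ‖ ^ 2 / (2 * ε) := by
    field_simp
    ring
  have h4 : (quadPoly B ℓ v).re = (B v v).re + (ℓ v).re := by simp [quadPoly]
  linarith [h v]

/-- The Schwartz function `v ↦ exp (B(v, v) + ℓ(v))`. -/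
def gaussExp (B : E →L[ℝ] E →L[ℝ] ℂ) (hB : NegDef B) (ℓ : E →L[ℝ] ℂ) : 𝓢(E, ℂ) where
  toFun v := Complex.exp (quadPoly B ℓ v)
  smooth' := Complex.contDiff_exp.comp (contDiff_quadPoly B ℓ)
  decay' k m := by
    obtain ⟨M, ε, hε, h⟩ := hB.re_quadPoly_le ℓ
    exact ⟨_, pow_mul_norm_iteratedFDeriv_exp_quadPoly_le B ℓ (a := 0) hε (by simpa using h) k m⟩

theorem gaussExp_apply (B : E →L[ℝ] E →L[ℝ] ℂ) (hB : NegDef B) (ℓ : E →L[ℝ] ℂ) (v : E) :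
    gaussExp B hB ℓ v = Complex.exp (B v v + ℓ v) := rfl

/-- `C` does not depend on the linear part, the height `M` or the centre `a`. This uniformity is the
source of all polynomial bounds in the parameters of the Gaussians. -/
theorem gradedSeminorm_gaussExp_le (B : E →L[ℝ] E →L[ℝ] ℂ) (hB : NegDef B) {ε : ℝ} (hε : 0 < ε)
    (j : ℕ) : ∃ C, 0 ≤ C ∧ ∀ (ℓ : E →L[ℝ] ℂ) (M : ℝ) (a : E),
      (∀ v, (B v v + ℓ v).re ≤ M - ε * ‖v - a‖ ^ 2) →
      gradedSeminorm E j (gaussExp B hB ℓ) ≤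
        C * (1 + ‖ℓ‖) ^ j * (1 + ‖a‖) ^ (2 * j) * Real.exp M := by
  refine ⟨j.factorial * (2 * j).factorial * Real.exp (1 + 1 / (4 * ε)) * (1 + 2 * ‖B‖) ^ j,
    by positivity, fun ℓ M a h => ?_⟩
  refine Seminorm.finset_sup_apply_le (by positivity) fun ⟨k, m⟩ hkm => ?_
  simp only [Finset.mem_Iic, Prod.mk_le_mk] at hkm
  obtain ⟨hk, hm⟩ := hkm
  refine SchwartzMap.seminorm_le_bound ℂ k m _ (by positivity) fun v => ?_
  refine (pow_mul_norm_iteratedFDeriv_exp_quadPoly_le B ℓ hε h k m v).trans ?_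
  have h1 : (1 : ℝ) ≤ 1 + ‖a‖ := by linarith [norm_nonneg a]
  have h2 : 1 + ‖ℓ‖ + 2 * ‖B‖ ≤ (1 + 2 * ‖B‖) * (1 + ‖ℓ‖) := by
    nlinarith [mul_nonneg (norm_nonneg ℓ) (norm_nonneg B)]
  have h3 : (1 : ℝ) ≤ (1 + 2 * ‖B‖) * (1 + ‖ℓ‖) := by
    linarith [norm_nonneg ℓ, norm_nonneg B]
  calc _ ≤ j.factorial * (2 * j).factorial * Real.exp (1 + 1 / (4 * ε)) *
        ((1 + 2 * ‖B‖) * (1 + ‖ℓ‖)) ^ j * (1 + ‖a‖) ^ (2 * j) * Real.exp M := by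
        have h4 : (1 + ‖ℓ‖ + 2 * ‖B‖) ^ m ≤ ((1 + 2 * ‖B‖) * (1 + ‖ℓ‖)) ^ j :=
          (pow_le_pow_left₀ (by positivity) h2 m).trans (pow_le_pow_right₀ h3 hm)
        have h5 : k + m ≤ 2 * j := by omega
        gcongr
    _ = _ := by
        rw [mul_pow]
        ring

/-- All derivatives decay faster than every exponential. -/
def SuperDecay (G : 𝓢(E, ℂ)) : Prop :=
  ∀ (R : ℝ) (m : ℕ), ∃ C, 0 ≤ C ∧ ∀ v, ‖iteratedFDeriv ℝ m G v‖ ≤ C * Real.exp (-R * ‖v‖)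

theorem superDecay_gaussExp (B : E →L[ℝ] E →L[ℝ] ℂ) (hB : NegDef B) (ℓ : E →L[ℝ] ℂ) :
    SuperDecay (gaussExp B hB ℓ) := by
  intro R m
  obtain ⟨M, ε, hε, h⟩ := hB.re_quadPoly_le ℓ
  refine ⟨m.factorial * Real.exp M * (1 + ‖ℓ‖ + 2 * ‖B‖) ^ m *
    (m.factorial * Real.exp (1 + (R + 1) ^ 2 / (4 * ε))), by positivity, fun v => ?_⟩
  have h1 := one_add_pow_mul_exp_le m R ‖v‖ hε (norm_nonneg _)
  set A := 1 + ‖ℓ‖ + 2 * ‖B‖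
  have hA : 0 ≤ A := by positivity
  calc _ ≤ m.factorial * Real.exp (M - ε * ‖v‖ ^ 2) * (A * (1 + ‖v‖)) ^ m := by
        refine (norm_iteratedFDeriv_exp_quadPoly_le B ℓ v m).trans ?_
        gcongr
        exact h v
    _ = m.factorial * Real.exp M * A ^ m * ((1 + ‖v‖) ^ m * Real.exp (R * ‖v‖ - ε * ‖v‖ ^ 2)) *
          Real.exp (-R * ‖v‖) := by
        rw [show M - ε * ‖v‖ ^ 2 = M + (R * ‖v‖ - ε * ‖v‖ ^ 2) + -R * ‖v‖ by ring, Real.exp_add,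
          Real.exp_add, mul_pow]
        ring
    _ ≤ _ := by gcongr

theorem lineDerivOp_gaussExp_apply (B : E →L[ℝ] E →L[ℝ] ℂ) (hB : NegDef B) (ℓ : E →L[ℝ] ℂ)
    (w v : E) : LineDeriv.lineDerivOp w (gaussExp B hB ℓ) v =
      (B v w + B w v + ℓ w) * gaussExp B hB ℓ v := by
  rw [SchwartzMap.lineDerivOp_apply_eq_fderiv]
  have h : HasFDerivAt (gaussExp B hB ℓ) _ v := (hasFDerivAt_quadPoly B ℓ v).cexp
  rw [h.fderiv]
  simp [gaussExp_apply, quadPoly]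
  ring

end GaussExp

/-! ### Products of linear forms with rapidly decaying functions -/

section Monomial

variable {E : Type*} [NormedAddCommGroup E] [NormedSpace ℝ E] {ι : Type*}

theorem hasTemperateGrowth_prod_clm (s : Finset ι) (ℓ : ι → E →L[ℝ] ℂ) :
    (fun v => ∏ i ∈ s, ℓ i v).HasTemperateGrowth := by
  classical
  induction s using Finset.induction_on with
  | empty => simp
  | insert i s hi ih =>
    simp only [Finset.prod_insert hi]
    exact (ℓ i).hasTemperateGrowth.mul ih

/-- The product of a Schwartz function with a family of linear forms. -/
def monMul (s : Finset ι) (ℓ : ι → E →L[ℝ] ℂ) (G : 𝓢(E, ℂ)) : 𝓢(E, ℂ) :=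
  SchwartzMap.smulLeftCLM ℂ (fun v => ∏ i ∈ s, ℓ i v) G

@[simp] theorem monMul_apply (s : Finset ι) (ℓ : ι → E →L[ℝ] ℂ) (G : 𝓢(E, ℂ)) (v : E) :
    monMul s ℓ G v = (∏ i ∈ s, ℓ i v) * G v := by
  rw [monMul, SchwartzMap.smulLeftCLM_apply_apply (hasTemperateGrowth_prod_clm s ℓ), smul_eq_mul]

theorem norm_iteratedFDeriv_clm_le (ℓ : E →L[ℝ] ℂ) (v : E) (i : ℕ) :
    ‖iteratedFDeriv ℝ i ℓ v‖ ≤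
      (if i = 0 then ‖ℓ‖ * ‖v‖ else 0) + (if i = 1 then ‖ℓ‖ else 0) := by
  rcases i with _ | _ | i
  · simpa using ℓ.le_opNorm v
  · rw [← norm_iteratedFDeriv_fderiv, norm_iteratedFDeriv_zero]
    simp
  · rw [← norm_iteratedFDeriv_fderiv]
    have : fderiv ℝ ℓ = fun _ => ℓ := funext fun v => ℓ.fderiv
    rw [this, iteratedFDeriv_const_of_ne (by omega)]
    simp

theorem norm_iteratedFDeriv_prod_clm_le (s : Finset ι) (ℓ : ι → E →L[ℝ] ℂ) (v : E) {m i : ℕ}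
    (hi : i ≤ m) : ‖iteratedFDeriv ℝ i (fun v => ∏ j ∈ s, ℓ j v) v‖ ≤
      (∏ j ∈ s, ‖ℓ j‖) * (‖v‖ + m) ^ s.card := by
  classical
  induction s using Finset.induction_on generalizing i with
  | empty =>
    simp only [Finset.prod_empty, Finset.card_empty, pow_zero, mul_one]
    rcases i with _ | i
    · simp
    · simp [iteratedFDeriv_const_of_ne]
  | insert a s ha ih =>
    simp only [Finset.prod_insert ha, Finset.card_insert_of_notMem ha]
    set X := (∏ j ∈ s, ‖ℓ j‖) * (‖v‖ + m) ^ s.card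
    have hX : 0 ≤ X := mul_nonneg (Finset.prod_nonneg fun _ _ => norm_nonneg _) (by positivity)
    have hsm : ContDiff ℝ ∞ fun v => ∏ j ∈ s, ℓ j v := contDiff_prod fun j _ => (ℓ j).contDiff
    refine (norm_iteratedFDeriv_mul_le (𝕜 := ℝ) (ℓ a).contDiff hsm v (n := i)
      (mod_cast le_top)).trans ?_
    calc _ ≤ ∑ b ∈ Finset.range (i + 1), ((if b = 0 then ‖ℓ a‖ * ‖v‖ * X else 0) +
          (if b = 1 then i * ‖ℓ a‖ * X else 0)) := by
          refine Finset.sum_le_sum fun b hb => ?_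
          have h1 := norm_iteratedFDeriv_clm_le (ℓ a) v b
          have h2 := ih (i := i - b) (by omega)
          calc _ ≤ (i.choose b : ℝ) * ((if b = 0 then ‖ℓ a‖ * ‖v‖ else 0) +
                (if b = 1 then ‖ℓ a‖ else 0)) * X := by gcongr
            _ = _ := by
              rcases b with _ | _ | b
              · simp
              · simp
              · simp
      _ ≤ ‖ℓ a‖ * ‖v‖ * X + i * ‖ℓ a‖ * X := by
          rw [Finset.sum_add_distrib, Finset.sum_ite_eq', Finset.sum_ite_eq']
          have h0 : 0 ≤ ‖ℓ a‖ * ‖v‖ * X := by positivity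
          have h1 : 0 ≤ i * ‖ℓ a‖ * X := by positivity
          split_ifs <;> linarith
      _ ≤ ‖ℓ a‖ * ‖v‖ * X + m * ‖ℓ a‖ * X := by gcongr
      _ = _ := by
          simp only [X]
          ring

/-- A monomial of degree k is controlled by r^k ≤ (k!/R^k) e^{Rr}, and the exponential is absorbed
by `G`. As `R` is arbitrary, dividing by k! leaves a geometric series of any prescribed ratio. -/
theorem seminorm_monMul_le {G : 𝓢(E, ℂ)} (hG : SuperDecay G) (K m : ℕ) {R : ℝ} (hR : 0 < R) :
    ∃ C, 0 ≤ C ∧ ∀ (s : Finset ι) (ℓ : ι → E →L[ℝ] ℂ), SchwartzMap.seminorm ℝ K m (monMul s ℓ G) ≤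
      C * (s.card.factorial / R ^ s.card * ∏ i ∈ s, ‖ℓ i‖) := by
  -- `R` is spent on the monomial and the extra 1 on the weight ‖v‖^K.
  choose c hc0 hc using hG (R + 1)
  refine ⟨∑ i ∈ Finset.range (m + 1), (m.choose i : ℝ) * c (m - i) *
    (K.factorial * Real.exp (R * m)), Finset.sum_nonneg fun i _ => by
      have := hc0 (m - i); positivity, fun s ℓ => ?_⟩
  have hprod : 0 ≤ ∏ i ∈ s, ‖ℓ i‖ := Finset.prod_nonneg fun _ _ => norm_nonneg _
  refine SchwartzMap.seminorm_le_bound ℝ K m _ (mul_nonneg (Finset.sum_nonneg fun i _ => by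
      have := hc0 (m - i); positivity) (by positivity)) fun v => ?_
  have hfun : (monMul s ℓ G : E → ℂ) = fun v => (∏ i ∈ s, ℓ i v) * G v :=
    funext fun v => monMul_apply s ℓ G v
  have hsm : ContDiff ℝ ∞ fun v => ∏ j ∈ s, ℓ j v := contDiff_prod fun j _ => (ℓ j).contDiff
  rw [hfun]
  refine (mul_le_mul_of_nonneg_left (norm_iteratedFDeriv_mul_le (𝕜 := ℝ) hsm (G.smooth ⊤) v (n := m)
    (mod_cast le_top)) (by positivity)).trans ?_
  rw [Finset.mul_sum, Finset.sum_mul]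
  refine Finset.sum_le_sum fun i hi => ?_
  have h1 := norm_iteratedFDeriv_prod_clm_le s ℓ v (m := m) (i := i)
    (Nat.lt_succ_iff.1 (Finset.mem_range.1 hi))
  have h2 := hc (m - i) v
  have h3 : (‖v‖ + m) ^ s.card ≤ s.card.factorial / R ^ s.card * Real.exp (R * (‖v‖ + m)) := by
    have := Real.pow_div_factorial_le_exp (R * (‖v‖ + m)) (by positivity) s.card
    rw [mul_pow] at this
    rw [div_mul_eq_mul_div, le_div_iff₀' (by positivity)]
    rwa [div_le_iff₀' (by positivity)] at this
  have h4 : ‖v‖ ^ K ≤ K.factorial * Real.exp ‖v‖ := by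
    have := Real.pow_div_factorial_le_exp ‖v‖ (by positivity) K
    rwa [div_le_iff₀' (by positivity)] at this
  have := hc0 (m - i)
  calc _ ≤ (K.factorial * Real.exp ‖v‖) * ((m.choose i : ℝ) * ((∏ j ∈ s, ‖ℓ j‖) *
        (s.card.factorial / R ^ s.card * Real.exp (R * (‖v‖ + m)))) *
          (c (m - i) * Real.exp (-(R + 1) * ‖v‖))) := by
        gcongr
        exact h1.trans (by gcongr)
    _ = (m.choose i : ℝ) * c (m - i) * (K.factorial * (Real.exp ‖v‖ * Real.exp (R * (‖v‖ + m)) *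
          Real.exp (-(R + 1) * ‖v‖))) * (s.card.factorial / R ^ s.card * ∏ i ∈ s, ‖ℓ i‖) := by ring
    _ = _ := by
        rw [← Real.exp_add, ← Real.exp_add]
        ring_nf

end Monomial

/-! ### Holomorphic dependence on the linear part -/

section Holomorphic

variable {E : Type*} [NormedAddCommGroup E] [NormedSpace ℝ E]

theorem hasSum_of_eq {ι : Type*} {f g : ι → ℂ} {a : ℂ} (h : HasSum f a) (e : ∀ k, g k = f k) :
    HasSum g a := by
  rwa [funext e]

/-- This is the exponential series of s ℓ₁ multiplied by the Gaussian. With R = 2(‖s‖‖ℓ₁‖ + 1) in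
`seminorm_monMul_le`, every seminorm of the terms decays like 2^{-k}; hence distributions evaluated
on the family are holomorphic in s. -/
theorem hasSum_gaussExp (B : E →L[ℝ] E →L[ℝ] ℂ) (hB : NegDef B) (ℓ₀ ℓ₁ : E →L[ℝ] ℂ) (s : ℂ) :
    HasSum (fun k : ℕ => (s ^ k / k.factorial) •
      monMul (Finset.univ : Finset (Fin k)) (fun _ => ℓ₁) (gaussExp B hB ℓ₀))
      (gaussExp B hB (ℓ₀ + s • ℓ₁)) := by
  refine hasSum_of_summable_seminorm (fun K m => ?_) fun v => ?_
  · have hR : 0 < 2 * (‖s‖ * ‖ℓ₁‖ + 1) := by positivity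
    have hb : ∃ C, 0 ≤ C ∧ ∀ k : ℕ, SchwartzMap.seminorm ℝ K m
        (monMul (Finset.univ : Finset (Fin k)) (fun _ => ℓ₁) (gaussExp B hB ℓ₀)) ≤
        C * (k.factorial / (2 * (‖s‖ * ‖ℓ₁‖ + 1)) ^ k * ‖ℓ₁‖ ^ k) := by
      obtain ⟨C, hC, h⟩ := seminorm_monMul_le (ι := ℕ) (superDecay_gaussExp B hB ℓ₀) K m hR
      refine ⟨C, hC, fun k => ?_⟩
      have := h (Finset.range k) fun _ => ℓ₁
      have heq : monMul (Finset.univ : Finset (Fin k)) (fun _ => ℓ₁) (gaussExp B hB ℓ₀) =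
          monMul (Finset.range k) (fun _ => ℓ₁) (gaussExp B hB ℓ₀) := by
        ext v
        simp
      rw [heq]
      simpa using this
    obtain ⟨C, hC, h⟩ := hb
    refine Summable.of_nonneg_of_le (fun _ => apply_nonneg _ _) (fun k => ?_)
      ((summable_geometric_of_lt_one (r := (1 / 2 : ℝ)) (by norm_num) (by norm_num)).mul_left C)
    have hsm : SchwartzMap.seminorm ℝ K m ((s ^ k / (k.factorial : ℂ)) •
        monMul (Finset.univ : Finset (Fin k)) (fun _ => ℓ₁) (gaussExp B hB ℓ₀)) =
        ‖s ^ k / (k.factorial : ℂ)‖ * SchwartzMap.seminorm ℝ K m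
        (monMul (Finset.univ : Finset (Fin k)) (fun _ => ℓ₁) (gaussExp B hB ℓ₀)) :=
      map_smul_eq_mul (SchwartzMap.seminorm ℂ K m) _ _
    rw [hsm, norm_div, norm_pow, Complex.norm_natCast]
    have hle : ‖s‖ * ‖ℓ₁‖ / (2 * (‖s‖ * ‖ℓ₁‖ + 1)) ≤ 1 / 2 := by
      rw [div_le_div_iff₀ hR (by norm_num)]
      linarith
    calc _ ≤ ‖s‖ ^ k / k.factorial * (C * (k.factorial / (2 * (‖s‖ * ‖ℓ₁‖ + 1)) ^ k * ‖ℓ₁‖ ^ k)) := by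
          gcongr
          exact h k
      _ = C * (‖s‖ * ‖ℓ₁‖ / (2 * (‖s‖ * ‖ℓ₁‖ + 1))) ^ k := by
          rw [div_pow, mul_pow ‖s‖]
          have : (k.factorial : ℝ) ≠ 0 := by positivity
          field_simp
      _ ≤ _ := by gcongr
  · have h := (NormedSpace.expSeries_div_hasSum_exp (s * ℓ₁ v)).mul_right (gaussExp B hB ℓ₀ v)
    rw [← Complex.exp_eq_exp_ℂ] at h
    have h1 : gaussExp B hB (ℓ₀ + s • ℓ₁) v = Complex.exp (s * ℓ₁ v) * gaussExp B hB ℓ₀ v := by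
      rw [gaussExp_apply, gaussExp_apply, ← Complex.exp_add]
      congr 1
      simp
      ring
    rw [h1]
    refine hasSum_of_eq h fun k => ?_
    simp [mul_pow]
    ring

theorem hasFPowerSeriesAt_gaussExp (L : 𝓢(E, ℂ) →L[ℂ] ℂ) (B : E →L[ℝ] E →L[ℝ] ℂ) (hB : NegDef B)
    (ℓ₀ ℓ₁ : E →L[ℝ] ℂ) : HasFPowerSeriesAt (fun s : ℂ => L (gaussExp B hB (ℓ₀ + s • ℓ₁)))
      (FormalMultilinearSeries.ofScalars ℂ fun k : ℕ => L (monMul (Finset.univ : Finset (Fin k))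
        (fun _ => ℓ₁) (gaussExp B hB ℓ₀)) / k.factorial) 0 := by
  rw [hasFPowerSeriesAt_iff]
  refine Filter.Eventually.of_forall fun s => ?_
  have h := L.hasSum (hasSum_gaussExp B hB ℓ₀ ℓ₁ s)
  rw [zero_add]
  refine hasSum_of_eq h fun k => ?_
  rw [FormalMultilinearSeries.coeff_ofScalars, map_smul, smul_eq_mul, smul_eq_mul]
  ring

theorem hasDerivAt_apply_gaussExp (L : 𝓢(E, ℂ) →L[ℂ] ℂ) (B : E →L[ℝ] E →L[ℝ] ℂ) (hB : NegDef B)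
    (ℓ₀ ℓ₁ : E →L[ℝ] ℂ) (s : ℂ) : HasDerivAt (fun s : ℂ => L (gaussExp B hB (ℓ₀ + s • ℓ₁)))
      (L (SchwartzMap.smulLeftCLM ℂ ℓ₁ (gaussExp B hB (ℓ₀ + s • ℓ₁)))) s := by
  have h := (hasFPowerSeriesAt_gaussExp L B hB (ℓ₀ + s • ℓ₁) ℓ₁).hasDerivAt
  rw [← sub_self s] at h
  have h1 := h.comp_sub_const s s
  have h2 : (fun x => L (gaussExp B hB (ℓ₀ + s • ℓ₁ + (x - s) • ℓ₁))) =
      fun x => L (gaussExp B hB (ℓ₀ + x • ℓ₁)) := by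
    funext x
    congr 2
    ext v
    simp
    ring
  rw [h2] at h1
  have h3 : SchwartzMap.smulLeftCLM ℂ ℓ₁ (gaussExp B hB (ℓ₀ + s • ℓ₁)) =
      monMul (Finset.univ : Finset (Fin 1)) (fun _ => ℓ₁) (gaussExp B hB (ℓ₀ + s • ℓ₁)) := by
    simp [monMul]
  rw [h3]
  simpa [FormalMultilinearSeries.ofScalars_apply_eq] using h1

end Holomorphic

/-! ### Modulated Gaussians span a dense subspace -/

section Span

/-- Identity theorem: the function is analytic in complex s and vanishes on the real points 1/(n+1),
which accumulate at 0, so all its Taylor coefficients vanish. -/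
theorem apply_monMul_eq_zero {E : Type*} [NormedAddCommGroup E] [NormedSpace ℝ E]
    (L : 𝓢(E, ℂ) →L[ℂ] ℂ) (B : E →L[ℝ] E →L[ℝ] ℂ) (hB : NegDef B) (ℓ : E →L[ℝ] ℂ)
    (h : ∀ s : ℝ, L (gaussExp B hB ((s : ℂ) • ℓ)) = 0) (k : ℕ) :
    L (monMul (Finset.univ : Finset (Fin k)) (fun _ => ℓ) (gaussExp B hB 0)) = 0 := by
  have hp := hasFPowerSeriesAt_gaussExp L B hB 0 ℓ
  have hfr : ∃ᶠ z in nhdsWithin (0 : ℂ) {0}ᶜ, L (gaussExp B hB (0 + z • ℓ)) = 0 := by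
    have ht : Filter.Tendsto (fun n : ℕ => ((1 / ((n : ℝ) + 1) : ℝ) : ℂ)) Filter.atTop
        (nhdsWithin (0 : ℂ) {0}ᶜ) := by
      refine tendsto_nhdsWithin_iff.2 ⟨?_, Filter.Eventually.of_forall fun n => ?_⟩
      · have := (Complex.continuous_ofReal.tendsto 0).comp
          (tendsto_one_div_add_atTop_nhds_zero_nat (𝕜 := ℝ))
        simpa [Function.comp_def] using this
      · simp only [Set.mem_compl_iff, Set.mem_singleton_iff, Complex.ofReal_eq_zero]
        positivity
    exact ht.frequently (Filter.Frequently.of_forall fun n => by rw [zero_add]; exact h _)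
  have hz := (hp.analyticAt.frequently_zero_iff_eventually_zero).1 hfr
  have hp0 := hp.locally_zero_iff.1 hz
  have := congrArg (fun p => FormalMultilinearSeries.coeff p k) hp0
  rw [FormalMultilinearSeries.coeff_ofScalars] at this
  simpa [FormalMultilinearSeries.coeff, Nat.factorial_ne_zero] using this

variable {ι : Type*}

/-- The coordinate functions with complex values. -/
def coordC (i : ι) : EuclideanSpace ℝ ι →L[ℝ] ℂ :=
  Complex.ofRealCLM.comp (EuclideanSpace.proj i : EuclideanSpace ℝ ι →L[ℝ] ℝ)

@[simp] theorem coordC_apply (i : ι) (v : EuclideanSpace ℝ ι) : coordC i v = (v i : ℂ) := rfl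

variable [Fintype ι]

theorem norm_coordC_le (i : ι) : ‖coordC i‖ ≤ 1 := by
  refine ContinuousLinearMap.opNorm_le_bound _ zero_le_one fun v => ?_
  rw [coordC_apply, Complex.norm_real, one_mul]
  exact PiLp.norm_apply_le v i

theorem inner_pow_eq_sum (q v : EuclideanSpace ℝ ι) (k : ℕ) :
    (inner ℝ q v : ℂ) ^ k = ∑ f : Fin k → ι, (∏ j, (q (f j) : ℂ)) * ∏ j, (v (f j) : ℂ) := by
  classical
  have h1 : ((inner ℝ q v : ℝ) : ℂ) = ∑ i, (q i : ℂ) * (v i : ℂ) := by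
    rw [PiLp.inner_apply, Complex.ofReal_sum]
    refine Finset.sum_congr rfl fun i _ => ?_
    simp [mul_comm]
  have h2 := Finset.prod_univ_sum (ι := Fin k) (fun _ => (Finset.univ : Finset ι))
    fun _ i => (q i : ℂ) * (v i : ℂ)
  simp only [Finset.prod_const, Finset.card_univ, Fintype.card_fin, Fintype.piFinset_univ] at h2
  rw [h1, h2]
  simp [Finset.prod_mul_distrib]

variable (L : 𝓢(EuclideanSpace ℝ ι, ℂ) →L[ℂ] ℂ)
  (B : EuclideanSpace ℝ ι →L[ℝ] EuclideanSpace ℝ ι →L[ℝ] ℂ) (hB : NegDef B)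

/-- The purely imaginary linear form `I λ`. -/
def imForm {E : Type*} [NormedAddCommGroup E] [NormedSpace ℝ E] (lam : E →L[ℝ] ℝ) : E →L[ℝ] ℂ :=
  Complex.I • Complex.ofRealCLM.comp lam

@[simp] theorem imForm_apply {E : Type*} [NormedAddCommGroup E] [NormedSpace ℝ E]
    (lam : E →L[ℝ] ℝ) (v : E) : imForm lam v = Complex.I * lam v := rfl

/-- The relation is kept as a polynomial identity in `q`. No polarisation is needed, because it is
integrated against a function of `q` in `apply_smulLeft_fourier_eq_zero`. -/
theorem sum_apply_monMul_eq_zero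
    (h : ∀ lam : EuclideanSpace ℝ ι →L[ℝ] ℝ, L (gaussExp B hB (imForm lam)) = 0) (k : ℕ)
    (q : EuclideanSpace ℝ ι) : ∑ f : Fin k → ι, (∏ j, (q (f j) : ℂ)) *
      L (monMul Finset.univ (fun j => coordC (f j)) (gaussExp B hB 0)) = 0 := by
  have h0 := apply_monMul_eq_zero L B hB (imForm (innerSL ℝ q)) (fun s => by
    rw [show (s : ℂ) • imForm (innerSL ℝ q) = imForm (innerSL ℝ (s • q)) by
      ext v
      simp
      ring]
    exact h _) k
  have h1 : monMul (Finset.univ : Finset (Fin k)) (fun _ => imForm (innerSL ℝ q)) (gaussExp B hB 0) =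
      Complex.I ^ k • ∑ f : Fin k → ι, (∏ j, (q (f j) : ℂ)) •
        monMul Finset.univ (fun j => coordC (f j)) (gaussExp B hB 0) := by
    ext v
    simp only [monMul_apply, imForm_apply, innerSL_apply_apply, Finset.prod_const,
      Finset.card_univ, Fintype.card_fin, smul_apply, sum_apply, coordC_apply, smul_eq_mul, mul_pow,
      inner_pow_eq_sum]
    rw [mul_assoc, Finset.sum_mul]
    simp only [mul_assoc]
  rw [h1, map_smul, map_sum] at h0
  simpa using h0

/-- Expanding e^{-2πi q·v} writes G times the Fourier transform of ψ as a series of monomials times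
G. The compact support of ψ bounds the moments by R^k ‖ψ‖₁, so the series converges in Schwartz
space, and `L` kills every term. -/
theorem apply_smulLeft_fourier_eq_zero
    (h : ∀ lam : EuclideanSpace ℝ ι →L[ℝ] ℝ, L (gaussExp B hB (imForm lam)) = 0)
    (ψ : 𝓢(EuclideanSpace ℝ ι, ℂ)) (hψ : HasCompactSupport ψ) :
    L (SchwartzMap.smulLeftCLM ℂ (gaussExp B hB 0) (𝓕 ψ)) = 0 := by
  set G := gaussExp B hB 0
  obtain ⟨R, hR0, hR⟩ : ∃ R, 0 < R ∧ ∀ q, ψ q ≠ 0 → ‖q‖ ≤ R := by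
    obtain ⟨R, hR⟩ := hψ.isCompact.isBounded.exists_norm_le
    exact ⟨max R 1, by positivity, fun q hq =>
      (hR q (subset_tsupport _ hq)).trans (le_max_left _ _)⟩
  set I1 : ℝ := ∫ q, ‖ψ q‖
  have hI1 : 0 ≤ I1 := integral_nonneg fun _ => norm_nonneg _
  have hint : ∀ u : EuclideanSpace ℝ ι → ℂ, Continuous u → Integrable fun q => u q * ψ q := by
    intro u hu
    exact (hu.mul ψ.continuous).integrable_of_hasCompactSupport hψ.mul_left
  have hbound : ∀ (u : EuclideanSpace ℝ ι → ℂ) (K : ℝ), 0 ≤ K → (∀ q, ‖q‖ ≤ R → ‖u q‖ ≤ K) →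
      ∫ q, ‖u q * ψ q‖ ≤ K * I1 := by
    intro u K hK hu
    rw [← integral_const_mul]
    refine integral_mono_of_nonneg (Filter.Eventually.of_forall fun _ => norm_nonneg _)
      (ψ.integrable.norm.const_mul K) (Filter.Eventually.of_forall fun q => ?_)
    simp only [norm_mul]
    by_cases hq : ψ q = 0
    · simp [hq]
    · exact mul_le_mul_of_nonneg_right (hu q (hR q hq)) (norm_nonneg _)
  let c : ∀ k : ℕ, (Fin k → ι) → ℂ := fun k f => ∫ q, (∏ j, (q (f j) : ℂ)) * ψ q
  have hcont : ∀ (k : ℕ) (f : Fin k → ι),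
      Continuous fun q : EuclideanSpace ℝ ι => ∏ j, (q (f j) : ℂ) := by
    intro k f
    fun_prop
  have hc : ∀ k f, ‖c k f‖ ≤ R ^ k * I1 := by
    intro k f
    refine (norm_integral_le_integral_norm _).trans (hbound _ _ (by positivity) fun q hq => ?_)
    rw [norm_prod]
    refine (Finset.prod_le_prod (g := fun _ => R) (fun _ _ => norm_nonneg _) fun j _ => ?_).trans_eq
      (by simp)
    rw [Complex.norm_real]
    exact (PiLp.norm_apply_le q (f j)).trans hq
  let a : ℂ := -2 * Real.pi * Complex.I
  let mon : ∀ k : ℕ, (Fin k → ι) → 𝓢(EuclideanSpace ℝ ι, ℂ) := fun k f =>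
    monMul Finset.univ (fun j => coordC (f j)) G
  let term : ℕ → 𝓢(EuclideanSpace ℝ ι, ℂ) := fun k =>
    (a ^ k / (k.factorial : ℂ)) • ∑ f : Fin k → ι, c k f • mon k f
  have hL : ∀ k, L (term k) = 0 := by
    intro k
    simp only [term, map_smul, map_sum, smul_eq_mul]
    have : ∑ f : Fin k → ι, c k f * L (mon k f) =
        ∫ q, (∑ f : Fin k → ι, (∏ j, (q (f j) : ℂ)) * L (mon k f)) * ψ q := by
      simp only [Finset.sum_mul]
      rw [integral_finsetSum]
      · refine Finset.sum_congr rfl fun f _ => ?_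
        rw [← integral_mul_const]
        refine integral_congr_ae (Filter.Eventually.of_forall fun q => ?_)
        simp only
        ring
      · intro f _
        exact hint _ ((hcont k f).mul continuous_const)
    rw [this]
    simp [mon, G, sum_apply_monMul_eq_zero L B hB h]
  have hval : ∀ k v, term k v = (a ^ k / (k.factorial : ℂ)) *
      (∫ q, (inner ℝ q v : ℂ) ^ k * ψ q) * G v := by
    intro k v
    have : ∫ q, (inner ℝ q v : ℂ) ^ k * ψ q = ∑ f : Fin k → ι, c k f * ∏ j, (v (f j) : ℂ) := by
      simp only [inner_pow_eq_sum, Finset.sum_mul]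
      rw [integral_finsetSum]
      · refine Finset.sum_congr rfl fun f _ => ?_
        rw [← integral_mul_const]
        refine integral_congr_ae (Filter.Eventually.of_forall fun q => ?_)
        simp only
        ring
      · intro f _
        exact hint _ ((hcont k f).mul continuous_const)
    rw [this]
    simp only [term, smul_apply, sum_apply, mon, monMul_apply, coordC_apply, smul_eq_mul]
    rw [mul_assoc, Finset.sum_mul]
    simp only [mul_assoc]
  have hsum : HasSum term (SchwartzMap.smulLeftCLM ℂ G (𝓕 ψ)) := by
    refine hasSum_of_summable_seminorm (fun K m => ?_) fun v => ?_
    · set d : ℝ := (Fintype.card ι : ℝ)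
      -- Degree k contributes (2π)^k from the exponent, R^k from the moments and d^k index tuples;
      -- this `Q` makes the resulting ratio at most 1/2.
      set Q : ℝ := 2 * (2 * Real.pi * R * d + 1)
      have hπ := Real.pi_pos
      have hd : 0 ≤ d := by positivity
      have hQ : 0 < Q := by positivity
      obtain ⟨C, hC, hCb⟩ : ∃ C, 0 ≤ C ∧ ∀ (k : ℕ) (f : Fin k → ι),
          SchwartzMap.seminorm ℝ K m (mon k f) ≤ C * (k.factorial / Q ^ k) := by
        obtain ⟨C, hC, hCb⟩ := seminorm_monMul_le (ι := ℕ) (superDecay_gaussExp B hB 0) K m hQ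
        refine ⟨C, hC, fun k f => ?_⟩
        -- Factors are reindexed by ℕ because the constant of `seminorm_monMul_le` is tied to the
        -- index type and has to serve all k at once.
        let g : ℕ → EuclideanSpace ℝ ι →L[ℝ] ℂ := fun i =>
          if hi : i < k then coordC (f ⟨i, hi⟩) else 0
        have heq : mon k f = monMul (Finset.range k) g G := by
          ext v
          simp [mon, g, Finset.prod_range]
        rw [heq]
        refine (hCb (Finset.range k) g).trans ?_
        rw [Finset.card_range]
        refine mul_le_mul_of_nonneg_left (mul_le_of_le_one_right (by positivity) ?_) hC
        refine Finset.prod_le_one (fun _ _ => norm_nonneg _) fun i _ => ?_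
        simp only [g]
        split_ifs
        · exact norm_coordC_le _
        · simp
      refine Summable.of_nonneg_of_le (fun _ => apply_nonneg _ _) (fun k => ?_)
        ((summable_geometric_of_lt_one (r := (1 / 2 : ℝ)) (by norm_num) (by norm_num)).mul_left
          (C * I1))
      have hsm : SchwartzMap.seminorm ℝ K m (term k) = ‖a ^ k / (k.factorial : ℂ)‖ *
          SchwartzMap.seminorm ℝ K m (∑ f : Fin k → ι, c k f • mon k f) :=
        map_smul_eq_mul (SchwartzMap.seminorm ℂ K m) _ _
      have hsm' : ∀ f, SchwartzMap.seminorm ℝ K m (c k f • mon k f) =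
          ‖c k f‖ * SchwartzMap.seminorm ℝ K m (mon k f) := fun f =>
        map_smul_eq_mul (SchwartzMap.seminorm ℂ K m) _ _
      have ha : ‖a‖ = 2 * Real.pi := by
        simp [a, abs_of_pos hπ]
      rw [hsm, norm_div, norm_pow, Complex.norm_natCast, ha]
      have hle : 2 * Real.pi * R * d / Q ≤ 1 / 2 := by
        rw [div_le_div_iff₀ hQ (by norm_num)]
        simp only [Q]
        linarith
      calc _ ≤ (2 * Real.pi) ^ k / k.factorial *
            ∑ f : Fin k → ι, R ^ k * I1 * (C * (k.factorial / Q ^ k)) := by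
            gcongr
            refine (Finset.le_sum_of_subadditive (SchwartzMap.seminorm ℝ K m) (map_zero _).le
              (map_add_le_add _) _ _).trans (Finset.sum_le_sum fun f _ => ?_)
            rw [hsm']
            exact mul_le_mul (hc k f) (hCb k f) (apply_nonneg _ _) (by positivity)
        _ = C * I1 * (2 * Real.pi * R * d / Q) ^ k := by
            rw [Finset.sum_const, Finset.card_univ, Fintype.card_fun, Fintype.card_fin, nsmul_eq_mul,
              Nat.cast_pow, div_pow, mul_pow _ d, mul_pow _ R]
            have : (k.factorial : ℝ) ≠ 0 := by positivity
            field_simp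
            simp only [d]
            ring
        _ ≤ _ := by gcongr
    · rw [SchwartzMap.smulLeftCLM_apply_apply G.hasTemperateGrowth, smul_eq_mul]
      have h1 : HasSum (fun k : ℕ => ∫ q, (a * inner ℝ q v) ^ k / (k.factorial : ℂ) * ψ q) (𝓕 ψ v) := by
        have hF : 𝓕 ψ v = ∫ q, ∑' k : ℕ, (a * inner ℝ q v) ^ k / (k.factorial : ℂ) * ψ q := by
          rw [SchwartzMap.fourier_coe, Real.fourier_eq']
          refine integral_congr_ae (Filter.Eventually.of_forall fun q => ?_)
          simp only
          rw [tsum_mul_right, ← (NormedSpace.expSeries_div_hasSum_exp (a * inner ℝ q v)).tsum_eq.symm,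
            ← Complex.exp_eq_exp_ℂ, smul_eq_mul]
          congr 2
          simp [a]
          ring
        rw [hF]
        refine hasSum_integral_of_summable_integral_norm (fun k => ?_) ?_
        · exact hint _ (by fun_prop)
        · refine Summable.of_nonneg_of_le (fun _ => integral_nonneg fun _ => norm_nonneg _)
            (fun k => hbound _ ((‖a‖ * (R * ‖v‖)) ^ k / k.factorial) (by positivity)
              fun q hq => ?_) ((Real.summable_pow_div_factorial (‖a‖ * (R * ‖v‖))).mul_right I1)
          rw [norm_div, norm_pow, norm_mul, Complex.norm_natCast, Complex.norm_real]
          have : ‖inner ℝ q v‖ ≤ R * ‖v‖ := (norm_inner_le_norm q v).trans (by gcongr)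
          gcongr
      refine hasSum_of_eq (h1.mul_left (G v)) fun k => ?_
      rw [hval, ← integral_const_mul, mul_comm _ (G v)]
      congr 1
      refine integral_congr_ae (Filter.Eventually.of_forall fun q => ?_)
      simp only [mul_pow]
      ring
  have := L.hasSum hsum
  simp only [hL] at this
  exact this.unique hasSum_zero

/-- Since the Fourier transform is onto, `L` kills G φ for every Schwartz φ. A compactly supported φ
is itself of this form, because φ/G is smooth with compact support. -/
theorem eq_zero_of_apply_gaussExp_euclidean
    (h : ∀ lam : EuclideanSpace ℝ ι →L[ℝ] ℝ, L (gaussExp B hB (imForm lam)) = 0) : L = 0 := by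
  set G := gaussExp B hB 0
  have h1 : L ∘L (SchwartzMap.smulLeftCLM ℂ G) ∘L
      (FourierTransform.fourierCLM ℂ 𝓢(EuclideanSpace ℝ ι, ℂ)) = 0 :=
    ext_of_hasCompactSupport fun ψ hψ => by
      simpa using apply_smulLeft_fourier_eq_zero L B hB h ψ hψ
  have h2 : ∀ φ, L (SchwartzMap.smulLeftCLM ℂ G φ) = 0 := by
    intro φ
    have := congrArg (fun A : 𝓢(EuclideanSpace ℝ ι, ℂ) →L[ℂ] ℂ => A (𝓕⁻ φ)) h1
    simpa using this
  refine ext_of_hasCompactSupport fun φ hφ => ?_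
  have hsm : ContDiff ℝ ∞ fun v => Complex.exp (-quadPoly B 0 v) :=
    Complex.contDiff_exp.comp (contDiff_quadPoly B 0).neg
  have h3 := h2 (mulCompact _ hsm φ hφ)
  have h4 : SchwartzMap.smulLeftCLM ℂ G (mulCompact _ hsm φ hφ) = φ := by
    ext v
    rw [SchwartzMap.smulLeftCLM_apply_apply G.hasTemperateGrowth, mulCompact_apply, smul_eq_mul,
      ← mul_assoc]
    change Complex.exp (quadPoly B 0 v) * _ * _ = _
    rw [← Complex.exp_add, add_neg_cancel, Complex.exp_zero, one_mul]
  rw [h4] at h3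
  simpa using h3

/-- A tempered distribution vanishing on all modulations of a fixed Gaussian is zero. -/
theorem eq_zero_of_apply_gaussExp {E : Type*} [NormedAddCommGroup E] [NormedSpace ℝ E]
    [FiniteDimensional ℝ E] (L : 𝓢(E, ℂ) →L[ℂ] ℂ) (B : E →L[ℝ] E →L[ℝ] ℂ) (hB : NegDef B)
    (h : ∀ lam : E →L[ℝ] ℝ, L (gaussExp B hB (imForm lam)) = 0) : L = 0 := by
  let e : E ≃L[ℝ] EuclideanSpace ℝ (Fin (Module.finrank ℝ E)) := toEuclidean
  let e' : E →L[ℝ] EuclideanSpace ℝ (Fin (Module.finrank ℝ E)) := e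
  let B' : EuclideanSpace ℝ (Fin (Module.finrank ℝ E)) →L[ℝ]
      EuclideanSpace ℝ (Fin (Module.finrank ℝ E)) →L[ℝ] ℂ :=
    B.bilinearComp (e.symm : _ →L[ℝ] E) (e.symm : _ →L[ℝ] E)
  have hB' : NegDef B' := by
    obtain ⟨ε, hε, hBε⟩ := hB
    refine ⟨ε / (1 + ‖e'‖) ^ 2, by positivity, fun v => ?_⟩
    have h1 := hBε (e.symm v)
    have h2 : ‖v‖ ≤ (1 + ‖e'‖) * ‖e.symm v‖ := by
      have := e'.le_opNorm (e.symm v)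
      simp only [e', ContinuousLinearEquiv.coe_coe, ContinuousLinearEquiv.apply_symm_apply] at this
      linarith [norm_nonneg (e.symm v)]
    have h3 : ‖v‖ ^ 2 ≤ (1 + ‖e'‖) ^ 2 * ‖e.symm v‖ ^ 2 := by
      rw [← mul_pow]
      gcongr
    change (B (e.symm v) (e.symm v)).re ≤ _
    refine h1.trans ?_
    rw [neg_mul, neg_mul, neg_le_neg_iff, div_mul_eq_mul_div, div_le_iff₀ (by positivity)]
    nlinarith
  have h0 := eq_zero_of_apply_gaussExp_euclidean
    (L ∘L SchwartzMap.compCLMOfContinuousLinearEquiv ℂ e) B' hB' fun lam => by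
      have : SchwartzMap.compCLMOfContinuousLinearEquiv ℂ e (gaussExp B' hB' (imForm lam)) =
          gaussExp B hB (imForm (lam.comp e')) := by
        ext v
        simp [gaussExp_apply, B', e']
      simp only [ContinuousLinearMap.comp_apply]
      rw [this]
      exact h _
  ext φ
  have h1 := congrArg (fun A : 𝓢(EuclideanSpace ℝ (Fin (Module.finrank ℝ E)), ℂ) →L[ℂ] ℂ =>
    A (SchwartzMap.compCLMOfContinuousLinearEquiv ℂ e.symm φ)) h0
  simp only [ContinuousLinearMap.comp_apply, zero_apply] at h1
  rw [zero_apply, ← h1]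
  congr 1
  ext v
  simp

end Span

/-! ### A Phragmén–Lindelöf principle -/

section PhragmenLindelof

theorem one_add_norm_le_two_mul {z : ℂ} (hz : 0 ≤ z.re) : 1 + ‖z‖ ≤ 2 * ‖z + 1‖ := by
  have h1 : ‖z‖ ^ 2 = z.re * z.re + z.im * z.im := by
    rw [← Complex.normSq_eq_norm_sq, Complex.normSq_apply]
  have h2 : ‖z + 1‖ ^ 2 = (z.re + 1) * (z.re + 1) + z.im * z.im := by
    rw [← Complex.normSq_eq_norm_sq, Complex.normSq_apply]
    simp
  refine abs_le_of_sq_le_sq' ?_ (by positivity) |>.2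
  nlinarith [sq_nonneg (‖z‖ - 1), norm_nonneg z]

theorem norm_exp_I_mul_sq (b : ℝ) (z : ℂ) :
    ‖Complex.exp (Complex.I * b * z ^ 2 / 2)‖ = Real.exp (-(b * z.re * z.im)) := by
  rw [Complex.norm_exp]
  congr 1
  have : Complex.I * b * z ^ 2 / 2 = Complex.I * ((b / 2 : ℝ) : ℂ) * z ^ 2 := by
    push_cast
    ring
  rw [this]
  simp [pow_two, Complex.mul_re, Complex.mul_im]
  ring

variable {f : ℂ → ℂ} {a C : ℝ} {N : ℕ}

/-- Growth of order 2 is the critical case for a quadrant, so a factor e^{ibz²/2}, of modulus e^{-b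
Re z Im z}, is inserted. Below the ray tan θ = b/a the given bound suffices, as a (Im z)² ≤ b Re z
Im z. The sector above it has opening less than π/2, where order 2 is admissible; the logarithm
turns it into a strip. The factor (z+1)^N, which has no zero in the closed right half plane, absorbs
the polynomial. -/
theorem norm_le_in_quadrant_aux (hf : Differentiable ℂ f) (ha : 0 < a) (hC : 0 ≤ C)
    (h1 : ∀ z, ‖f z‖ ≤ C * (1 + ‖z‖) ^ N * Real.exp (a * z.im ^ 2))
    (h2 : ∀ y : ℝ, ‖f (y * Complex.I)‖ ≤ C * (1 + |y|) ^ N) {b : ℝ} (hb : 0 < b) {z : ℂ}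
    (hx : 0 ≤ z.re) (hy : 0 ≤ z.im) :
    ‖f z‖ ≤ C * 2 ^ N * ‖z + 1‖ ^ N * Real.exp (b * z.re * z.im) := by
  have h3 : ∀ z : ℂ, 0 ≤ z.re → ‖f z‖ ≤ C * 2 ^ N * ‖z + 1‖ ^ N * Real.exp (a * z.im ^ 2) := by
    intro z hz
    refine (h1 z).trans ?_
    rw [mul_assoc C (2 ^ N), ← mul_pow]
    gcongr
    exact one_add_norm_le_two_mul hz
  rcases eq_or_ne z 0 with rfl | hz0
  · simpa using h3 0 le_rfl
  set θ := Real.arctan (b / a)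
  have hθ0 : 0 < θ := Real.arctan_pos.2 (by positivity)
  have hθ1 : θ < Real.pi / 2 := Real.arctan_lt_pi_div_two _
  have hcos : 0 < Real.cos θ := Real.cos_pos_of_mem_Ioo ⟨by linarith, hθ1⟩
  have htan : a * Real.sin θ = b * Real.cos θ := by
    have : Real.sin θ / Real.cos θ = b / a := by rw [← Real.tan_eq_sin_div_cos, Real.tan_arctan]
    field_simp at this
    linarith
  have harg0 : 0 ≤ z.arg := Complex.arg_nonneg_iff.2 hy
  have harg1 : z.arg ≤ Real.pi / 2 := Complex.arg_le_pi_div_two_iff.2 (Or.inl hx)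
  have hre : z.re = ‖z‖ * Real.cos z.arg := (Complex.norm_mul_cos_arg z).symm
  have him : z.im = ‖z‖ * Real.sin z.arg := (Complex.norm_mul_sin_arg z).symm
  rcases le_total z.arg θ with hle | hle
  · refine (h3 z hx).trans (mul_le_mul_of_nonneg_left (Real.exp_le_exp.2 ?_) (by positivity))
    have hs : Real.sin z.arg * Real.cos θ ≤ Real.cos z.arg * Real.sin θ := by
      have := Real.sin_nonneg_of_nonneg_of_le_pi (x := θ - z.arg) (by linarith)
        (by linarith [Real.pi_pos])
      rw [Real.sin_sub] at this
      linarith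
    have hab : a * Real.sin z.arg ≤ b * Real.cos z.arg := by
      refine le_of_mul_le_mul_right ?_ hcos
      calc _ = a * (Real.sin z.arg * Real.cos θ) := by ring
        _ ≤ a * (Real.cos z.arg * Real.sin θ) := by gcongr
        _ = _ := by rw [mul_left_comm, htan]; ring
    have hab' : a * z.im ≤ b * z.re := by
      rw [hre, him]
      nlinarith [norm_nonneg z]
    nlinarith
  let F : ℂ → ℂ := fun w => f (Complex.exp w) *
    Complex.exp (Complex.I * b * Complex.exp w ^ 2 / 2) / (Complex.exp w + 1) ^ N
  have hpos : ∀ w : ℂ, θ ≤ w.im → w.im ≤ Real.pi / 2 → 0 ≤ (Complex.exp w).re := by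
    intro w hw1 hw2
    rw [Complex.exp_re]
    exact mul_nonneg (Real.exp_pos _).le (Real.cos_nonneg_of_mem_Icc ⟨by linarith, hw2⟩)
  have hne : ∀ w : ℂ, θ ≤ w.im → w.im ≤ Real.pi / 2 → 0 < ‖Complex.exp w + 1‖ := by
    intro w hw1 hw2
    have := one_add_norm_le_two_mul (hpos w hw1 hw2)
    linarith [norm_nonneg (Complex.exp w)]
  have hFn : ∀ w, ‖F w‖ = ‖f (Complex.exp w)‖ *
      Real.exp (-(b * (Complex.exp w).re * (Complex.exp w).im)) / ‖Complex.exp w + 1‖ ^ N := by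
    intro w
    simp only [F]
    rw [norm_div, norm_mul, norm_pow, norm_exp_I_mul_sq]
  have hFle : ∀ w : ℂ, θ ≤ w.im → w.im ≤ Real.pi / 2 → ‖F w‖ ≤ C * 2 ^ N *
      Real.exp (a * (Complex.exp w).im ^ 2 - b * (Complex.exp w).re * (Complex.exp w).im) := by
    intro w hw1 hw2
    have hp := hne w hw1 hw2
    rw [hFn, div_le_iff₀ (by positivity), sub_eq_add_neg, Real.exp_add]
    calc _ ≤ (C * 2 ^ N * ‖Complex.exp w + 1‖ ^ N * Real.exp (a * (Complex.exp w).im ^ 2)) *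
          Real.exp (-(b * (Complex.exp w).re * (Complex.exp w).im)) := by
          gcongr
          exact h3 _ (hpos w hw1 hw2)
      _ = _ := by ring
  have key : ‖F (Complex.log z)‖ ≤ C * 2 ^ N := by
    -- The exponent 2 is allowed because the strip has width π/2 - θ < π/2.
    refine PhragmenLindelof.horizontal_strip (a := θ) (b := Real.pi / 2) ?_
      ⟨2, ?_, a, ?_⟩ ?_ ?_ ?_ ?_
    · refine DifferentiableOn.diffContOnCl fun w hw => DifferentiableAt.differentiableWithinAt ?_
      have hw' : w ∈ Complex.im ⁻¹' Set.Icc θ (Real.pi / 2) :=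
        closure_minimal (Set.preimage_mono Set.Ioo_subset_Icc_self)
          (isClosed_Icc.preimage Complex.continuous_im) hw
      have hne' : (Complex.exp w + 1) ^ N ≠ 0 := pow_ne_zero _ (norm_pos_iff.1 (hne w hw'.1 hw'.2))
      have hfe : DifferentiableAt ℂ (fun w => f (Complex.exp w)) w :=
        (hf _).comp w Complex.differentiableAt_exp
      exact (hfe.mul (by fun_prop)).div (by fun_prop) hne'
    · rw [lt_div_iff₀ (by linarith)]
      linarith
    · refine Asymptotics.IsBigO.of_bound (C * 2 ^ N) ?_
      refine Filter.eventually_inf_principal.2 (Filter.Eventually.of_forall fun w hw => ?_)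
      refine (hFle w hw.1.le hw.2.le).trans ?_
      rw [Real.norm_of_nonneg (Real.exp_pos _).le]
      gcongr
      have hsq : (Complex.exp w).im ^ 2 ≤ Real.exp (2 * |w.re|) := by
        have h5 : |(Complex.exp w).im| ≤ Real.exp |w.re| := by
          refine (Complex.abs_im_le_norm _).trans ?_
          rw [Complex.norm_exp]
          exact Real.exp_le_exp.2 (le_abs_self _)
        calc (Complex.exp w).im ^ 2 = |(Complex.exp w).im| ^ 2 := (sq_abs _).symm
          _ ≤ Real.exp |w.re| ^ 2 := by gcongr
          _ = _ := by rw [← Real.exp_nat_mul]; norm_num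
      have h6 : 0 ≤ b * (Complex.exp w).re * (Complex.exp w).im := by
        refine mul_nonneg (mul_nonneg hb.le (hpos w hw.1.le hw.2.le)) ?_
        rw [Complex.exp_im]
        exact mul_nonneg (Real.exp_pos _).le (Real.sin_nonneg_of_nonneg_of_le_pi
          (by linarith [hw.1]) (by linarith [hw.2, Real.pi_pos]))
      nlinarith
    · intro w hw
      refine (hFle w hw.ge (by linarith)).trans (mul_le_of_le_one_right (by positivity) ?_)
      rw [Real.exp_le_one_iff, Complex.exp_re, Complex.exp_im, hw]
      refine le_of_eq ?_
      linear_combination Real.exp w.re ^ 2 * Real.sin θ * htan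
    · intro w hw
      have he : Complex.exp w = (Real.exp w.re : ℝ) * Complex.I := by
        apply Complex.ext
        · simp [Complex.exp_re, hw, -Complex.ofReal_exp]
        · simp [Complex.exp_im, hw, -Complex.ofReal_exp]
      have hp := hne w (by linarith) hw.le
      have h7 := h2 (Real.exp w.re)
      rw [← he, abs_of_pos (Real.exp_pos _)] at h7
      have h8 : 1 + Real.exp w.re ≤ 2 * ‖Complex.exp w + 1‖ := by
        have := one_add_norm_le_two_mul (hpos w (by linarith) hw.le)
        rwa [Complex.norm_exp] at this
      have h9 : (Complex.exp w).re = 0 := by rw [he]; simp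
      rw [hFn, h9, div_le_iff₀ (by positivity)]
      simp only [mul_zero, zero_mul, neg_zero, Real.exp_zero, mul_one]
      refine h7.trans ?_
      rw [mul_assoc, ← mul_pow]
      gcongr
    · rw [Complex.log_im]
      exact hle
    · rw [Complex.log_im]
      exact harg1
  rw [hFn, Complex.exp_log hz0] at key
  have hp : 0 < ‖z + 1‖ := by
    have := one_add_norm_le_two_mul hx
    linarith [norm_nonneg z]
  rw [div_le_iff₀ (by positivity), Real.exp_neg, ← div_eq_mul_inv, div_le_iff₀ (Real.exp_pos _)] at key
  exact key

/-- The constant in the auxiliary bound does not depend on b, so b can tend to 0. -/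
theorem norm_le_in_quadrant (hf : Differentiable ℂ f) (ha : 0 < a) (hC : 0 ≤ C)
    (h1 : ∀ z, ‖f z‖ ≤ C * (1 + ‖z‖) ^ N * Real.exp (a * z.im ^ 2))
    (h2 : ∀ y : ℝ, ‖f (y * Complex.I)‖ ≤ C * (1 + |y|) ^ N) {z : ℂ}
    (hx : 0 ≤ z.re) (hy : 0 ≤ z.im) : ‖f z‖ ≤ C * 2 ^ N * (1 + ‖z‖) ^ N := by
  have hlim : Filter.Tendsto (fun b : ℝ => C * 2 ^ N * ‖z + 1‖ ^ N * Real.exp (b * z.re * z.im))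
      (nhdsWithin 0 (Set.Ioi 0)) (nhds (C * 2 ^ N * ‖z + 1‖ ^ N * Real.exp (0 * z.re * z.im))) :=
    Filter.Tendsto.mono_left (Continuous.tendsto (by fun_prop) 0) nhdsWithin_le_nhds
  have h3 : ‖f z‖ ≤ C * 2 ^ N * ‖z + 1‖ ^ N * Real.exp (0 * z.re * z.im) :=
    ge_of_tendsto hlim (eventually_nhdsWithin_of_forall fun b hb =>
      norm_le_in_quadrant_aux hf ha hC h1 h2 hb hx hy)
  rw [zero_mul, zero_mul, Real.exp_zero, mul_one] at h3
  refine h3.trans ?_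
  gcongr
  refine (norm_add_le _ _).trans_eq ?_
  rw [norm_one, add_comm]

/-- Both hypotheses are invariant under z ↦ -z and under conjugating argument and value, which
reduces every quadrant to the first. -/
theorem norm_le_of_growth (hf : Differentiable ℂ f) (ha : 0 < a) (hC : 0 ≤ C)
    (h1 : ∀ z, ‖f z‖ ≤ C * (1 + ‖z‖) ^ N * Real.exp (a * z.im ^ 2))
    (h2 : ∀ y : ℝ, ‖f (y * Complex.I)‖ ≤ C * (1 + |y|) ^ N) (z : ℂ) :
    ‖f z‖ ≤ C * 2 ^ N * (1 + ‖z‖) ^ N := by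
  have hup : ∀ f : ℂ → ℂ, Differentiable ℂ f →
      (∀ z, ‖f z‖ ≤ C * (1 + ‖z‖) ^ N * Real.exp (a * z.im ^ 2)) →
      (∀ y : ℝ, ‖f (y * Complex.I)‖ ≤ C * (1 + |y|) ^ N) → ∀ z : ℂ, 0 ≤ z.re →
      ‖f z‖ ≤ C * 2 ^ N * (1 + ‖z‖) ^ N := by
    intro f hf h1 h2 z hz
    rcases le_total 0 z.im with hy | hy
    · exact norm_le_in_quadrant hf ha hC h1 h2 hz hy
    · have := norm_le_in_quadrant (N := N) (f := fun z => (starRingEnd ℂ) (f ((starRingEnd ℂ) z)))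
        (z := (starRingEnd ℂ) z) (fun z => by
          simpa [Function.comp_def] using (hf ((starRingEnd ℂ) z)).conj_conj) ha hC
        (fun z => ?_) (fun y => ?_) (by simpa using hz) (by simpa using hy)
      · simpa using this
      · have := h1 ((starRingEnd ℂ) z)
        simpa using this
      · have := h2 (-y)
        simpa using this
  rcases le_total 0 z.re with hx | hx
  · exact hup f hf h1 h2 z hx
  · have := hup (fun z => f (-z)) (hf.comp differentiable_neg) (fun z => by simpa using h1 (-z))
      (fun y => by simpa using h2 (-y)) (-z) (by simpa using hx)
    simpa using this

/-- Cauchy's estimate on circles of radius R → ∞: R^N from the growth against R^{N+1} in the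
denominator. -/
theorem iteratedDeriv_eq_zero_of_norm_le (hf : Differentiable ℂ f)
    (h : ∀ z, ‖f z‖ ≤ C * (1 + ‖z‖) ^ N) (z : ℂ) : iteratedDeriv (N + 1) f z = 0 := by
  have hC : 0 ≤ C := by simpa using (norm_nonneg _).trans (h 0)
  set K := ((N + 1).factorial : ℝ) * (C * (2 + ‖z‖) ^ N)
  have hb : ∀ n : ℕ, ‖iteratedDeriv (N + 1) f z‖ ≤ K * (1 / ((n : ℝ) + 1)) := by
    intro n
    set R : ℝ := (n : ℝ) + 1
    have hR : 1 ≤ R := by simp [R]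
    have h1 := Complex.norm_iteratedDeriv_le_of_forall_mem_sphere_norm_le (N + 1) (c := z) (R := R)
      (C := C * ((2 + ‖z‖) * R) ^ N) (by linarith) hf.diffContOnCl fun w hw => by
        refine (h w).trans ?_
        gcongr
        have : ‖w‖ ≤ ‖w - z‖ + ‖z‖ := by simpa using norm_add_le (w - z) z
        rw [mem_sphere_iff_norm.1 hw] at this
        nlinarith [norm_nonneg z]
    refine h1.trans_eq ?_
    simp only [K]
    rw [mul_pow, pow_succ]
    have : R ≠ 0 := by linarith
    field_simp
  have hlim : Filter.Tendsto (fun n : ℕ => K * (1 / ((n : ℝ) + 1))) Filter.atTop (nhds 0) := by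
    simpa using (tendsto_one_div_add_atTop_nhds_zero_nat (𝕜 := ℝ)).const_mul K
  have := ge_of_tendsto' hlim hb
  exact norm_le_zero_iff.1 this

end PhragmenLindelof

/-! ### Continuity of fibre integrals and of outer products -/

section FiberCLM

variable {n : ℕ}

theorem finsetSup_seminorm_real_eq {E : Type*} [NormedAddCommGroup E] [NormedSpace ℝ E]
    (s : Finset (ℕ × ℕ)) (f : 𝓢(E, ℂ)) :
    s.sup (schwartzSeminormFamily ℝ E ℂ) f = s.sup (schwartzSeminormFamily ℂ E ℂ) f := by
  simp only [Seminorm.finset_sup_apply]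
  rfl

theorem fiber_bound_seminorm {F : Type} [NormedAddCommGroup F] [NormedSpace ℝ F]
    (G : 𝓢(Rn n × Rn n, F)) (k m : ℕ) (x y : Rn n) :
    ‖x‖ ^ k * ‖G (x, y)‖ ≤ 2 ^ (k + m) * ((Finset.Iic (k + m, 0)).sup
      (schwartzSeminormFamily ℝ (Rn n × Rn n) F)) G * (1 + ‖y‖) ^ (-(m : ℝ)) := by
  have h := SchwartzMap.one_add_le_sup_seminorm_apply (𝕜 := ℝ) (m := (k + m, 0))
    (k := k + m) (n := 0) le_rfl le_rfl G (x, y)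
  simp only [norm_iteratedFDeriv_zero] at h
  have hx : ‖x‖ ≤ 1 + ‖(x, y)‖ := (norm_fst_le (x, y)).trans (by linarith)
  have hy : 1 + ‖y‖ ≤ 1 + ‖(x, y)‖ := by linarith [norm_snd_le (x, y)]
  have hpos : (0 : ℝ) < (1 + ‖y‖) ^ m := by positivity
  rw [Real.rpow_neg (by positivity), Real.rpow_natCast, ← div_eq_mul_inv, le_div_iff₀ hpos]
  refine le_trans ?_ h
  rw [pow_add]
  calc ‖x‖ ^ k * ‖G (x, y)‖ * (1 + ‖y‖) ^ m = ‖x‖ ^ k * (1 + ‖y‖) ^ m * ‖G (x, y)‖ := by ring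
    _ ≤ _ := by gcongr

/-- A quantitative `fiber_decay`: bounding by seminorms of `G` yields continuity of fibre
integration. The target `F` varies because each derivative changes it. -/
theorem fiber_decay_seminorm (k m : ℕ) : ∀ {F : Type} [NormedAddCommGroup F] [NormedSpace ℝ F],
    ∃ (s : Finset (ℕ × ℕ)) (C : ℝ), 0 ≤ C ∧ ∀ (G : 𝓢(Rn n × Rn n, F)) (x : Rn n),
      ‖x‖ ^ k * ‖iteratedFDeriv ℝ m (fun x => ∫ y, G (x, y)) x‖ ≤
        C * (s.sup (schwartzSeminormFamily ℝ (Rn n × Rn n) F)) G := by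
  induction m with
  | zero =>
    intro F _ _
    set p := (volume : Measure (Rn n)).integrablePower
    have hp := Measure.integrable_pow_neg_integrablePower (volume : Measure (Rn n))
    refine ⟨Finset.Iic (k + p, 0), 2 ^ (k + p) * ∫ y : Rn n, (1 + ‖y‖) ^ (-(p : ℝ)),
      mul_nonneg (by positivity) (integral_nonneg fun _ => by positivity), fun G x => ?_⟩
    rw [norm_iteratedFDeriv_zero]
    calc ‖x‖ ^ k * ‖∫ y, G (x, y)‖ ≤ ‖x‖ ^ k * ∫ y, ‖G (x, y)‖ := by
          gcongr
          exact norm_integral_le_integral_norm _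
      _ = ∫ y, ‖x‖ ^ k * ‖G (x, y)‖ := (integral_const_mul _ _).symm
      _ ≤ ∫ y, 2 ^ (k + p) * ((Finset.Iic (k + p, 0)).sup
            (schwartzSeminormFamily ℝ (Rn n × Rn n) F)) G * (1 + ‖y‖) ^ (-(p : ℝ)) :=
          integral_mono ((fiber_integrable G x).norm.const_mul _) (hp.const_mul _)
            (fiber_bound_seminorm G k p x)
      _ = _ := by
          rw [integral_const_mul]
          ring
  | succ m ih =>
    intro F _ _
    obtain ⟨s, C, hC, h⟩ := ih (F := Rn n →L[ℝ] F)
    let D : 𝓢(Rn n × Rn n, F) →L[ℝ] 𝓢(Rn n × Rn n, Rn n →L[ℝ] F) :=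
      (SchwartzMap.postcompCLM (𝕜 := ℝ)
        ((ContinuousLinearMap.compL ℝ (Rn n) (Rn n × Rn n) F).flip
          (ContinuousLinearMap.inl ℝ (Rn n) (Rn n)))) ∘L
        (SchwartzMap.fderivCLM ℝ (Rn n × Rn n) F)
    obtain ⟨s', C', -, h'⟩ := Seminorm.bound_of_continuous (schwartz_withSeminorms ℝ (Rn n × Rn n) F)
      ((s.sup (schwartzSeminormFamily ℝ (Rn n × Rn n) (Rn n →L[ℝ] F))).comp D.toLinearMap)
      ((continuous_finsetSup_seminorm s).comp D.continuous)
    refine ⟨s', C * C', mul_nonneg hC C'.2, fun G x => ?_⟩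
    rw [← norm_iteratedFDeriv_fderiv,
      show fderiv ℝ (fun x => ∫ y, G (x, y)) = fun x => ∫ y, fderivFst G (x, y) from
        funext fun x => (fiber_hasFDerivAt G x).fderiv, mul_assoc]
    exact (h (fderivFst G) x).trans (mul_le_mul_of_nonneg_left (h' G) hC)

/-- Integration over the second variable as a continuous linear map. -/
def fiberCLM : 𝓢(Rn n × Rn n, ℂ) →L[ℂ] 𝓢(Rn n, ℂ) :=
  SchwartzMap.mkCLM (fun G x => ∫ y, G (x, y))
    (fun F G x => by
      simpa using integral_add (fiber_integrable F x) (fiber_integrable G x))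
    (fun a F x => by simp [integral_const_mul])
    (fun G => contDiff_infty.2 fun m => fiber_contDiff m G)
    fun q => by
      obtain ⟨s, C, hC, h⟩ := fiber_decay_seminorm (n := n) q.1 q.2 (F := ℂ)
      exact ⟨s, C, hC, fun G x => by simpa only [finsetSup_seminorm_real_eq] using h G x⟩

/-- `fiberIntegral` as a continuous linear map. -/
def fiberIntegralCLM (w : Rn n × Rn n → ℂ) : 𝓢(Rn n × Rn n, ℂ) →L[ℂ] 𝓢(Rn n, ℂ) :=
  fiberCLM ∘L SchwartzMap.smulLeftCLM ℂ w

theorem fiberIntegralCLM_apply (w : Rn n × Rn n → ℂ) (hw : w.HasTemperateGrowth)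
    (F : 𝓢(Rn n × Rn n, ℂ)) : fiberIntegralCLM w F = fiberIntegral w hw F := by
  ext x
  change ∫ y, SchwartzMap.smulLeftCLM ℂ w F (x, y) = ∫ y, w (x, y) * F (x, y)
  simp [hw]

theorem outer_decay_seminorm (γ : 𝓢(Rn n, ℂ)) (k m : ℕ) :
    ∃ (s : Finset (ℕ × ℕ)) (C : ℝ), 0 ≤ C ∧ ∀ (g : 𝓢(Rn n, ℂ)) (p : Rn n × Rn n),
      ‖p‖ ^ k * ‖iteratedFDeriv ℝ m (outer g γ) p‖ ≤
        C * (s.sup (schwartzSeminormFamily ℂ (Rn n) ℂ)) g := by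
  let sf := fun a b => SchwartzMap.seminorm ℂ a b γ
  have hsf : ∀ a b, 0 ≤ sf a b := fun a b => apply_nonneg _ _
  let s : Finset (ℕ × ℕ) := Finset.Iic (k, m)
  refine ⟨s, ∑ i ∈ Finset.range (m + 1), (m.choose i : ℝ) * (sf 0 (m - i) + sf k (m - i)),
    Finset.sum_nonneg fun i _ => by have := hsf 0 (m - i); have := hsf k (m - i); positivity,
    fun g p => ?_⟩
  have hg : ContDiff ℝ ∞ (fun p : Rn n × Rn n => g p.1) := (g.smooth ⊤).comp contDiff_fst
  have hf : ContDiff ℝ ∞ (fun p : Rn n × Rn n => γ p.2) := (γ.smooth ⊤).comp contDiff_snd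
  have bg : ∀ (i : ℕ), ‖iteratedFDeriv ℝ i (fun p : Rn n × Rn n => g p.1) p‖ ≤
      ‖iteratedFDeriv ℝ i g p.1‖ := by
    intro i
    have h := ContinuousLinearMap.iteratedFDeriv_comp_right
      (ContinuousLinearMap.fst ℝ (Rn n) (Rn n)) (g.smooth ⊤) p (i := i) (mod_cast le_top)
    change ‖iteratedFDeriv ℝ i (g ∘ ContinuousLinearMap.fst ℝ (Rn n) (Rn n)) p‖ ≤ _
    rw [h]
    refine (ContinuousMultilinearMap.norm_compContinuousLinearMap_le _ _).trans ?_
    refine mul_le_of_le_one_right (norm_nonneg _) ?_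
    exact Finset.prod_le_one (fun _ _ => norm_nonneg _)
      (fun _ _ => ContinuousLinearMap.norm_fst_le ..)
  have bf : ∀ (i : ℕ), ‖iteratedFDeriv ℝ i (fun p : Rn n × Rn n => γ p.2) p‖ ≤
      ‖iteratedFDeriv ℝ i γ p.2‖ := by
    intro i
    have h := ContinuousLinearMap.iteratedFDeriv_comp_right
      (ContinuousLinearMap.snd ℝ (Rn n) (Rn n)) (γ.smooth ⊤) p (i := i) (mod_cast le_top)
    change ‖iteratedFDeriv ℝ i (γ ∘ ContinuousLinearMap.snd ℝ (Rn n) (Rn n)) p‖ ≤ _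
    rw [h]
    refine (ContinuousMultilinearMap.norm_compContinuousLinearMap_le _ _).trans ?_
    refine mul_le_of_le_one_right (norm_nonneg _) ?_
    exact Finset.prod_le_one (fun _ _ => norm_nonneg _)
      (fun _ _ => ContinuousLinearMap.norm_snd_le ..)
  set X := s.sup (schwartzSeminormFamily ℂ (Rn n) ℂ) g
  have hX : 0 ≤ X := apply_nonneg _ _
  have hle : ∀ a b, a ≤ k → b ≤ m → SchwartzMap.seminorm ℂ a b g ≤ X := fun a b ha hb =>
    Seminorm.le_finset_sup_apply (p := schwartzSeminormFamily ℂ (Rn n) ℂ) (i := (a, b))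
      (by simp [s, ha, hb])
  have h1 := norm_iteratedFDeriv_mul_le (𝕜 := ℝ) hg hf p (n := m) (mod_cast le_top)
  refine (mul_le_mul_of_nonneg_left h1 (by positivity)).trans ?_
  rw [Finset.mul_sum, Finset.sum_mul]
  refine Finset.sum_le_sum fun i hi => ?_
  have him : i ≤ m := Nat.lt_succ_iff.1 (Finset.mem_range.1 hi)
  have hp : ‖p‖ ^ k ≤ ‖p.1‖ ^ k + ‖p.2‖ ^ k := by
    rw [Prod.norm_def]
    rcases max_cases ‖p.1‖ ‖p.2‖ with h | h <;> rw [h.1]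
    · exact le_add_of_nonneg_right (by positivity)
    · exact le_add_of_nonneg_left (by positivity)
  set A := ‖iteratedFDeriv ℝ i g p.1‖
  set B := ‖iteratedFDeriv ℝ (m - i) γ p.2‖
  have hA0 : A ≤ X := le_trans (by simpa using SchwartzMap.le_seminorm ℂ 0 i g p.1)
    (hle 0 i (Nat.zero_le _) him)
  have hB0 : B ≤ sf 0 (m - i) := by simpa using SchwartzMap.le_seminorm ℂ 0 (m - i) γ p.2
  have hAk : ‖p.1‖ ^ k * A ≤ X := (SchwartzMap.le_seminorm ℂ k i g p.1).trans (hle k i le_rfl him)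
  have hBk : ‖p.2‖ ^ k * B ≤ sf k (m - i) := SchwartzMap.le_seminorm ℂ k (m - i) γ p.2
  have hA : 0 ≤ A := norm_nonneg _
  have hB : 0 ≤ B := norm_nonneg _
  calc _ ≤ (‖p.1‖ ^ k + ‖p.2‖ ^ k) * ((m.choose i : ℝ) * A * B) := by
        gcongr
        · exact bg i
        · exact bf (m - i)
    _ = (m.choose i : ℝ) * ((‖p.1‖ ^ k * A) * B + A * (‖p.2‖ ^ k * B)) := by ring
    _ ≤ (m.choose i : ℝ) * (X * sf 0 (m - i) + X * sf k (m - i)) := by gcongr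
    _ = _ := by ring

/-- The outer product with a fixed second factor as a continuous linear map. -/
def outerCLM (γ : 𝓢(Rn n, ℂ)) : 𝓢(Rn n, ℂ) →L[ℂ] 𝓢(Rn n × Rn n, ℂ) :=
  SchwartzMap.mkCLM (fun g p => outer g γ p)
    (fun f g p => by
      change (f + g) p.1 * γ p.2 = f p.1 * γ p.2 + g p.1 * γ p.2
      rw [add_apply, add_mul])
    (fun a f p => by
      change (a • f) p.1 * γ p.2 = a • (f p.1 * γ p.2)
      rw [smul_apply, smul_mul_assoc])
    (fun g => (outer g γ).smooth ⊤)
    fun q => outer_decay_seminorm γ q.1 q.2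

/-- The shear `(x, y) ↦ (x, y - x)`. -/
def shear : (Rn n × Rn n) ≃L[ℝ] (Rn n × Rn n) :=
  ContinuousLinearEquiv.equivOfInverse
    ((ContinuousLinearMap.fst ℝ (Rn n) (Rn n)).prod
      (ContinuousLinearMap.snd ℝ (Rn n) (Rn n) - ContinuousLinearMap.fst ℝ (Rn n) (Rn n)))
    ((ContinuousLinearMap.fst ℝ (Rn n) (Rn n)).prod
      (ContinuousLinearMap.snd ℝ (Rn n) (Rn n) + ContinuousLinearMap.fst ℝ (Rn n) (Rn n)))
    (fun p => by simp) (fun p => by simp)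

/-- The map `g ↦ ((x, y) ↦ g(x) γ(y - x))`. -/
def shearOuterCLM (γ : 𝓢(Rn n, ℂ)) : 𝓢(Rn n, ℂ) →L[ℂ] 𝓢(Rn n × Rn n, ℂ) :=
  SchwartzMap.compCLMOfContinuousLinearEquiv ℂ shear ∘L outerCLM γ

@[simp] theorem shearOuterCLM_apply (γ g : 𝓢(Rn n, ℂ)) (x y : Rn n) :
    shearOuterCLM γ g (x, y) = g x * γ (y - x) := rfl

end FiberCLM

/-! ### Gaussians attached to the inner product -/

section InnerGauss

variable (E : Type*) [NormedAddCommGroup E] [InnerProductSpace ℝ E]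

/-- The inner product as a bilinear map with complex values. -/
def innerC : E →L[ℝ] E →L[ℝ] ℂ :=
  (ContinuousLinearMap.compL ℝ E ℝ ℂ Complex.ofRealCLM).comp
    (isBoundedBilinearMap_inner (𝕜 := ℝ) (E := E)).toContinuousLinearMap

@[simp] theorem innerC_apply (v w : E) : innerC E v w = (inner ℝ v w : ℝ) := rfl

variable {E}

theorem negDef_smul_innerC {a : ℝ} (ha : 0 < a) : NegDef ((-a : ℂ) • innerC E) :=
  ⟨a, ha, fun v => by
    simp only [smul_apply, innerC_apply, real_inner_self_eq_norm_sq, smul_eq_mul, neg_mul,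
      Complex.neg_re, ← Complex.ofReal_mul, Complex.ofReal_re, le_refl]⟩

/-- The Gaussian `exp (-a |v|² + ℓ v)`. -/
def innerGauss {a : ℝ} (ha : 0 < a) (ℓ : E →L[ℝ] ℂ) : 𝓢(E, ℂ) :=
  gaussExp ((-a : ℂ) • innerC E) (negDef_smul_innerC ha) ℓ

theorem innerGauss_apply {a : ℝ} (ha : 0 < a) (ℓ : E →L[ℝ] ℂ) (v : E) :
    innerGauss ha ℓ v = Complex.exp (-a * (‖v‖ : ℂ) ^ 2 + ℓ v) := by
  rw [innerGauss, gaussExp_apply]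
  simp

end InnerGauss

/-! ### Moments of shifted Gaussians -/

section Moments

/-- The moment `∫ uᵏ exp (-π (u - z)²) du`. -/
def moment (k : ℕ) (z : ℂ) : ℂ := ∫ u : ℝ, (u : ℂ) ^ k * Complex.exp (-Real.pi * (u - z) ^ 2)

theorem integrable_moment (k : ℕ) (z : ℂ) :
    Integrable fun u : ℝ => (u : ℂ) ^ k * Complex.exp (-Real.pi * (u - z) ^ 2) := by
  let f : 𝓢(ℝ, ℂ) := innerGauss Real.pi_pos ((2 * Real.pi * z) • Complex.ofRealCLM)
  have hf := f.integrable_pow_mul volume k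
  have h2 : Integrable fun u : ℝ => (u : ℂ) ^ k * f u := by
    refine hf.mono' (by have := f.continuous; fun_prop) (.of_forall fun u => ?_)
    simp
  refine (h2.const_mul (Complex.exp (-Real.pi * z ^ 2))).congr (.of_forall fun u => ?_)
  simp only [f, innerGauss_apply]
  rw [mul_left_comm, ← Complex.exp_add]
  congr 2
  have : ((|u| : ℝ) : ℂ) ^ 2 = (u : ℂ) ^ 2 := by rw [← Complex.ofReal_pow, sq_abs, Complex.ofReal_pow]
  simp [this]
  ring

theorem moment_zero (z : ℂ) : moment 0 z = 1 := by
  have h := integral_cexp_quadratic (b := -(Real.pi : ℂ)) (by simpa using Real.pi_pos)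
    (2 * Real.pi * z) (-Real.pi * z ^ 2)
  have hπ : (Real.pi : ℂ) ≠ 0 := by exact_mod_cast Real.pi_ne_zero
  have h1 : moment 0 z = ∫ x : ℝ, Complex.exp (-(Real.pi : ℂ) * x ^ 2 + 2 * Real.pi * z * x +
      -Real.pi * z ^ 2) := by
    refine integral_congr_ae (.of_forall fun u => ?_)
    simp only [pow_zero, one_mul]
    congr 1
    ring
  rw [h1, h, neg_neg, div_self hπ, Complex.one_cpow, one_mul, ← Complex.exp_zero]
  congr 1
  field_simp
  ring

theorem hasDerivAt_moment_integrand (k : ℕ) (z : ℂ) (u : ℝ) :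
    HasDerivAt (fun u : ℝ => (u : ℂ) ^ k * Complex.exp (-Real.pi * (u - z) ^ 2))
      (k * ((u : ℂ) ^ (k - 1) * Complex.exp (-Real.pi * (u - z) ^ 2)) +
        (2 * Real.pi * z * ((u : ℂ) ^ k * Complex.exp (-Real.pi * (u - z) ^ 2)) -
        2 * Real.pi * ((u : ℂ) ^ (k + 1) * Complex.exp (-Real.pi * (u - z) ^ 2)))) u := by
  have h1 : HasDerivAt (fun w : ℂ => w ^ k * Complex.exp (-Real.pi * (w - z) ^ 2))
      (k * (u : ℂ) ^ (k - 1) * Complex.exp (-Real.pi * ((u : ℂ) - z) ^ 2) +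
        (u : ℂ) ^ k * (Complex.exp (-Real.pi * ((u : ℂ) - z) ^ 2) *
          (-Real.pi * (2 * ((u : ℂ) - z))))) (u : ℂ) := by
    refine ((hasDerivAt_pow k _).mul
      ((((hasDerivAt_id _).sub_const z).pow 2).const_mul _).cexp).congr_deriv ?_
    simp
  refine h1.comp_ofReal.congr_deriv ?_
  ring

/-- The derivative of u^k e^{-π(u-z)²} integrates to zero. At k = 0 the truncated `k - 1` is
harmless, as its coefficient is 0. -/
theorem mul_moment (k : ℕ) (z : ℂ) :
    z * moment k z = moment (k + 1) z - k / (2 * Real.pi) * moment (k - 1) z := by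
  have h := integral_eq_zero_of_hasDerivAt_of_integrable (hasDerivAt_moment_integrand k z)
    (((integrable_moment (k - 1) z).const_mul _).add
      (((integrable_moment k z).const_mul _).sub ((integrable_moment (k + 1) z).const_mul _)))
    (integrable_moment k z)
  have hs := ((integrable_moment k z).const_mul (2 * Real.pi * z)).sub
    ((integrable_moment (k + 1) z).const_mul (2 * Real.pi))
  simp only [Pi.sub_def] at hs
  rw [integral_add ((integrable_moment (k - 1) z).const_mul _) hs,
    integral_sub ((integrable_moment k z).const_mul _) ((integrable_moment (k + 1) z).const_mul _),
    integral_const_mul, integral_const_mul, integral_const_mul] at h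
  change k * moment (k - 1) z + (2 * Real.pi * z * moment k z - 2 * Real.pi * moment (k + 1) z) = 0 at h
  have hπ : (Real.pi : ℂ) ≠ 0 := by exact_mod_cast Real.pi_ne_zero
  field_simp
  linear_combination h

/-- By `mul_moment`, multiplication by z raises the order of a moment by at most one, and the moment
of order 0 is the constant 1. -/
theorem pow_mem_span_moment (N : ℕ) :
    (fun z : ℂ => z ^ N) ∈ Submodule.span ℂ (moment '' Set.Iic N) := by
  induction N with
  | zero =>
    refine Submodule.subset_span ⟨0, by simp, ?_⟩
    ext z
    simp [moment_zero]
  | succ N ih =>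
    have key : ∀ f ∈ Submodule.span ℂ (moment '' Set.Iic N),
        (fun z => z * f z) ∈ Submodule.span ℂ (moment '' Set.Iic (N + 1)) := by
      intro f hf
      induction hf using Submodule.span_induction with
      | mem f hf =>
        obtain ⟨k, hk, rfl⟩ := hf
        have : (fun z => z * moment k z) =
            moment (k + 1) - (k / (2 * Real.pi) : ℂ) • moment (k - 1) := by
          ext z
          simp [mul_moment]
        rw [this]
        simp only [Set.mem_Iic] at hk
        exact Submodule.sub_mem _ (Submodule.subset_span ⟨k + 1, by simpa using hk, rfl⟩)
          (Submodule.smul_mem _ _ (Submodule.subset_span ⟨k - 1, by simp; omega, rfl⟩))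
      | zero =>
        simp only [Pi.zero_apply, mul_zero]
        exact Submodule.zero_mem _
      | add f g _ _ hf hg =>
        simp only [Pi.add_apply, mul_add]
        exact Submodule.add_mem _ hf hg
      | smul a f _ hf =>
        simp only [Pi.smul_apply, smul_eq_mul, mul_left_comm _ a]
        exact Submodule.smul_mem _ a hf
    simpa only [pow_succ'] using key _ ih

theorem eval_eq_sum_moment {N : ℕ} {P : Polynomial ℂ} (hP : P.natDegree ≤ N) :
    ∃ c : ℕ → ℂ, ∀ z, P.eval z = ∑ k ∈ Finset.range (N + 1), c k * moment k z := by
  have h1 : (fun z => P.eval z) ∈ Submodule.span ℂ (moment '' Set.Iic N) := by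
    have : (fun z => P.eval z) = ∑ k ∈ Finset.range (N + 1), P.coeff k • fun z : ℂ => z ^ k := by
      ext z
      rw [Polynomial.eval_eq_sum_range' (Nat.lt_succ_of_le hP)]
      simp
    rw [this]
    refine Submodule.sum_mem _ fun k hk => Submodule.smul_mem _ _ ?_
    exact Submodule.span_mono (Set.image_mono (Set.Iic_subset_Iic.2
      (Nat.lt_succ_iff.1 (Finset.mem_range.1 hk)))) (pow_mem_span_moment k)
  have h2 : (Set.Iic N : Set ℕ) = (Finset.range (N + 1) : Set ℕ) := by
    ext k
    simp
  rw [h2, Submodule.mem_span_image_finset_iff_exists_fun] at h1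
  obtain ⟨c, hc⟩ := h1
  refine ⟨fun k => if hk : k ∈ Finset.range (N + 1) then c ⟨k, hk⟩ else 0, fun z => ?_⟩
  rw [← congrFun hc z, ← Finset.sum_attach (Finset.range (N + 1))]
  simp only [Finset.univ_eq_attach, Finset.sum_apply, Pi.smul_apply, smul_eq_mul]
  refine Finset.sum_congr rfl fun k _ => ?_
  rw [dif_pos k.2]

end Moments

/-! ### Interpolation of entire functions with a vanishing derivative -/

section Interpolation

theorem exists_polynomial_of_iteratedDeriv_eq_zero {f : ℂ → ℂ} (hf : Differentiable ℂ f) {N : ℕ}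
    (h : ∀ z, iteratedDeriv (N + 1) f z = 0) :
    ∃ P : Polynomial ℂ, P.natDegree ≤ N ∧ ∀ z, f z = P.eval z := by
  refine ⟨∑ k ∈ Finset.range (N + 1),
    Polynomial.monomial k ((k.factorial : ℂ)⁻¹ * iteratedDeriv k f 0),
    Polynomial.natDegree_sum_le_of_forall_le _ _ fun k hk =>
      (Polynomial.natDegree_monomial_le _).trans (Nat.lt_succ_iff.1 (Finset.mem_range.1 hk)),
    fun z => ?_⟩
  have h0 : ∀ k, N + 1 ≤ k → iteratedDeriv k f = 0 := by
    intro k hk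
    obtain ⟨j, rfl⟩ := Nat.exists_eq_add_of_le hk
    induction j with
    | zero => exact funext h
    | succ j ih =>
      rw [← add_assoc, iteratedDeriv_succ, ih (by omega)]
      ext z
      simp
  rw [← Complex.taylorSeries_eq_of_entire' 0 z hf, tsum_eq_sum (s := Finset.range (N + 1))]
  · rw [Polynomial.eval_finsetSum]
    refine Finset.sum_congr rfl fun k _ => ?_
    simp
  · intro k hk
    rw [h0 k (by simpa using hk)]
    simp

/-- A finite interpolation formula, with coefficients expressed by Gaussian moments, for the entire
functions whose derivative of order `N + 1` vanishes. -/
theorem exists_interpolation (N : ℕ) : ∃ c : Fin (N + 1) → ℕ → ℂ, ∀ f : ℂ → ℂ, Differentiable ℂ f →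
    (∀ z, iteratedDeriv (N + 1) f z = 0) → ∀ z, f z = ∑ j : Fin (N + 1), f (j : ℕ) *
      ∑ k ∈ Finset.range (N + 1), c j k * moment k z := by
  let v : Fin (N + 1) → ℂ := fun j => ((j : ℕ) : ℂ)
  have hv : Set.InjOn v (Finset.univ : Finset (Fin (N + 1))) := fun i _ j _ hij =>
    Fin.ext (by simpa [v] using hij)
  have h : ∀ j, ∃ c : ℕ → ℂ, ∀ z, (Lagrange.basis Finset.univ v j).eval z =
      ∑ k ∈ Finset.range (N + 1), c k * moment k z := by
    intro j
    refine eval_eq_sum_moment ?_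
    rw [Lagrange.natDegree_basis hv (Finset.mem_univ j)]
    simp
  choose c hc using h
  refine ⟨c, fun f hf hz z => ?_⟩
  obtain ⟨P, hP, hfP⟩ := exists_polynomial_of_iteratedDeriv_eq_zero hf hz
  have hdeg : P.degree < (Finset.univ : Finset (Fin (N + 1))).card := by
    simpa using (Polynomial.degree_le_natDegree.trans (Nat.cast_le.2 hP)).trans_lt
      (Nat.cast_lt.2 (Nat.lt_succ_self N))
  have h1 := Lagrange.eq_interpolate_of_eval_eq (r := fun j => f (v j)) hv hdeg
    fun j _ => (hfP (v j)).symm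
  rw [hfP z, h1, Lagrange.interpolate_apply, Polynomial.eval_finsetSum]
  refine Finset.sum_congr rfl fun j _ => ?_
  rw [Polynomial.eval_mul, Polynomial.eval_C, hc]

/-- The one-variable formula has nodes and kernels that do not depend on the frozen coordinates, so
it can be applied to one coordinate after another. -/
theorem multi_interpolation {J : Type*} [Fintype J] (x : J → ℂ) (K : J → ℂ → ℂ) (n : ℕ) :
    ∀ Q : (Fin n → ℂ) → ℂ,
      (∀ ζ i, Q ζ = ∑ j, Q (Function.update ζ i (x j)) * K j (ζ i)) →
      ∀ ζ, Q ζ = ∑ j : Fin n → J, Q (fun i => x (j i)) * ∏ i, K (j i) (ζ i) := by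
  classical
  induction n with
  | zero =>
    intro Q _ ζ
    simp only [Finset.univ_unique, Finset.univ_eq_empty, Finset.prod_empty, mul_one,
      Finset.sum_singleton]
    exact congrArg Q (Subsingleton.elim _ _)
  | succ n ih =>
    intro Q hQ ζ
    have h1 : ∀ (a : ℂ) (η : Fin n → ℂ), Q (Fin.cons a η) =
        ∑ j : Fin n → J, Q (Fin.cons a fun i => x (j i)) * ∏ i, K (j i) (η i) := by
      intro a
      refine ih (fun η => Q (Fin.cons a η)) fun η i => ?_
      have := hQ (Fin.cons a η) i.succ
      simpa only [Fin.cons_succ, ← Fin.cons_update] using this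
    obtain ⟨a, η, rfl⟩ : ∃ a η, ζ = Fin.cons a η := ⟨ζ 0, Fin.tail ζ, (Fin.cons_self_tail ζ).symm⟩
    rw [hQ _ 0]
    simp only [Fin.update_cons_zero, Fin.cons_zero]
    rw [← (Fin.consEquiv fun _ : Fin (n + 1) => J).sum_comp, Fintype.sum_prod_type]
    refine Finset.sum_congr rfl fun j0 _ => ?_
    rw [h1, Finset.sum_mul]
    refine Finset.sum_congr rfl fun j _ => ?_
    rw [Fin.prod_univ_succ]
    have : (fun i => x ((Fin.consEquiv fun _ : Fin (n + 1) => J) (j0, j) i)) =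
        (Fin.cons (x j0) fun i => x (j i) : Fin (n + 1) → ℂ) := by
      ext i
      refine Fin.cases ?_ (fun i => ?_) i <;> simp [Fin.consEquiv]
    rw [this]
    simp [Fin.consEquiv]
    ring

end Interpolation

/-! ### Gaussian moments on `ℝⁿ` -/

theorem integral_prod_moment {n : ℕ} (α : Fin n → ℕ) (ζ : Fin n → ℂ) :
    ∫ w : Rn n, ∏ i, ((w i : ℂ) ^ α i * Complex.exp (-Real.pi * (w i - ζ i) ^ 2)) =
      ∏ i, moment (α i) (ζ i) := by
  rw [← (PiLp.volume_preserving_toLp (Fin n)).integral_comp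
    (MeasurableEquiv.toLp 2 (Fin n → ℝ)).measurableEmbedding]
  exact integral_fintype_prod_eq_prod (𝕜 := ℂ) fun i (u : ℝ) =>
    (u : ℂ) ^ α i * Complex.exp (-Real.pi * (u - ζ i) ^ 2)

/-! ### Gaussians on `ℝ²ⁿ` adapted to a shear -/

section Family

variable {n : ℕ}

/-- The map `(x, y) ↦ y - κ x`. -/
def devCLM (κ : ℝ) : Rn n × Rn n →L[ℝ] Rn n :=
  ContinuousLinearMap.snd ℝ (Rn n) (Rn n) - κ • ContinuousLinearMap.fst ℝ (Rn n) (Rn n)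

@[simp] theorem devCLM_apply (κ : ℝ) (v : Rn n × Rn n) : devCLM κ v = v.2 - κ • v.1 := rfl

/-- The bilinear form whose quadratic form is `-π b |x|² - π c |y - κ x|²`. -/
def famB (κ b c : ℝ) : (Rn n × Rn n) →L[ℝ] (Rn n × Rn n) →L[ℝ] ℂ :=
  (-(Real.pi * b : ℝ) : ℂ) • (innerC (Rn n)).bilinearComp (ContinuousLinearMap.fst ℝ (Rn n) (Rn n))
      (ContinuousLinearMap.fst ℝ (Rn n) (Rn n)) +
    (-(Real.pi * c : ℝ) : ℂ) • (innerC (Rn n)).bilinearComp (devCLM κ) (devCLM κ)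

theorem famB_apply (κ b c : ℝ) (v w : Rn n × Rn n) : famB κ b c v w =
    ((-(Real.pi * b) * inner ℝ v.1 w.1 - Real.pi * c * inner ℝ (devCLM κ v) (devCLM κ w) : ℝ) : ℂ) := by
  change (-(Real.pi * b : ℝ) : ℂ) * (inner ℝ v.1 w.1 : ℝ) + (-(Real.pi * c : ℝ) : ℂ) *
    (inner ℝ (devCLM κ v) (devCLM κ w) : ℝ) = _
  push_cast
  ring

theorem famB_self (κ b c : ℝ) (v : Rn n × Rn n) : famB κ b c v v =
    ((-(Real.pi * b) * ‖v.1‖ ^ 2 - Real.pi * c * ‖devCLM κ v‖ ^ 2 : ℝ) : ℂ) := by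
  rw [famB_apply, real_inner_self_eq_norm_sq, real_inner_self_eq_norm_sq]

theorem norm_sq_le_dev (κ : ℝ) (v : Rn n × Rn n) :
    ‖v‖ ^ 2 ≤ (2 + 2 * κ ^ 2) * (‖v.1‖ ^ 2 + ‖devCLM κ v‖ ^ 2) := by
  have h1 : ‖v.2‖ ≤ ‖devCLM κ v‖ + |κ| * ‖v.1‖ := by
    have := norm_add_le (devCLM κ v) (κ • v.1)
    rwa [devCLM_apply, sub_add_cancel, norm_smul, Real.norm_eq_abs] at this
  have h2 : ‖v.2‖ ^ 2 ≤ 2 * ‖devCLM κ v‖ ^ 2 + 2 * κ ^ 2 * ‖v.1‖ ^ 2 := by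
    have h3 := pow_le_pow_left₀ (norm_nonneg _) h1 2
    have h4 := sq_abs κ
    nlinarith [sq_nonneg (‖devCLM κ v‖ - |κ| * ‖v.1‖)]
  have h5 : ‖v‖ ^ 2 ≤ ‖v.1‖ ^ 2 + ‖v.2‖ ^ 2 := by
    rw [Prod.norm_def]
    rcases max_cases ‖v.1‖ ‖v.2‖ with h | h <;> rw [h.1] <;> nlinarith [sq_nonneg ‖v.1‖, sq_nonneg ‖v.2‖]
  nlinarith [mul_nonneg (sq_nonneg κ) (sq_nonneg ‖devCLM κ v‖), sq_nonneg ‖v.1‖]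

/-- The constant of ellipticity of `famB κ b c`. -/
def famEps (κ b c : ℝ) : ℝ := Real.pi * min b c / (2 + 2 * κ ^ 2)

theorem famEps_pos (κ : ℝ) {b c : ℝ} (hb : 0 < b) (hc : 0 < c) : 0 < famEps κ b c := by
  have := Real.pi_pos
  have := lt_min hb hc
  unfold famEps
  positivity

theorem famEps_mul_norm_sq_le (κ : ℝ) {b c : ℝ} (hb : 0 < b) (hc : 0 < c) (v : Rn n × Rn n) :
    famEps κ b c * ‖v‖ ^ 2 ≤ Real.pi * b * ‖v.1‖ ^ 2 + Real.pi * c * ‖devCLM κ v‖ ^ 2 := by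
  have hπ := Real.pi_pos
  have hm := lt_min hb hc
  have h := mul_le_mul_of_nonneg_left (norm_sq_le_dev κ v) (famEps_pos κ hb hc).le
  refine h.trans ?_
  have : famEps κ b c * ((2 + 2 * κ ^ 2) * (‖v.1‖ ^ 2 + ‖devCLM κ v‖ ^ 2)) =
      Real.pi * min b c * ‖v.1‖ ^ 2 + Real.pi * min b c * ‖devCLM κ v‖ ^ 2 := by
    unfold famEps
    field_simp
  rw [this]
  gcongr
  · exact min_le_left _ _
  · exact min_le_right _ _

theorem negDef_famB (κ : ℝ) {b c : ℝ} (hb : 0 < b) (hc : 0 < c) :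
    NegDef (famB (n := n) κ b c) :=
  ⟨famEps κ b c, famEps_pos κ hb hc, fun v => by
    rw [famB_self, Complex.ofReal_re]
    linarith [famEps_mul_norm_sq_le κ hb hc v]⟩

/-- The complex linear form `v ↦ ∑ ζᵢ vᵢ`. -/
def cdot (ζ : Fin n → ℂ) : Rn n →L[ℝ] ℂ := ∑ i, ζ i • coordC i

theorem cdot_apply (ζ : Fin n → ℂ) (v : Rn n) : cdot ζ v = ∑ i, ζ i * v i := by
  simp [cdot]

theorem sum_update_eq_add {A : Type*} [AddCommMonoid A] (g : Fin n → ℂ → A) (ζ : Fin n → ℂ)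
    (i : Fin n) (s : ℂ) (hg : g i 0 = 0) : ∑ j, g j (Function.update ζ i s j) =
      ∑ j, g j (Function.update ζ i 0 j) + g i s := by
  rw [Fintype.sum_eq_add_sum_compl i fun j => g j (Function.update ζ i s j),
    Fintype.sum_eq_add_sum_compl i fun j => g j (Function.update ζ i 0 j)]
  simp only [Function.update_self, hg, zero_add]
  rw [add_comm]
  congr 1
  refine Finset.sum_congr rfl fun j hj => ?_
  have : j ≠ i := by simpa using hj
  simp [this]

theorem cdot_update (ζ : Fin n → ℂ) (i : Fin n) (s : ℂ) :
    cdot (Function.update ζ i s) = cdot (Function.update ζ i 0) + s • coordC i :=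
  sum_update_eq_add (fun j a => a • coordC j) ζ i s (by ext v; simp)

/-- The sum of squares `∑ ζᵢ²`. -/
def csq (ζ : Fin n → ℂ) : ℂ := ∑ i, ζ i ^ 2

theorem csq_update (ζ : Fin n → ℂ) (i : Fin n) (s : ℂ) :
    csq (Function.update ζ i s) = csq (Function.update ζ i 0) + s ^ 2 := 
  sum_update_eq_add (fun _ a => a ^ 2) ζ i s (by simp)

/-- The linear form `2πi θ·x + 2π ζ·(y - κ x)`. -/
def famL (κ : ℝ) (θ : Rn n) (ζ : Fin n → ℂ) : (Rn n × Rn n) →L[ℝ] ℂ :=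
  (2 * Real.pi * Complex.I) • (innerC (Rn n) θ).comp (ContinuousLinearMap.fst ℝ (Rn n) (Rn n)) +
    (2 * Real.pi : ℂ) • (cdot ζ).comp (devCLM κ)

theorem famL_apply (κ : ℝ) (θ : Rn n) (ζ : Fin n → ℂ) (v : Rn n × Rn n) :
    famL κ θ ζ v = 2 * Real.pi * Complex.I * (inner ℝ θ v.1 : ℝ) +
      2 * Real.pi * cdot ζ (devCLM κ v) := rfl

theorem famL_update (κ : ℝ) (θ : Rn n) (ζ : Fin n → ℂ) (i : Fin n) (s : ℂ) :
    famL κ θ (Function.update ζ i s) = famL κ θ (Function.update ζ i 0) +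
      s • ((2 * Real.pi : ℂ) • (coordC i).comp (devCLM κ)) := by
  refine ContinuousLinearMap.ext fun v => ?_
  rw [famL_apply, cdot_update, add_apply, add_apply, famL_apply]
  simp
  ring

/-- From q₁·x + q₂·y = (q₁ + κq₂)·x + q₂·(y - κx). Thus imaginary ζ exhaust the modulations of one
Gaussian, as the density theorem requires. -/
theorem exists_famL_eq_imForm (κ : ℝ) (lam : (Rn n × Rn n) →L[ℝ] ℝ) :
    ∃ θ η : Rn n, imForm lam = famL κ θ (fun i => Complex.I * η i) := by
  let q1 := (InnerProductSpace.toDual ℝ (Rn n)).symm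
    (lam.comp (ContinuousLinearMap.inl ℝ (Rn n) (Rn n)))
  let q2 := (InnerProductSpace.toDual ℝ (Rn n)).symm
    (lam.comp (ContinuousLinearMap.inr ℝ (Rn n) (Rn n)))
  have hlam : ∀ v, lam v = inner ℝ q1 v.1 + inner ℝ q2 v.2 := by
    intro v
    simp only [q1, q2, InnerProductSpace.toDual_symm_apply, ContinuousLinearMap.comp_apply,
      ContinuousLinearMap.inl_apply, ContinuousLinearMap.inr_apply, ← map_add, Prod.mk_add_mk,
      add_zero, zero_add]
  have hc : ∀ η v : Rn n, cdot (fun i => Complex.I * η i) v = Complex.I * (inner ℝ η v : ℝ) := by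
    intro η v
    rw [cdot_apply, PiLp.inner_apply, Complex.ofReal_sum, Finset.mul_sum]
    refine Finset.sum_congr rfl fun i _ => ?_
    simp
    ring
  refine ⟨(1 / (2 * Real.pi)) • (q1 + κ • q2), (1 / (2 * Real.pi)) • q2, ?_⟩
  refine ContinuousLinearMap.ext fun v => ?_
  have hπ : (Real.pi : ℂ) ≠ 0 := by exact_mod_cast Real.pi_ne_zero
  rw [famL_apply, hc, imForm_apply, hlam, devCLM_apply]
  simp only [inner_smul_left, inner_add_left, inner_sub_right, inner_smul_right]
  simp
  field_simp
  ring

/-- The value of `L` on the Gaussians of the family, normalised by the factor `exp (-π ζ² / c)`. -/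
def famQ (L : 𝓢(Rn n × Rn n, ℂ) →L[ℂ] ℂ) (κ : ℝ) {b c : ℝ} (hb : 0 < b) (hc : 0 < c) (θ : Rn n)
    (ζ : Fin n → ℂ) : ℂ :=
  Complex.exp (-(Real.pi / c) * csq ζ) * L (gaussExp (famB κ b c) (negDef_famB κ hb hc) (famL κ θ ζ))

/-- The derivative in the `i`-th coordinate of the second variable. -/
def derivSnd (i : Fin n) : 𝓢(Rn n × Rn n, ℂ) →L[ℂ] 𝓢(Rn n × Rn n, ℂ) :=
  LineDeriv.lineDerivOpCLM ℂ 𝓢(Rn n × Rn n, ℂ)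
    ((0 : Rn n), (EuclideanSpace.single i (1 : ℝ) : Rn n))

theorem derivSnd_gaussExp (κ : ℝ) {b c : ℝ} (hb : 0 < b) (hc : 0 < c) (θ : Rn n) (ζ : Fin n → ℂ)
    (i : Fin n) :
    derivSnd i (gaussExp (famB κ b c) (negDef_famB κ hb hc) (famL κ θ ζ)) =
      (-c : ℂ) • SchwartzMap.smulLeftCLM ℂ ((2 * Real.pi : ℂ) • (coordC i).comp (devCLM κ))
        (gaussExp (famB κ b c) (negDef_famB κ hb hc) (famL κ θ ζ)) +
      (2 * Real.pi * ζ i) • gaussExp (famB κ b c) (negDef_famB κ hb hc) (famL κ θ ζ) := by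
  ext v
  rw [derivSnd, LineDeriv.lineDerivOpCLM_apply, lineDerivOp_gaussExp_apply, add_apply, smul_apply,
    smul_apply, SchwartzMap.smulLeftCLM_apply_apply (ContinuousLinearMap.hasTemperateGrowth _),
    famB_apply, famB_apply, famL_apply, cdot_apply]
  have hdev : devCLM κ ((0 : Rn n), EuclideanSpace.single i (1 : ℝ)) = EuclideanSpace.single i 1 := by
    simp
  rw [hdev]
  have h3 : ∑ j, ζ j * (((EuclideanSpace.single i (1 : ℝ) : Rn n) j : ℝ) : ℂ) = ζ i := by
    rw [Finset.sum_eq_single i (fun j _ hj => by simp [hj]) (by simp)]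
    simp
  rw [h3]
  simp only [EuclideanSpace.inner_single_right, EuclideanSpace.inner_single_left, smul_eq_mul,
    inner_zero_right, inner_zero_left, smul_apply, ContinuousLinearMap.comp_apply, coordC_apply]
  simp
  ring

/-- Differentiating the Gaussian in ζ_i multiplies it by 2π(y-κx)_i, which by `derivSnd_gaussExp` is
-(1/c)∂_{y_i} plus the scalar 2πζ_i/c. The normalising factor is chosen so that its derivative
cancels this scalar. -/
theorem hasDerivAt_famQ (L : 𝓢(Rn n × Rn n, ℂ) →L[ℂ] ℂ) (κ : ℝ) {b c : ℝ} (hb : 0 < b) (hc : 0 < c)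
    (θ : Rn n) (ζ : Fin n → ℂ) (i : Fin n) (s : ℂ) :
    HasDerivAt (fun s => famQ L κ hb hc θ (Function.update ζ i s))
      (-(1 / c) * famQ (L.comp (derivSnd i)) κ hb hc θ (Function.update ζ i s)) s := by
  have h1 := hasDerivAt_apply_gaussExp L (famB κ b c) (negDef_famB κ hb hc)
    (famL κ θ (Function.update ζ i 0)) ((2 * Real.pi : ℂ) • (coordC i).comp (devCLM κ)) s
  simp only [← famL_update] at h1
  have h2 : HasDerivAt (fun s : ℂ => Complex.exp (-(Real.pi / c) * csq (Function.update ζ i s)))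
      (Complex.exp (-(Real.pi / c) * csq (Function.update ζ i s)) * (-(Real.pi / c) * (2 * s))) s := by
    rw [show (fun s : ℂ => Complex.exp (-(Real.pi / c) * csq (Function.update ζ i s))) =
      fun s : ℂ => Complex.exp (-(Real.pi / c) * (csq (Function.update ζ i 0) + s ^ 2)) from
      funext fun s => by rw [csq_update], csq_update ζ i s]
    have := (((hasDerivAt_id s).pow 2).const_add (csq (Function.update ζ i 0))).const_mul
      (-((Real.pi : ℂ) / c))
    simpa using this.cexp
  have h3 := h2.mul h1
  refine h3.congr_deriv ?_
  have hc' : (c : ℂ) ≠ 0 := by exact_mod_cast hc.ne'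
  have hD := congrArg L (derivSnd_gaussExp κ hb hc θ (Function.update ζ i s) i)
  rw [map_add, map_smul, map_smul, Function.update_self, smul_eq_mul, smul_eq_mul] at hD
  simp only [famQ, ContinuousLinearMap.comp_apply]
  rw [hD]
  field_simp
  ring

theorem differentiable_famQ (L : 𝓢(Rn n × Rn n, ℂ) →L[ℂ] ℂ) (κ : ℝ) {b c : ℝ} (hb : 0 < b)
    (hc : 0 < c) (θ : Rn n) (ζ : Fin n → ℂ) (i : Fin n) :
    Differentiable ℂ fun s => famQ L κ hb hc θ (Function.update ζ i s) :=
  fun s => (hasDerivAt_famQ L κ hb hc θ ζ i s).differentiableAt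

theorem iteratedDeriv_famQ (L : 𝓢(Rn n × Rn n, ℂ) →L[ℂ] ℂ) (κ : ℝ) {b c : ℝ} (hb : 0 < b)
    (hc : 0 < c) (θ : Rn n) (ζ : Fin n → ℂ) (i : Fin n) (k : ℕ) (s : ℂ) :
    iteratedDeriv k (fun s => famQ L κ hb hc θ (Function.update ζ i s)) s =
      (-(1 / c)) ^ k * famQ (L.comp (derivSnd i ^ k)) κ hb hc θ (Function.update ζ i s) := by
  induction k generalizing s with
  | zero => 
    simp only [iteratedDeriv_zero, pow_zero, one_mul]
    rfl
  | succ k ih =>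
    rw [iteratedDeriv_succ, funext ih, ((hasDerivAt_famQ _ κ hb hc θ ζ i s).const_mul _).deriv,
      pow_succ, pow_succ, mul_assoc]
    rfl

theorem iteratedDeriv_famQ_eq_zero {L : 𝓢(Rn n × Rn n, ℂ) →L[ℂ] ℂ} {i : Fin n} {k : ℕ}
    (h : L.comp (derivSnd i ^ k) = 0) (κ : ℝ) {b c : ℝ} (hb : 0 < b) (hc : 0 < c) (θ : Rn n)
    (ζ : Fin n → ℂ) (s : ℂ) :
    iteratedDeriv k (fun s => famQ L κ hb hc θ (Function.update ζ i s)) s = 0 := by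
  rw [iteratedDeriv_famQ, h]
  simp [famQ]

end Family

/-! ### Vanishing of transversal derivatives -/

section Growth

variable {n : ℕ}

theorem norm_exp_csq_update (c : ℝ) (ζ : Fin n → ℂ) (i : Fin n) (s : ℂ) :
    ‖Complex.exp (-(Real.pi / c) * csq (Function.update ζ i s))‖ =
      Real.exp (-(Real.pi / c) * (csq (Function.update ζ i 0)).re) *
        Real.exp (-(Real.pi / c * s.re ^ 2)) * Real.exp (Real.pi / c * s.im ^ 2) := by
  rw [Complex.norm_exp, csq_update, ← Real.exp_add, ← Real.exp_add]
  congr 1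
  have : (-((Real.pi : ℂ) / c)) = ((-(Real.pi / c) : ℝ) : ℂ) := by push_cast; ring
  rw [this, Complex.re_ofReal_mul, Complex.add_re, sq s, Complex.mul_re]
  ring

theorem cdot_update_I_mul_re (η : Rn n) (i : Fin n) (s : ℂ) (v : Rn n) :
    (cdot (Function.update (fun k => Complex.I * η k) i s) v).re = s.re * v i := by
  rw [cdot_apply, Complex.re_sum, Finset.sum_eq_single i]
  · simp
  · intro k _ hk
    simp [hk]
  · simp

/-- The real part of s moves the Gaussian and raises its height by exp(π (Re s)²/c). The normalising
factor cancels exactly this and leaves exp(π (Im s)²/c). `N` depends only on the order of `L`; `C`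
may depend on the other parameters. -/
theorem famQ_growth (L : 𝓢(Rn n × Rn n, ℂ) →L[ℂ] ℂ) (κ : ℝ) {b c : ℝ} (hb : 0 < b) (hc : 0 < c) :
    ∃ N : ℕ, ∀ (θ η : Rn n) (i : Fin n), ∃ C, 0 ≤ C ∧ ∀ s : ℂ,
      ‖famQ L κ hb hc θ (Function.update (fun k => Complex.I * η k) i s)‖ ≤
        C * (1 + ‖s‖) ^ N * Real.exp (Real.pi / c * s.im ^ 2) := by
  have hπ := Real.pi_pos
  obtain ⟨j, C0, hC0, hL⟩ := exists_bound_of_continuous L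
  obtain ⟨C1, hC1, hG⟩ := gradedSeminorm_gaussExp_le (famB (n := n) κ b c) (negDef_famB κ hb hc)
    (famEps_pos κ hb hc) j
  refine ⟨j + 2 * j, fun θ η i => ?_⟩
  set ζ : Fin n → ℂ := fun k => Complex.I * η k
  set ℓ0 := famL κ θ (Function.update ζ i 0)
  set ℓ1 : (Rn n × Rn n) →L[ℝ] ℂ := (2 * Real.pi : ℂ) • (coordC i).comp (devCLM κ)
  set r0 : ℝ := Real.exp (-(Real.pi / c) * (csq (Function.update ζ i 0)).re)
  set K1 : ℝ := 1 + ‖ℓ0‖ + ‖ℓ1‖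
  set K2 : ℝ := 1 + 1 / c
  have hK2 : 0 ≤ K2 := by positivity
  refine ⟨r0 * (C0 * C1 * K1 ^ j * K2 ^ (2 * j)), by positivity, fun s => ?_⟩
  have hs := norm_nonneg s
  have hl : 1 + ‖famL κ θ (Function.update ζ i s)‖ ≤ K1 * (1 + ‖s‖) := by
    rw [famL_update]
    have h1 := norm_add_le ℓ0 (s • ℓ1)
    rw [norm_smul] at h1
    have := mul_nonneg (norm_nonneg ℓ0) hs
    have := norm_nonneg ℓ1
    simp only [K1]
    nlinarith
  -- The centre obtained by completing the square in y - κx.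
  set a : Rn n × Rn n := (0, (s.re / c) • EuclideanSpace.single i (1 : ℝ))
  have ha : 1 + ‖a‖ ≤ K2 * (1 + ‖s‖) := by
    have h1 : ‖a‖ = |s.re| / c := by
      simp [a, norm_smul, abs_of_pos hc]
      positivity
    have h2 : |s.re| / c ≤ 1 / c * ‖s‖ := by
      rw [div_mul_eq_mul_div, one_mul]
      gcongr
      exact Complex.abs_re_le_norm s
    have h3 : 0 < 1 / c := by positivity
    rw [h1]
    simp only [K2]
    nlinarith
  have hM : ∀ v, (famB κ b c v v + famL κ θ (Function.update ζ i s) v).re ≤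
      Real.pi / c * s.re ^ 2 - famEps κ b c * ‖v - a‖ ^ 2 := by
    intro v
    have h1 := famEps_mul_norm_sq_le κ hb hc (v - a)
    have h2 : devCLM κ (v - a) = devCLM κ v - (s.re / c) • EuclideanSpace.single i (1 : ℝ) := by
      rw [map_sub]
      simp [a]
    have h3 : ‖devCLM κ (v - a)‖ ^ 2 =
        ‖devCLM κ v‖ ^ 2 - 2 * (s.re / c) * devCLM κ v i + (s.re / c) ^ 2 := by
      rw [h2, norm_sub_sq_real, inner_smul_right, EuclideanSpace.inner_single_right, norm_smul,
        Real.norm_eq_abs, mul_pow, sq_abs]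
      simp
      ring
    have h4 : (famL κ θ (Function.update ζ i s) v).re = 2 * Real.pi * (s.re * devCLM κ v i) := by
      rw [famL_apply, Complex.add_re, show (2 * (Real.pi : ℂ)) = ((2 * Real.pi : ℝ) : ℂ) by simp,
        Complex.re_ofReal_mul _ (cdot _ _), cdot_update_I_mul_re]
      simp
    rw [h3] at h1
    have h5 : (v - a).1 = v.1 := by simp [a]
    rw [h5] at h1
    rw [Complex.add_re, famB_self, Complex.ofReal_re, h4]
    have h6 : Real.pi * c * (‖devCLM κ v‖ ^ 2 - 2 * (s.re / c) * devCLM κ v i + (s.re / c) ^ 2) =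
        Real.pi * c * ‖devCLM κ v‖ ^ 2 - 2 * Real.pi * (s.re * devCLM κ v i) +
          Real.pi / c * s.re ^ 2 := by
      field_simp
    rw [h6] at h1
    linarith
  have h7 := (hL _).trans (mul_le_mul_of_nonneg_left (hG _ _ a hM) hC0)
  rw [famQ, norm_mul, norm_exp_csq_update]
  set X := Real.exp (Real.pi / c * s.re ^ 2)
  have hX : Real.exp (-(Real.pi / c * s.re ^ 2)) * X = 1 := by
    rw [← Real.exp_add, neg_add_cancel, Real.exp_zero]
  set Y := Real.exp (Real.pi / c * s.im ^ 2)
  calc _ ≤ r0 * Real.exp (-(Real.pi / c * s.re ^ 2)) * Y *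
        (C0 * (C1 * (K1 * (1 + ‖s‖)) ^ j * (K2 * (1 + ‖s‖)) ^ (2 * j) * X)) := by
        refine mul_le_mul_of_nonneg_left (h7.trans ?_) (by positivity)
        gcongr
    _ = r0 * (C0 * C1 * K1 ^ j * K2 ^ (2 * j)) * (1 + ‖s‖) ^ (j + 2 * j) * Y *
        (Real.exp (-(Real.pi / c * s.re ^ 2)) * X) := by
        rw [pow_add, mul_pow, mul_pow]
        ring
    _ = _ := by rw [hX, mul_one]

theorem norm_update_le (η : Rn n) (i : Fin n) (y : ℝ) :
    ‖(WithLp.toLp 2 (Function.update (fun k => η k) i y) : Rn n)‖ ≤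
      ‖(WithLp.toLp 2 (Function.update (fun k => η k) i 0) : Rn n)‖ + |y| := by
  have : (WithLp.toLp 2 (Function.update (fun k => η k) i y) : Rn n) =
      WithLp.toLp 2 (Function.update (fun k => η k) i 0) + EuclideanSpace.single i y := by
    ext k
    by_cases hk : k = i
    · subst hk
      simp
    · simp [hk]
  rw [this]
  refine (norm_add_le _ _).trans_eq ?_
  simp

/-- Phragmén–Lindelöf is applied in ζ_i with the other coordinates imaginary. The exponent `N'` is
uniform in θ, so that a single order of differentiation serves all modulations; the constants need
not be uniform. -/
theorem exists_comp_derivSnd_pow_eq_zero (L : 𝓢(Rn n × Rn n, ℂ) →L[ℂ] ℂ) (κ : ℝ) {b c : ℝ}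
    (hb : 0 < b) (hc : 0 < c) {N' : ℕ} (h : ∀ θ : Rn n, ∃ C, 0 ≤ C ∧ ∀ q : Rn n,
      ‖famQ L κ hb hc θ (fun k => Complex.I * q k)‖ ≤ C * (1 + ‖q‖) ^ N') :
    ∃ N : ℕ, ∀ i, L.comp (derivSnd i ^ (N + 1)) = 0 := by
  have hπ := Real.pi_pos
  obtain ⟨N1, h1⟩ := famQ_growth L κ hb hc
  refine ⟨max N1 N', fun i => ?_⟩
  refine eq_zero_of_apply_gaussExp _ (famB κ b c) (negDef_famB κ hb hc) fun lam => ?_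
  obtain ⟨θ, η, hlam⟩ := exists_famL_eq_imForm κ lam
  rw [hlam]
  set ζ : Fin n → ℂ := fun k => Complex.I * η k
  obtain ⟨C1, hC1, h1⟩ := h1 θ η i
  obtain ⟨C2, hC2, h2⟩ := h θ
  set A : ℝ := 1 + ‖(WithLp.toLp 2 (Function.update (fun k => η k) i 0) : Rn n)‖
  have hA : 1 ≤ A := by simp [A]
  have hle := norm_le_of_growth (N := max N1 N') (a := Real.pi / c) (C := max C1 (C2 * A ^ N'))
    (differentiable_famQ L κ hb hc θ ζ i) (by positivity) (hC1.trans (le_max_left _ _))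
    (fun z => by
      refine (h1 z).trans ?_
      gcongr
      · exact le_max_left _ _
      · linarith [norm_nonneg z]
      · exact le_max_left _ _)
    (fun y => by
      have h3 := h2 (WithLp.toLp 2 (Function.update (fun k => η k) i y))
      have h4 : (fun k => Complex.I *
          (((WithLp.toLp 2 (Function.update (fun k => η k) i y) : Rn n) k : ℝ) : ℂ)) =
          Function.update ζ i (y * Complex.I) := by
        ext k
        by_cases hk : k = i
        · subst hk
          simp [mul_comm]
        · simp [hk, ζ]
      rw [h4] at h3
      refine h3.trans ?_
      have h5 := norm_update_le η i y
      have h6 : 1 + ‖(WithLp.toLp 2 (Function.update (fun k => η k) i y) : Rn n)‖ ≤ A * (1 + |y|) := by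
        have := abs_nonneg y
        simp only [A] at hA ⊢
        nlinarith
      calc _ ≤ C2 * (A * (1 + |y|)) ^ N' := by gcongr
        _ = C2 * A ^ N' * (1 + |y|) ^ N' := by rw [mul_pow]; ring
        _ ≤ _ := by
          gcongr
          · exact le_max_right _ _
          · linarith [abs_nonneg y]
          · exact le_max_right _ _)
  -- At the point s = ζ_i the update is trivial, so the derivative is a nonzero multiple of the
  -- value of L ∘ ∂_{y_i}^{N+1} on the modulated Gaussian.
  have h0 := iteratedDeriv_eq_zero_of_norm_le (differentiable_famQ L κ hb hc θ ζ i) hle (ζ i)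
  rw [iteratedDeriv_famQ, Function.update_eq_self, famQ] at h0
  have hc' : (c : ℂ) ≠ 0 := by exact_mod_cast hc.ne'
  have hn : (-(1 / (c : ℂ))) ^ (max N1 N' + 1) ≠ 0 := pow_ne_zero _ (by simpa using hc')
  simpa only [mul_eq_zero, hn, Complex.exp_ne_zero, false_or] using h0

end Growth

/-! ### Polynomial bounds at imaginary parameters, from the extension of T exp(tΔ). -/

section Bound

variable {n : ℕ}

/-- The phase `2πi q·v`. -/
def phase (q : Rn n) : Rn n →L[ℝ] ℂ := (2 * Real.pi * Complex.I) • innerC (Rn n) q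

theorem phase_apply (q v : Rn n) : phase q v = 2 * Real.pi * Complex.I * (inner ℝ q v : ℝ) := rfl

theorem norm_phase_le (q : Rn n) : ‖phase q‖ ≤ 2 * Real.pi * ‖q‖ := by
  refine ContinuousLinearMap.opNorm_le_bound _ (by have := Real.pi_pos; positivity) fun v => ?_
  rw [phase_apply, norm_mul, Complex.norm_real]
  have : ‖2 * (Real.pi : ℂ) * Complex.I‖ = 2 * Real.pi := by
    simp [abs_of_pos Real.pi_pos]
  rw [this]
  have h1 := norm_inner_le_norm (𝕜 := ℝ) q v
  have := Real.pi_pos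
  calc _ ≤ 2 * Real.pi * (‖q‖ * ‖v‖) := by gcongr
    _ = _ := by ring

theorem gradedSeminorm_innerGauss_phase_le {a : ℝ} (ha : 0 < a) (j : ℕ) : ∃ C, 0 ≤ C ∧
    ∀ q : Rn n, gradedSeminorm (Rn n) j (innerGauss ha (phase q)) ≤ C * (1 + ‖q‖) ^ j := by
  have hπ := Real.pi_pos
  obtain ⟨C, hC, h⟩ := gradedSeminorm_gaussExp_le ((-a : ℂ) • innerC (Rn n)) (negDef_smul_innerC ha)
    ha j
  refine ⟨C * (1 + 2 * Real.pi) ^ j, by positivity, fun q => ?_⟩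
  refine (h (phase q) 0 0 fun v => ?_).trans ?_
  · simp [phase_apply]
    rw [← Complex.ofReal_pow, Complex.ofReal_re]
  · have h1 : 1 + ‖phase q‖ ≤ (1 + 2 * Real.pi) * (1 + ‖q‖) := by
      have := norm_phase_le q
      nlinarith [norm_nonneg q]
    rw [norm_zero, add_zero, one_pow, mul_one, Real.exp_zero, mul_one, mul_assoc, ← mul_pow]
    gcongr

theorem fourier_innerGauss_phase {a : ℝ} (ha : 0 < a) (q ξ : Rn n) :
    𝓕 (innerGauss ha (phase q)) ξ =
      (Real.pi / a : ℂ) ^ ((n : ℂ) / 2) * Complex.exp (-Real.pi ^ 2 * ‖q - ξ‖ ^ 2 / a) := by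
  have h := fourier_gaussian_innerProductSpace' (b := a) (by simpa using ha) q ξ
  rw [finrank_euclideanSpace_fin] at h
  rw [← h, SchwartzMap.fourier_coe]
  exact congrArg (fun f : Rn n → ℂ => 𝓕 f ξ) (funext fun v => by rw [innerGauss_apply, phase_apply])

/-- On the Fourier side, πt|ξ|² - 2πt|ξ - q/2|² = -πt|ξ - q|² + πt|q|²/2. So the preimage is a wider
Gaussian of half the frequency, with the gain e^{-πt|q|²/2}; `K` is the ratio of the two Fourier
constants. -/
theorem exists_isExpLaplacian {t : ℝ} (ht : 0 < t) (h1 : 0 < Real.pi / t)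
    (h2 : 0 < Real.pi / (2 * t)) :
    ∃ K : ℂ, ∀ q : Rn n, IsExpLaplacian t
      ((K * Complex.exp (-(Real.pi * t / 2) * ‖q‖ ^ 2)) •
        innerGauss h2 (phase ((1 / 2 : ℝ) • q))) (innerGauss h1 (phase q)) := by
  have hπ : (Real.pi : ℂ) ≠ 0 := by exact_mod_cast Real.pi_ne_zero
  have ht' : (t : ℂ) ≠ 0 := by exact_mod_cast ht.ne'
  set A : ℂ := ((Real.pi : ℂ) / (Real.pi / t : ℝ)) ^ ((n : ℂ) / 2)
  set B : ℂ := ((Real.pi : ℂ) / (Real.pi / (2 * t) : ℝ)) ^ ((n : ℂ) / 2)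
  have hB : B ≠ 0 := by
    have : (Real.pi : ℂ) / (Real.pi / (2 * t) : ℝ) ≠ 0 := div_ne_zero hπ (by exact_mod_cast h2.ne')
    exact fun h => this (Complex.cpow_eq_zero_iff _ _ |>.1 h).1
  refine ⟨A / B, fun q ξ => ?_⟩
  rw [FourierTransform.fourier_smul, smul_apply, fourier_innerGauss_phase, fourier_innerGauss_phase,
    smul_eq_mul]
  change A * _ = _ * (_ * (B * _))
  have h3 : (‖q - ξ‖ : ℂ) ^ 2 = (‖q‖ : ℂ) ^ 2 - 2 * (inner ℝ q ξ : ℝ) + (‖ξ‖ : ℂ) ^ 2 := by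
    rw [← Complex.ofReal_pow, norm_sub_sq_real]
    push_cast
    ring
  have h4 : (‖(1 / 2 : ℝ) • q - ξ‖ : ℂ) ^ 2 =
      (‖q‖ : ℂ) ^ 2 / 4 - (inner ℝ q ξ : ℝ) + (‖ξ‖ : ℂ) ^ 2 := by
    rw [← Complex.ofReal_pow, norm_sub_sq_real, norm_smul, inner_smul_left]
    simp
    ring
  have h5 : Complex.exp (-Real.pi ^ 2 * ‖q - ξ‖ ^ 2 / (Real.pi / t : ℝ)) =
      Complex.exp (t * (Real.pi * ‖ξ‖ ^ 2) : ℝ) * (Complex.exp (-(Real.pi * t / 2) * ‖q‖ ^ 2) *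
        Complex.exp (-Real.pi ^ 2 * ‖(1 / 2 : ℝ) • q - ξ‖ ^ 2 / (Real.pi / (2 * t) : ℝ))) := by
    rw [← Complex.exp_add, ← Complex.exp_add, h3, h4]
    congr 1
    push_cast
    field_simp
    ring
  rw [h5, Complex.ofReal_exp]
  field_simp

/-- The two weights cancel on compactly supported functions; both sides are tempered, so density
extends the equality. -/
theorem apply_eq_apply_smulLeft_gaussWeight {s : ℝ} {Φ Ψ : 𝓢'(Rn n × Rn n, ℂ)}
    (h : ∀ (φ : 𝓢(Rn n × Rn n, ℂ)) (hφ : HasCompactSupport φ),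
      Ψ φ = Φ (mulCompact (gaussWeight s) (contDiff_gaussWeight s) φ hφ))
    (hw : (gaussWeight (n := n) (-s)).HasTemperateGrowth)
    (F : 𝓢(Rn n × Rn n, ℂ)) :
    Φ F = Ψ (SchwartzMap.smulLeftCLM ℂ (gaussWeight (-s)) F) := by
  let A : 𝓢(Rn n × Rn n, ℂ) →L[ℂ] ℂ := Φ
  let B : 𝓢(Rn n × Rn n, ℂ) →L[ℂ] ℂ := Ψ
  have : A = B.comp (SchwartzMap.smulLeftCLM ℂ (gaussWeight (-s))) := by
    refine ext_of_hasCompactSupport fun φ hφ => ?_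
    have hψ : HasCompactSupport (SchwartzMap.smulLeftCLM ℂ (gaussWeight (n := n) (-s)) φ) := by
      have : (SchwartzMap.smulLeftCLM ℂ (gaussWeight (n := n) (-s)) φ : Rn n × Rn n → ℂ) =
          fun v => gaussWeight (-s) v * φ v := by
        ext v
        rw [SchwartzMap.smulLeftCLM_apply_apply hw, smul_eq_mul]
      rw [this]
      exact hφ.mul_left
    refine Eq.trans ?_ (h _ hψ).symm
    change Φ φ = Φ _
    congr 1
    ext v
    rw [mulCompact_apply, SchwartzMap.smulLeftCLM_apply_apply hw, smul_eq_mul, ← mul_assoc]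
    simp only [gaussWeight]
    rw [← Complex.ofReal_mul, ← Real.exp_add, neg_mul, neg_mul, add_neg_cancel, Real.exp_zero,
      Complex.ofReal_one, one_mul]
  exact congrArg (fun L : 𝓢(Rn n × Rn n, ℂ) →L[ℂ] ℂ => L F) this

theorem hasTemperateGrowth_gaussWeight {s : ℝ} (hs : s ≤ 0) :
    (gaussWeight (n := n) s).HasTemperateGrowth := by
  have hsub : (fun p : Rn n × Rn n => p.1 - p.2).HasTemperateGrowth :=
    (ContinuousLinearMap.fst ℝ (Rn n) (Rn n) -
      ContinuousLinearMap.snd ℝ (Rn n) (Rn n)).hasTemperateGrowth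
  have hq : (fun p : Rn n × Rn n => s * Real.pi * ‖p.1 - p.2‖ ^ 2).HasTemperateGrowth :=
    (Function.HasTemperateGrowth.const _).mul
      ((Function.hasTemperateGrowth_norm_sq (Rn n)).comp hsub)
  exact Function.Complex.hasTemperateGrowth_ofReal.comp (hasTemperateGrowth_exp_of_nonpos hq fun p =>
    mul_nonpos_of_nonpos_of_nonneg (mul_nonpos_of_nonpos_of_nonneg hs Real.pi_pos.le) (by positivity))

theorem exists_derivSnd_pow_eq_zero {t : ℝ} (ht : 0 < t) {T : 𝓢(Rn n, ℂ) →L[ℂ] 𝓢'(Rn n, ℂ)}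
    (hT : CompExpLaplacianIsTempered t T) {Φ Ψ : 𝓢'(Rn n × Rn n, ℂ)} (hΦ : IsSchwartzKernel T Φ)
    (h : ∀ F, Φ F = Ψ (SchwartzMap.smulLeftCLM ℂ (gaussWeight (-(1 / t))) F)) :
    ∃ N : ℕ, ∀ i, (Ψ : 𝓢(Rn n × Rn n, ℂ) →L[ℂ] ℂ).comp (derivSnd i ^ (N + 1)) = 0 := by
  have hπ := Real.pi_pos
  have hπ' : (Real.pi : ℂ) ≠ 0 := by exact_mod_cast hπ.ne'
  have ht' : (t : ℂ) ≠ 0 := by exact_mod_cast ht.ne'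
  obtain ⟨S, hS⟩ := hT
  have hb : 0 < 1 / t := by positivity
  have hc : 0 < 2 / t := by positivity
  have h1 : 0 < Real.pi / t := by positivity
  have h2 : 0 < Real.pi / (2 * t) := by positivity
  obtain ⟨K, hK⟩ := exists_isExpLaplacian (n := n) ht h1 h2
  obtain ⟨j, C0, hC0, hSb⟩ := exists_bound_of_separately_continuous S
  obtain ⟨C1, hC1, hG⟩ := gradedSeminorm_innerGauss_phase_le (n := n) h2 j
  -- With κ = 1/2, b = 1/t, c = 2/t, the form b|x|² + c|y-κx|² equals |x-y|²/t + |x|²/(2t) + |y|²/t: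
  -- the weight times a tensor product. Each factor of the product contributes `j` to the degree.
  refine exists_comp_derivSnd_pow_eq_zero _ (1 / 2) hb hc (N' := j + j) fun θ => ?_
  refine ⟨‖K‖ * (C0 * C1 * C1 * (1 + ‖θ‖) ^ j), by positivity, fun q => ?_⟩
  set f := innerGauss h1 (phase q)
  set g := innerGauss h2 (phase (θ - (1 / 2 : ℝ) • q))
  set f' := innerGauss h2 (phase ((1 / 2 : ℝ) • q))
  have hfam : SchwartzMap.smulLeftCLM ℂ (gaussWeight (-(1 / t))) (outer g f) =
      gaussExp (famB (1 / 2) (1 / t) (2 / t)) (negDef_famB (1 / 2) hb hc)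
        (famL (1 / 2) θ (fun k => Complex.I * q k)) := by
    ext ⟨x, y⟩
    rw [SchwartzMap.smulLeftCLM_apply_apply (hasTemperateGrowth_gaussWeight (by linarith)),
      outer_apply, smul_eq_mul, innerGauss_apply, innerGauss_apply, gaussExp_apply, gaussWeight,
      Complex.ofReal_exp, ← Complex.exp_add, ← Complex.exp_add, famB_self, famL_apply, phase_apply,
      phase_apply]
    have hcd : cdot (fun k => Complex.I * (q k : ℂ)) (devCLM (1 / 2) (x, y)) =
        Complex.I * (inner ℝ q (devCLM (1 / 2) (x, y)) : ℝ) := by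
      rw [cdot_apply, PiLp.inner_apply, Complex.ofReal_sum, Finset.mul_sum]
      refine Finset.sum_congr rfl fun i _ => ?_
      simp only [RCLike.inner_apply, conj_trivial, Complex.ofReal_mul]
      ring
    rw [hcd, devCLM_apply]
    have e1 : ‖y - (1 / 2 : ℝ) • x‖ ^ 2 = ‖y‖ ^ 2 - inner ℝ x y + ‖x‖ ^ 2 / 4 := by
      rw [norm_sub_sq_real, norm_smul, inner_smul_right, real_inner_comm]
      simp
      ring
    have e2 : ‖x - y‖ ^ 2 = ‖x‖ ^ 2 - 2 * inner ℝ x y + ‖y‖ ^ 2 := norm_sub_sq_real x y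
    have e3 : inner ℝ q (y - (1 / 2 : ℝ) • x) = inner ℝ q y - inner ℝ q x / 2 := by
      rw [inner_sub_right, inner_smul_right]
      ring
    have e4 : inner ℝ (θ - (1 / 2 : ℝ) • q) x = inner ℝ θ x - inner ℝ q x / 2 := by
      rw [inner_sub_left, inner_smul_left]
      simp
      ring
    rw [e1, e2, e3, e4]
    congr 1
    push_cast
    field_simp
    ring
  have hval : Ψ (gaussExp (famB (1 / 2) (1 / t) (2 / t)) (negDef_famB (1 / 2) hb hc)
      (famL (1 / 2) θ (fun k => Complex.I * q k))) =
      K * Complex.exp (-(Real.pi * t / 2) * ‖q‖ ^ 2) * S f' g := by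
    rw [← hfam, ← h, ← hΦ, ← hS _ _ (hK q), map_smul]
    rfl
  have hcsq : csq (fun k => Complex.I * (q k : ℂ)) = -(‖q‖ : ℂ) ^ 2 := by
    rw [← Complex.ofReal_pow, EuclideanSpace.real_norm_sq_eq, csq]
    simp [mul_pow]
  -- At ζ = iq the normalising factor is e^{πt|q|²/2}, the inverse of the gain in
  -- `exists_isExpLaplacian`.
  have hQ : famQ Ψ (1 / 2) hb hc θ (fun k => Complex.I * q k) = K * S f' g := by
    change Complex.exp _ * Ψ _ = _
    rw [hval, hcsq, mul_right_comm K, mul_left_comm, ← Complex.exp_add]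
    have : -((Real.pi : ℂ) / (2 / t : ℝ)) * -(‖q‖ : ℂ) ^ 2 + -(Real.pi * t / 2) * ‖q‖ ^ 2 = 0 := by
      push_cast
      field_simp
      ring
    rw [this, Complex.exp_zero, mul_one]
  rw [hQ, norm_mul, mul_assoc]
  refine mul_le_mul_of_nonneg_left ((hSb f' g).trans ?_) (norm_nonneg _)
  have hq := norm_nonneg q
  have hθ := norm_nonneg θ
  have hhalf : ‖(1 / 2 : ℝ) • q‖ ≤ ‖q‖ := by
    rw [norm_smul]
    norm_num
    linarith
  have b1 : gradedSeminorm (Rn n) j f' ≤ C1 * (1 + ‖q‖) ^ j := (hG _).trans (by gcongr)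
  have b2 : gradedSeminorm (Rn n) j g ≤ C1 * ((1 + ‖θ‖) * (1 + ‖q‖)) ^ j := by
    refine (hG _).trans ?_
    have : 1 + ‖θ - (1 / 2 : ℝ) • q‖ ≤ (1 + ‖θ‖) * (1 + ‖q‖) := by
      have := norm_sub_le θ ((1 / 2 : ℝ) • q)
      nlinarith [mul_nonneg hθ hq]
    gcongr
  calc _ ≤ C0 * (C1 * (1 + ‖q‖) ^ j) * (C1 * ((1 + ‖θ‖) * (1 + ‖q‖)) ^ j) := by gcongr
    _ = _ := by
      rw [mul_pow, pow_add]
      ring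

end Bound

/-! ### Expansion of a distribution annihilated by transversal derivatives -/

section Expansion

variable {n : ℕ}

/-- The monomial `(x - y)^α`. -/
def polyDev (α : Fin n → ℕ) (p : Rn n × Rn n) : ℂ := ((∏ i, (p.1 i - p.2 i) ^ α i : ℝ) : ℂ)

theorem hasTemperateGrowth_polyDev (α : Fin n → ℕ) : (polyDev α).HasTemperateGrowth := by
  have hsub : (fun p : Rn n × Rn n => p.1 - p.2).HasTemperateGrowth :=
    (ContinuousLinearMap.fst ℝ (Rn n) (Rn n) -
      ContinuousLinearMap.snd ℝ (Rn n) (Rn n)).hasTemperateGrowth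
  exact Function.Complex.hasTemperateGrowth_ofReal.comp
    (hasTemperateGrowth_prod Finset.univ fun i =>
    (((EuclideanSpace.proj i : Rn n →L[ℝ] ℝ).hasTemperateGrowth).comp hsub).pow (α i))

theorem gaussExp_famB_one_apply (θ : Rn n) (ζ : Fin n → ℂ) (x y : Rn n) :
    gaussExp (famB 1 1 1) (negDef_famB 1 one_pos one_pos) (famL 1 θ ζ) (x, y) =
      innerGauss Real.pi_pos (phase θ) x *
        innerGauss Real.pi_pos ((2 * Real.pi : ℂ) • cdot ζ) (y - x) := by
  rw [gaussExp_apply, innerGauss_apply, innerGauss_apply, ← Complex.exp_add, famB_self, famL_apply,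
    phase_apply, devCLM_apply, smul_apply, one_smul, smul_eq_mul]
  congr 1
  push_cast
  ring

theorem gaussExp_famB_one (θ : Rn n) (ζ : Fin n → ℂ) :
    gaussExp (famB 1 1 1) (negDef_famB 1 one_pos one_pos) (famL 1 θ ζ) =
      shearOuterCLM (innerGauss Real.pi_pos ((2 * Real.pi : ℂ) • cdot ζ))
        (innerGauss Real.pi_pos (phase θ)) := by
  ext ⟨x, y⟩
  rw [gaussExp_famB_one_apply, shearOuterCLM_apply]

theorem innerGauss_cdot_apply (ζ : Fin n → ℂ) (w : Rn n) :
    innerGauss Real.pi_pos ((2 * Real.pi : ℂ) • cdot ζ) w =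
      Complex.exp (Real.pi * csq ζ) * ∏ i, Complex.exp (-Real.pi * (w i - ζ i) ^ 2) := by
  rw [innerGauss_apply, ← Complex.exp_sum, ← Complex.exp_add, smul_apply, cdot_apply, smul_eq_mul,
    ← Complex.ofReal_pow, EuclideanSpace.real_norm_sq_eq, csq, Complex.ofReal_sum, Finset.mul_sum,
    Finset.mul_sum, Finset.mul_sum, ← Finset.sum_add_distrib, ← Finset.sum_add_distrib]
  congr 1
  refine Finset.sum_congr rfl fun i _ => ?_
  push_cast
  ring

/-- The substitution y = w + x separates the variables; x - y = -w accounts for the sign. -/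
theorem fiberIntegralCLM_polyDev_gaussExp (α : Fin n → ℕ) (θ : Rn n) (ζ : Fin n → ℂ) :
    fiberIntegralCLM (polyDev α)
      (gaussExp (famB 1 1 1) (negDef_famB 1 one_pos one_pos) (famL 1 θ ζ)) =
      ((∏ i, (-1 : ℂ) ^ α i) * Complex.exp (Real.pi * csq ζ) * ∏ i, moment (α i) (ζ i)) •
        innerGauss Real.pi_pos (phase θ) := by
  ext x
  rw [fiberIntegralCLM_apply _ (hasTemperateGrowth_polyDev α), fiberIntegral_apply, smul_apply,
    ← integral_add_right_eq_self _ x, ← integral_prod_moment, smul_eq_mul,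
    mul_comm _ (innerGauss _ _ _), ← mul_assoc, ← integral_const_mul]
  refine integral_congr_ae (.of_forall fun w => ?_)
  simp only
  rw [gaussExp_famB_one_apply, add_sub_cancel_right, innerGauss_cdot_apply, Finset.prod_mul_distrib]
  have : polyDev α (x, w + x) = (∏ i, (-1 : ℂ) ^ α i) * ∏ i, (w i : ℂ) ^ α i := by
    rw [polyDev, Complex.ofReal_prod, ← Finset.prod_mul_distrib]
    refine Finset.prod_congr rfl fun i _ => ?_
    rw [← mul_pow]
    simp
  rw [this]
  ring

/-- A distribution annihilated by high derivatives in `y` is, up to Gaussian averaging in `y - x`,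
a polynomial in `x - y` with distributional coefficients in `x`. -/
theorem exists_expansion (L : 𝓢(Rn n × Rn n, ℂ) →L[ℂ] ℂ) {N : ℕ}
    (h : ∀ i, L.comp (derivSnd i ^ (N + 1)) = 0) :
    ∃ M : (Fin n → ℕ) → (𝓢(Rn n, ℂ) →L[ℂ] ℂ), ∀ F,
      L F = ∑ α ∈ Fintype.piFinset fun _ => Finset.range (N + 1),
        M α (fiberIntegralCLM (polyDev α) F) := by
  obtain ⟨c, hc⟩ := exists_interpolation N
  let x : Fin (N + 1) → ℂ := fun j => ((j : ℕ) : ℂ)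
  -- Read off from the interpolation formula: `L` on g(x) γ(y-x), with γ the Gaussian at a grid
  -- node, weighted by the moment coefficients of the Lagrange polynomials.
  let M : (Fin n → ℕ) → (𝓢(Rn n, ℂ) →L[ℂ] ℂ) := fun α => (∏ i, (-1 : ℂ) ^ α i) •
    ∑ j : Fin n → Fin (N + 1),
      ((∏ i, c (j i) (α i)) * Complex.exp (-Real.pi * csq fun i => x (j i))) •
      L.comp (shearOuterCLM (innerGauss Real.pi_pos ((2 * Real.pi : ℂ) • cdot fun i => x (j i))))
  refine ⟨M, fun F => ?_⟩
  let R : 𝓢(Rn n × Rn n, ℂ) →L[ℂ] ℂ := ∑ α ∈ Fintype.piFinset fun _ => Finset.range (N + 1),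
    (M α).comp (fiberIntegralCLM (polyDev α))
  have hLR : L - R = 0 := by
    refine eq_zero_of_apply_gaussExp _ (famB 1 1 1) (negDef_famB 1 one_pos one_pos) fun lam => ?_
    obtain ⟨θ, η, hlam⟩ := exists_famL_eq_imForm 1 lam
    rw [hlam]
    set ζ : Fin n → ℂ := fun k => Complex.I * η k
    -- The hypothesis on `L` makes the derivative of order N + 1 of `famQ` vanish in each
    -- coordinate, so the grid values determine it.
    have hQ := multi_interpolation x (fun j z => ∑ k ∈ Finset.range (N + 1), c j k * moment k z) n
      (fun ζ => famQ L 1 one_pos one_pos θ ζ) (fun ζ i => by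
        have := hc (fun s => famQ L 1 one_pos one_pos θ (Function.update ζ i s))
          (differentiable_famQ L 1 one_pos one_pos θ ζ i)
          (iteratedDeriv_famQ_eq_zero (h i) 1 one_pos one_pos θ ζ) (ζ i)
        simpa only [Function.update_eq_self] using this) ζ
    have hfam : ∀ ζ : Fin n → ℂ, famQ L 1 one_pos one_pos θ ζ = Complex.exp (-Real.pi * csq ζ) *
        L (gaussExp (famB 1 1 1) (negDef_famB 1 one_pos one_pos) (famL 1 θ ζ)) := by
      intro ζ
      simp [famQ]
    have hL : L (gaussExp (famB 1 1 1) (negDef_famB 1 one_pos one_pos) (famL 1 θ ζ)) =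
        Complex.exp (Real.pi * csq ζ) * famQ L 1 one_pos one_pos θ ζ := by
      rw [hfam, ← mul_assoc, ← Complex.exp_add]
      simp
    have hMα : ∀ α, M α (innerGauss Real.pi_pos (phase θ)) = (∏ i, (-1 : ℂ) ^ α i) *
        ∑ j : Fin n → Fin (N + 1), (∏ i, c (j i) (α i)) *
          famQ L 1 one_pos one_pos θ (fun i => x (j i)) := by
      intro α
      simp only [M, smul_apply, sum_apply, ContinuousLinearMap.comp_apply, ← gaussExp_famB_one, hfam,
        smul_eq_mul, mul_assoc]
    have hsign : ∀ α : Fin n → ℕ, (∏ i, (-1 : ℂ) ^ α i) * (∏ i, (-1 : ℂ) ^ α i) = 1 := by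
      intro α
      rw [← Finset.prod_mul_distrib]
      exact Finset.prod_eq_one fun i _ => by rw [← mul_pow]; simp
    rw [sub_apply, sub_eq_zero, hL, hQ]
    simp only [R, sum_apply, ContinuousLinearMap.comp_apply, fiberIntegralCLM_polyDev_gaussExp,
      map_smul, hMα, smul_eq_mul, Finset.prod_univ_sum, Finset.mul_sum]
    rw [Finset.sum_comm]
    refine Finset.sum_congr rfl fun α _ => Finset.sum_congr rfl fun j _ => ?_
    rw [Finset.prod_mul_distrib]
    linear_combination -(Complex.exp (Real.pi * csq ζ) * (∏ i, moment (α i) (ζ i)) *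
      (∏ i, c (j i) (α i)) * famQ L 1 one_pos one_pos θ (fun i => x (j i))) * hsign α
  have h1 : L F = R F := by rw [sub_eq_zero.1 hLR]
  rw [h1]
  simp [R]

theorem fiberIntegralCLM_polyDev_gaussWeight {t : ℝ} (ht : 0 < t) (α : Fin n → ℕ)
    (F : 𝓢(Rn n × Rn n, ℂ)) :
    fiberIntegralCLM (polyDev α) (SchwartzMap.smulLeftCLM ℂ (gaussWeight (-(1 / t))) F) =
      ((t ^ ((n : ℝ) / 2) : ℝ) : ℂ) •
        fiberIntegral (polyHeat t α) (hasTemperateGrowth_polyHeat ht α) F := by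
  have hneg : -(1 / t) ≤ 0 := by
    have : 0 < 1 / t := by positivity
    linarith
  have ht0 : ((t ^ ((n : ℝ) / 2) : ℝ) : ℂ) ≠ 0 := by
    exact_mod_cast (Real.rpow_pos_of_pos ht _).ne'
  ext x
  rw [fiberIntegralCLM_apply _ (hasTemperateGrowth_polyDev α), fiberIntegral_apply, smul_apply,
    fiberIntegral_apply, smul_eq_mul, ← integral_const_mul]
  refine integral_congr_ae (.of_forall fun y => ?_)
  simp only
  rw [SchwartzMap.smulLeftCLM_apply_apply (hasTemperateGrowth_gaussWeight hneg), smul_eq_mul, polyDev,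
    polyHeat, gaussWeight, heatKernel]
  have : -(1 / t) * Real.pi * ‖x - y‖ ^ 2 = -(Real.pi * ‖x - y‖ ^ 2 / t) := by
    field_simp
  rw [this]
  push_cast
  field_simp

end Expansion

end HardyOperators

end

/-! ### The main theorem. -/

theorem mainTheorem2 (n : ℕ) (t : ℝ) (ht : 0 < t)
    (T : 𝓢(HardyOperators.Rn n, ℂ) →L[ℂ] 𝓢'(HardyOperators.Rn n, ℂ))
    (hT : HardyOperators.CompExpLaplacianIsTempered t T)
    (Φ : 𝓢'(HardyOperators.Rn n × HardyOperators.Rn n, ℂ))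
    (hΦ : HardyOperators.IsSchwartzKernel T Φ)
    (hE : HardyOperators.MulIsTempered (HardyOperators.gaussWeight (1 / t))
      (HardyOperators.contDiff_gaussWeight (1 / t)) Φ) :
    ∃ N : ℕ, 0 < N ∧ ∃ M : (Fin n → ℕ) → 𝓢'(HardyOperators.Rn n, ℂ),
      ∀ F : 𝓢(HardyOperators.Rn n × HardyOperators.Rn n, ℂ),
        Φ F = ∑ α ∈ HardyOperators.multiIndices n N,
          M α (HardyOperators.fiberIntegral (HardyOperators.polyHeat t α)
            (HardyOperators.hasTemperateGrowth_polyHeat ht α) F) := by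
  classical
  obtain ⟨Ψ, hΨ⟩ := hE
  have hneg : -(1 / t) ≤ 0 := by
    have : 0 < 1 / t := by positivity
    linarith
  have hΦΨ := HardyOperators.apply_eq_apply_smulLeft_gaussWeight hΨ
    (HardyOperators.hasTemperateGrowth_gaussWeight hneg)
  obtain ⟨N, hN⟩ := HardyOperators.exists_derivSnd_pow_eq_zero ht hT hΦ hΦΨ
  obtain ⟨M, hM⟩ := HardyOperators.exists_expansion
    (Ψ : 𝓢(HardyOperators.Rn n × HardyOperators.Rn n, ℂ) →L[ℂ] ℂ) hN
  -- The factor t^{n/2} undoes the normalisation of the heat kernel; outside the box α_i ≤ N the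
  -- coefficients are 0.
  let M' : (Fin n → ℕ) → (𝓢(HardyOperators.Rn n, ℂ) →L[ℂ] ℂ) := fun α =>
    if α ∈ Fintype.piFinset fun _ => Finset.range (N + 1) then
      ((t ^ ((n : ℝ) / 2) : ℝ) : ℂ) • M α else 0
  -- The box has total degree at most nN; the added 1 only ensures positivity.
  refine ⟨n * N + 1, Nat.succ_pos _, fun α => M' α, fun F => ?_⟩
  refine (hΦΨ F).trans ((hM _).trans ?_)
  have hsub : (Fintype.piFinset fun _ : Fin n => Finset.range (N + 1)) ⊆
      HardyOperators.multiIndices n (n * N + 1) := by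
    intro α hα
    rw [HardyOperators.mem_multiIndices]
    refine (Finset.sum_le_card_nsmul _ _ N fun i _ => ?_).trans (by simp)
    exact Nat.lt_succ_iff.1 (Finset.mem_range.1 (Fintype.mem_piFinset.1 hα i))
  change _ = ∑ α ∈ _, M' α _
  rw [← Finset.sum_subset hsub fun α _ hα => by simp only [M', if_neg hα]; rfl]
  refine Finset.sum_congr rfl fun α hα => ?_
  rw [HardyOperators.fiberIntegralCLM_polyDev_gaussWeight ht, map_smul]
  simp only [M', if_pos hα]
  rfl
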